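/- Let $M>0$, $h(r)=1-\frac{2M}{r}$, and let the Kruskal extension be $\{(T,X,\omega)\in\mathbb R^2\times S^2: X^2-T^2>-2M\}$ with the metric $\frac{16M^2e^{-r/2M}}{r}(-dT^2+dX^2)+r^2g_{S^2}$, where $r>0$ is given by $(r-2M)e^{r/2M}=X^2-T^2$; $\partial_T$ is future directed. Put $E_\pm=e^{(r\pm t)/4M}$. Regions I and I' are the images of $\{r>2M\}$, $t\in\mathbb R$, under $(T,X)=\pm\tfrac12\sqrt{r-2M}\,(E_+-E_-,\,E_++E_-)$, with sign $+$ for I and $-$ for I'; region II' is the image of $\{0<r<2M\}$, $t\in\mathbb R$, under $(T,X)=-\tfrac12\sqrt{2M-r}\,(E_++E_-,\,E_+-E_-)$. An SS-CMC hypersurface of mean curvature $H$ is a smooth embedded spacelike spherically symmetric hypersurface whose mean curvature (one third of the trace of the second fundamental form $\langle\nabla_\cdot N,\cdot\rangle$, with $N$ the future directed unit normal) is the constant $H\in\mathbb R$. It is called complete if it is closed in the Kruskal extension and each $C^1$ curve of finite length in it, defined on $(0,1)$, either converges at $1$ to a point of it or satisfies $r\to0$ at $1$ (runs into the singularity). For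 constants $c,\bar c$ and base points $r_1,r_3>2M$ and $r_4,r_4'$ in the domain described below, let $$l_1=\tfrac{1}{\sqrt{h}}\Big(Hr+\tfrac{c}{r^2}\Big),\qquad l_3=-l_1,\qquad l_4=\tfrac1{\sqrt{-h}}\Big(Hr+\tfrac{c}{r^2}\Big),$$ $$f_i(r)=\int_{r_i}^r\frac{l_i}{h}\sqrt{\frac1{1+l_i^2}}\,dr+\bar c\quad(i=1,3,\ r>2M),$$ $$f_4^{*}(r)=\int_{r_4}^r\frac{1}{-h}\sqrt{\frac{l_4^2}{l_4^2-1}}\,dr+\bar c,\qquad f_4^{**}(r)=\int_{r_4'}^r\frac{1}{h}\sqrt{\frac{l_4^2}{l_4^2-1}}\,dr+\bar c .$$ Let $\Sigma^1_{H,c,\bar c}$ and $\Sigma^3_{H,c,\bar c}$ be the graphs $t=f_1(r)$ in region I and $t=f_3(r)$ in region I'. Let $\tilde k_H(r)=-Hr^3+r^{3/2}(2M-r)^{1/2}$ on $(0,2M)$. The functions $f_4^*$, $f_4^{**}$ are defined where $\tilde k_H<c$, and also at points with $\tilde k_H=c$ at which they stay finite; only the part of this domain that reaches up to $r=2M$ is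 used, and $\Sigma^4$ denotes the corresponding graph(s) in region II'. The function $\tilde k_H$ has a unique maximum point $R_H\in(0,2M)$, and $-3HR_H^{3/2}(2M-R_H)^{1/2}=2R_H-3M$. Let $C_H=\tilde k_H(R_H)$. **Theorem.** Let $H\in\mathbb R$, $c_1>-8M^3H$ and $\bar c_1\in\mathbb R$. Then $\Sigma^1=\Sigma^1_{H,c_1,\bar c_1}$ is an SS-CMC hypersurface of mean curvature $H$ in region I, and for some $\bar c_4'$ it joins smoothly, along a sphere of $\{X+T=0,\ X>0\}$ that lies in the closure of both, with an SS-CMC hypersurface $\Sigma^4=\Sigma^4_{H,c_1,\bar c_4'}$ of mean curvature $H$ in region II'. That is, the union of the two with this sphere is again a smooth SS-CMC hypersurface of mean curvature $H$. Moreover (unions of hypersurfaces include the joining spheres): (a) If $c_1>C_H$, then $\Sigma^4$ is the graph of $f_4^{**}$, defined on $(0,2M)$, and $\Sigma^1\cup\Sigma^4$ is a complete, smooth, connected SS-CMC hypersurface of the Kruskal extension with exactly two ends. (b) If $c_1=C_H$, then $\Sigma^4$ is the graph of $f_4^{**}$, defined on $(R_H,2M)$, and $\Sigma^1\cup\Sigma^4$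 is a complete, smooth, connected SS-CMC hypersurface of the Kruskal extension with exactly two ends. (c) If $-8M^3H<c_1<C_H$, then $f_4^*$ and $f_4^{**}$ are defined on $[r'',2M)$ for the $r''\in(R_H,2M)$ with $\tilde k_H(r'')=c_1$, and $\Sigma^4$ is the union of the graphs of $f_4^*$ and $f_4^{**}$ with $r_4=r_4'=r''$ and the same additive constant $\bar c_4'$. For some $\bar c_3$, $\Sigma^4$ also joins smoothly, along a sphere of $\{X=T<0\}$, with $\Sigma^3=\Sigma^3_{H,c_1,\bar c_3}$ in region I', and $\Sigma^1\cup\Sigma^4\cup\Sigma^3$ is a complete, smooth, connected SS-CMC hypersurface of the Kruskal extension with exactly two ends. -/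

import Mathlib

open Set Filter Topology MeasureTheory
open scoped ContDiff

noncomputable section

/-! ### The Kruskal extension of mass `M` -/

/-- Euclidean three-space. -/
abbrev E3 : Type := EuclideanSpace ℝ (Fin 3)

/-- The round unit two-sphere. -/
abbrev S2 : Type := Metric.sphere (0 : E3) 1

/-- Triples `(T, X, ω)`; the Kruskal extension is an open subset of this space. -/
abbrev KPoint : Type := ℝ × ℝ × S2

/-- The Kruskal extension `X² - T² > -2M` (that is, `r > 0`). -/
def Kruskal (M : ℝ) : Set KPoint := {p | -(2 * M) < p.2.1 ^ 2 - p.1 ^ 2}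

/-- The area radius: the positive solution `r` of `(r - 2M) e^{r / 2M} = X² - T²`. -/
def kruskalR (M T X : ℝ) : ℝ :=
  Function.invFunOn (fun r : ℝ => (r - 2 * M) * Real.exp (r / (2 * M))) (Ioi 0) (X ^ 2 - T ^ 2)

/-- The factor `16 M² e^{-r / 2M} / r` of `-dT² + dX²` in the Kruskal metric. -/
def kruskalA (M T X : ℝ) : ℝ :=
  16 * M ^ 2 * Real.exp (-(kruskalR M T X) / (2 * M)) / kruskalR M T X

/-- The point of the unit sphere with polar angle `θ` and azimuth `φ`. -/
def spherePoint (θ φ : ℝ) : S2 :=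
  ⟨!₂[Real.sin θ * Real.cos φ, Real.sin θ * Real.sin φ, Real.cos θ], by
    have h1 := Real.sin_sq_add_cos_sq θ
    have h2 := Real.sin_sq_add_cos_sq φ
    rw [mem_sphere_zero_iff_norm, EuclideanSpace.norm_eq, Real.sqrt_eq_one]
    simp only [Fin.sum_univ_three, Real.norm_eq_abs, sq_abs]
    simp
    linear_combination h1 + Real.sin θ ^ 2 * h2⟩

/-- The point with coordinates `x = (T, X, θ, φ)`. -/
def chartPoint (x : Fin 4 → ℝ) : KPoint := (x 0, x 1, spherePoint (x 2) (x 3))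

/-- The Kruskal metric
`(16 M² e^{-r / 2M} / r) (-dT² + dX²) + r² dθ² + r² sin² θ dφ²` in the coordinates
`(T, X, θ, φ)`. -/
def kruskalMetric (M : ℝ) (x : Fin 4 → ℝ) : Matrix (Fin 4) (Fin 4) ℝ :=
  Matrix.diagonal ![-kruskalA M (x 0) (x 1), kruskalA M (x 0) (x 1),
    kruskalR M (x 0) (x 1) ^ 2, kruskalR M (x 0) (x 1) ^ 2 * Real.sin (x 2) ^ 2]

/-! ### Lorentzian geometry in coordinates -/

/-- The partial derivative `∂ᵢ f`. -/
def pd (i : Fin 4) (f : (Fin 4 → ℝ) → ℝ) (x : Fin 4 → ℝ) : ℝ :=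
  fderiv ℝ f x (Pi.single i 1)

/-- The Christoffel symbol `Γᵏᵢⱼ` of the metric `g`. -/
def christoffel (g : (Fin 4 → ℝ) → Matrix (Fin 4) (Fin 4) ℝ) (k i j : Fin 4)
    (x : Fin 4 → ℝ) : ℝ :=
  (1 / 2) * ∑ l, (g x)⁻¹ k l *
    (pd i (fun y => g y j l) x + pd j (fun y => g y i l) x - pd l (fun y => g y i j) x)

/-- The gradient `∇F`. -/
def grad (g : (Fin 4 → ℝ) → Matrix (Fin 4) (Fin 4) ℝ) (F : (Fin 4 → ℝ) → ℝ)
    (x : Fin 4 → ℝ) : Fin 4 → ℝ :=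
  fun i => ∑ j, (g x)⁻¹ i j * pd j F x

/-- `⟨∇F, ∇F⟩`. -/
def gradSq (g : (Fin 4 → ℝ) → Matrix (Fin 4) (Fin 4) ℝ) (F : (Fin 4 → ℝ) → ℝ)
    (x : Fin 4 → ℝ) : ℝ :=
  ∑ i, ∑ j, g x i j * grad g F x i * grad g F x j

/-- The unit normal `N = ∇F / √(-⟨∇F, ∇F⟩)` of the spacelike level sets of `F`. -/
def unitNormal (g : (Fin 4 → ℝ) → Matrix (Fin 4) (Fin 4) ℝ) (F : (Fin 4 → ℝ) → ℝ)
    (x : Fin 4 → ℝ) : Fin 4 → ℝ :=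
  fun i => grad g F x i / Real.sqrt (-gradSq g F x)

/-- The `k`-th component of the covariant derivative `∇_{∂ᵢ} N` of a vector field `N`. -/
def covDeriv (g : (Fin 4 → ℝ) → Matrix (Fin 4) (Fin 4) ℝ) (N : (Fin 4 → ℝ) → Fin 4 → ℝ)
    (i k : Fin 4) (x : Fin 4 → ℝ) : ℝ :=
  pd i (fun y => N y k) x + ∑ j, christoffel g k i j x * N x j

/-- The mean curvature `H = (1/3) tr ⟨∇_· N, ·⟩` of the level set of `F` through `x`, the trace
being taken over the tangent space of the level set with respect to the induced metric:
`gⁱʲ + Nⁱ Nʲ` is the inverse of the induced metric. -/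
def meanCurvature (g : (Fin 4 → ℝ) → Matrix (Fin 4) (Fin 4) ℝ) (F : (Fin 4 → ℝ) → ℝ)
    (x : Fin 4 → ℝ) : ℝ :=
  (1 / 3) * ∑ i, ∑ j, ((g x)⁻¹ i j + unitNormal g F x i * unitNormal g F x j) *
    ∑ k, g x j k * covDeriv g (unitNormal g F) i k x

/-! ### SS-CMC hypersurfaces in the Kruskal extension -/

/-- Invariance under rotations of the sphere factor. -/
def SphericallySymmetric (S : Set KPoint) : Prop :=
  ∀ (A : E3 ≃ₗᵢ[ℝ] E3) (T X : ℝ) (p q : S2),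
    (q : E3) = A (p : E3) → (T, X, p) ∈ S → (T, X, q) ∈ S

/-- `S` is a smooth, spacelike, spherically symmetric hypersurface (embedded, without boundary)
of the Kruskal extension, with constant mean curvature `H` with respect to the future directed
unit normal. Near each of its points, `S` is a level set of a smooth function with
timelike future directed gradient (`∂_T` is future directed). By symmetry it is enough to look
at the points that are covered by the polar coordinates. -/
def IsSSCMC (M H : ℝ) (S : Set KPoint) : Prop :=
  S ⊆ Kruskal M ∧ SphericallySymmetric S ∧
  ∀ x : Fin 4 → ℝ, x 2 ∈ Ioo 0 Real.pi → chartPoint x ∈ S →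
    ∃ (O : Set (Fin 4 → ℝ)) (F : (Fin 4 → ℝ) → ℝ),
      IsOpen O ∧ x ∈ O ∧ ContDiffOn ℝ ∞ F O ∧
      ∀ y ∈ O, (chartPoint y ∈ S ↔ F y = 0) ∧
        (F y = 0 →
          gradSq (kruskalMetric M) F y < 0 ∧
          0 < grad (kruskalMetric M) F y 0 ∧
          meanCurvature (kruskalMetric M) F y = H)

/-- The two hypersurfaces `A` and `B` join smoothly along `Z`. -/
def JoinSmoothly (M H : ℝ) (A Z B : Set KPoint) : Prop :=
  IsSSCMC M H A ∧ IsSSCMC M H B ∧ Z ⊆ closure A ∧ Z ⊆ closure B ∧ IsSSCMC M H (A ∪ Z ∪ B)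

/-- The speed at parameter `s`, in the Kruskal metric, of a curve `σ = (T, X, ω)`. -/
def speed (M : ℝ) (σ : ℝ → KPoint) (s : ℝ) : ℝ :=
  Real.sqrt (kruskalA M (σ s).1 (σ s).2.1 *
      (-(deriv (fun u => (σ u).1) s) ^ 2 + (deriv (fun u => (σ u).2.1) s) ^ 2) +
    kruskalR M (σ s).1 (σ s).2.1 ^ 2 * ‖deriv (fun u => ((σ u).2.2 : E3)) s‖ ^ 2)

/-- `S` is complete in the Kruskal extension: it is closed in the Kruskal extension, and each
`C¹` curve of finite length in `S` has an endpoint in `S`, unless it runs into the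
singularity `r = 0` (which does not belong to the spacetime). -/
def IsCompleteIn (M : ℝ) (S : Set KPoint) : Prop :=
  Kruskal M ∩ closure S ⊆ S ∧
  ∀ σ : ℝ → KPoint,
    ContDiffOn ℝ 1 (fun s => (σ s).1) (Ioo 0 1) →
    ContDiffOn ℝ 1 (fun s => (σ s).2.1) (Ioo 0 1) →
    ContDiffOn ℝ 1 (fun s => ((σ s).2.2 : E3)) (Ioo 0 1) →
    (∀ s ∈ Ioo (0 : ℝ) 1, σ s ∈ S) →
    IntegrableOn (speed M σ) (Ioo 0 1) →
      (∃ p ∈ S, Tendsto σ (𝓝[<] 1) (𝓝 p)) ∨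
      Tendsto (fun s => kruskalR M (σ s).1 (σ s).2.1) (𝓝[<] 1) (𝓝 0)

/-- The ends of a topological space: compatible choices, for all compact sets `K`, of a
connected component of the complement of `K`. -/
def spaceEnds (Y : Type*) [TopologicalSpace Y] : Set (TopologicalSpace.Compacts Y → Set Y) :=
  {e | (∀ K : TopologicalSpace.Compacts Y, ∃ y ∈ (K : Set Y)ᶜ, e K = connectedComponentIn (K : Set Y)ᶜ y) ∧
    ∀ K L : TopologicalSpace.Compacts Y, K ≤ L → e L ⊆ e K}

/-- `S` is a complete and smooth (connected) SS-CMC hypersurface in the Kruskal extension, with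
mean curvature `H` and exactly two ends. -/
def IsCompleteSSCMCWithTwoEnds (M H : ℝ) (S : Set KPoint) : Prop :=
  IsSSCMC M H S ∧ IsConnected S ∧ IsCompleteIn M S ∧ (spaceEnds S).ncard = 2

/-! ### Schwarzschild coordinates on the regions I, I' and II' -/

/-- `(T, X)` for the point of region I with Schwarzschild coordinates `t` and `r > 2M`. -/
def regionI (M t r : ℝ) : ℝ × ℝ :=
  (Real.sqrt (r - 2 * M) * (Real.exp ((r + t) / (4 * M)) - Real.exp ((r - t) / (4 * M))) / 2,
   Real.sqrt (r - 2 * M) * (Real.exp ((r + t) / (4 * M)) + Real.exp ((r - t) / (4 * M))) / 2)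

/-- `(T, X)` for the point of region I' with Schwarzschild coordinates `t` and `r > 2M`. -/
def regionI' (M t r : ℝ) : ℝ × ℝ :=
  (-(Real.sqrt (r - 2 * M) * (Real.exp ((r + t) / (4 * M)) - Real.exp ((r - t) / (4 * M))) / 2),
   -(Real.sqrt (r - 2 * M) * (Real.exp ((r + t) / (4 * M)) + Real.exp ((r - t) / (4 * M))) / 2))

/-- `(T, X)` for the point of region II' with Schwarzschild coordinates `t` and
`0 < r < 2M`. -/
def regionII' (M t r : ℝ) : ℝ × ℝ :=
  (-(Real.sqrt (2 * M - r) * (Real.exp ((r + t) / (4 * M)) + Real.exp ((r - t) / (4 * M))) / 2),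
   -(Real.sqrt (2 * M - r) * (Real.exp ((r + t) / (4 * M)) - Real.exp ((r - t) / (4 * M))) / 2))

/-- The union of the spheres over the points `γ r = (T, X)`, `r ∈ J`, of the Kruskal plane. -/
def sweep (J : Set ℝ) (γ : ℝ → ℝ × ℝ) : Set KPoint := {p | ∃ r ∈ J, (p.1, p.2.1) = γ r}

/-- The sphere over the point `(T, X)` of the Kruskal plane. -/
def sphereOver (T X : ℝ) : Set KPoint := {p | p.1 = T ∧ p.2.1 = X}

/-! ### The explicit solutions -/

/-- `h(r) = 1 - 2M / r`. -/
def hS (M r : ℝ) : ℝ := 1 - 2 * M / r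

def l1 (M H c r : ℝ) : ℝ := 1 / Real.sqrt (hS M r) * (H * r + c / r ^ 2)

def l3 (M H c r : ℝ) : ℝ := 1 / Real.sqrt (hS M r) * (-H * r - c / r ^ 2)

def l4 (M H c r : ℝ) : ℝ := 1 / Real.sqrt (-hS M r) * (H * r + c / r ^ 2)

/-- The height function of the solution in region I, with base point `r₁`. -/
def f1 (M H c r₁ cbar r : ℝ) : ℝ :=
  (∫ x in r₁..r, l1 M H c x / hS M x * Real.sqrt (1 / (1 + l1 M H c x ^ 2))) + cbar

/-- The height function of the solution in region I', with base point `r₃`. -/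
def f3 (M H c r₃ cbar r : ℝ) : ℝ :=
  (∫ x in r₃..r, l3 M H c x / hS M x * Real.sqrt (1 / (1 + l3 M H c x ^ 2))) + cbar

/-- The derivative of the increasing solution in region II'. -/
def f4slope (M H c r : ℝ) : ℝ :=
  1 / (-hS M r) * Real.sqrt (l4 M H c r ^ 2 / (l4 M H c r ^ 2 - 1))

/-- The increasing solution `f₄*` in region II', with base point `r₄`. -/
def f4inc (M H c r₄ cbar r : ℝ) : ℝ := (∫ x in r₄..r, f4slope M H c x) + cbar

/-- The decreasing solution `f₄**` in region II', with base point `r₄`. -/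
def f4dec (M H c r₄ cbar r : ℝ) : ℝ :=
  (∫ x in r₄..r, 1 / hS M x * Real.sqrt (l4 M H c x ^ 2 / (l4 M H c x ^ 2 - 1))) + cbar

/-- `-H r³ + r^{3/2} (2M - r)^{1/2}` on `(0, 2M)`. -/
def kTilde (M H r : ℝ) : ℝ := -H * r ^ 3 + Real.sqrt (r ^ 3 * (2 * M - r))

/-- `R` is the point `R_H ∈ (0, 2M)` with `-3 H R^{3/2} (2M - R)^{1/2} = 2 R - 3 M`, the unique
maximum point of `kTilde M H`; the maximum is `C_H = kTilde M H R`. -/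
def IsPeak (M H R : ℝ) : Prop :=
  R ∈ Ioo 0 (2 * M) ∧ -3 * H * Real.sqrt (R ^ 3 * (2 * M - R)) = 2 * R - 3 * M ∧
  ∀ r ∈ Ioo 0 (2 * M), r ≠ R → kTilde M H r < kTilde M H R

/-- `f₄` stays finite at `r`: for a one-sided interval between `r` and some `s` where
`kTilde < c`, the integral that defines `f₄` converges. -/
def F4FiniteAt (M H c r : ℝ) : Prop :=
  ∃ s ∈ Ioo 0 (2 * M), s ≠ r ∧ (∀ x ∈ uIcc r s, x ≠ r → kTilde M H x < c) ∧
    IntervalIntegrable (f4slope M H c) volume r s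

/-- The domain of `f₄`. -/
def f4Domain (M H c : ℝ) : Set ℝ :=
  {r | r ∈ Ioo 0 (2 * M) ∧ (kTilde M H r < c ∨ (kTilde M H r = c ∧ F4FiniteAt M H c r))}

/-- The part of the domain of `f₄` that reaches up to `r = 2M`. -/
def f4OuterDomain (M H c : ℝ) : Set ℝ :=
  {r | r ∈ Ioo 0 (2 * M) ∧ Ico r (2 * M) ⊆ f4Domain M H c}

/-- `Σ¹` in region I. -/
def Sigma1 (M H c r₁ cbar : ℝ) : Set KPoint :=
  sweep (Ioi (2 * M)) (fun r => regionI M (f1 M H c r₁ cbar r) r)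

/-- `Σ³` in region I'. -/
def Sigma3 (M H c r₃ cbar : ℝ) : Set KPoint :=
  sweep (Ioi (2 * M)) (fun r => regionI' M (f3 M H c r₃ cbar r) r)

/-- The graph of `f₄**` in region II', over the part of its domain that reaches up to `2M`. -/
def Sigma4dec (M H c r₄ cbar : ℝ) : Set KPoint :=
  sweep (f4OuterDomain M H c) (fun r => regionII' M (f4dec M H c r₄ cbar r) r)

/-- The graph of `f₄*` in region II', over the part of its domain that reaches up to `2M`. -/
def Sigma4inc (M H c r₄ cbar : ℝ) : Set KPoint :=
  sweep (f4OuterDomain M H c) (fun r => regionII' M (f4inc M H c r₄ cbar r) r)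

end

/-! A spherically symmetric spacelike hypersurface is a spacelike curve in the (T, X) plane times a
sphere. Let s be proper length along this profile curve, S = dr/ds and w = h dt/ds. The mean
curvature equation becomes the linear equation w' + 2w/r = 3H in the variable r, so w = Hr + c/r²
(`boostRate`), with c the constant of integration. Unit speed then gives S² = h + w² (`slopeSq`).

The Schwarzschild form degenerates at r = 2M, so the curve is described in null coordinates U = X −
T, V = X + T. With p = dU/ds and q = dV/ds one has U = 4M(S + w)p and V = 4M(S − w)q. Thus log U has
derivative 1/(4M(S + w)), which is regular as long as S + w > 0, and V follows from UV = (r −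
2M)e^{r/2M}. The condition c > −8M³H says w > 0 at r = 2M; on the branch S > 0 this gives S + w = 2w
> 0 there, while S − w and V vanish. The curve therefore crosses from region I to region II'
smoothly (`cmcAt_half`). The structure `CMCAt` records these relations, free of division by h, and
`isSSCMC_sweep` deduces from them that the swept surface has mean curvature H, at the horizon as
well. The explicit functions f₁, f₃, f₄ are Schwarzschild time t = 2M(log|V| − log|U|) as a function
of r along this one curve. The smooth joins are hence built in, and prescribing the additive
constant at one point is a time translation (U, V) ↦ (kU, V/k).

The trichotomy is the behaviour of S² inside the horizon, where r⁴S² = (Hr³ + c)² − r³(2M − r). If c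
> C_H, S has no zero and r runs down to the singularity. If c = C_H, S² has a double zero at R_H:
reaching it takes infinite length, t diverges, and the curve escapes along V → −∞. These two cases
use r = r₀ + e^v. If c < C_H, S² has a simple zero at r'', reached after finite length. There r =
r'' + v² makes S smooth and odd in v, and the curve continues as its own mirror image under X ↦ −X,
into region I' (`exists_reflected_extension`).

Completeness reduces to the profile: projecting a curve of finite length gives a convergent proper
length ℓ, and ℓ is unbounded at each end unless r → 0 there (`isCompleteIn_sweep`). The surface is
parametrized homeomorphically by ℝ × S², and the parameter is a proper function that separates its
two ends (`ncard_spaceEnds_eq_two`). -/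

/-! ### The area radius as an inverse function. -/

/-- The increasing function `r ↦ (r - 2M) e^{r / 2M}` that defines the area radius. -/
noncomputable def radiusFun (M r : ℝ) : ℝ := (r - 2 * M) * Real.exp (r / (2 * M))

theorem hasDerivAt_radiusFun {M : ℝ} (hM : 0 < M) (r : ℝ) :
    HasDerivAt (radiusFun M) (r / (2 * M) * Real.exp (r / (2 * M))) r := by
  have h1 : HasDerivAt (fun r : ℝ => r / (2 * M)) (1 / (2 * M)) r := (hasDerivAt_id r).div_const _
  have h2 := ((hasDerivAt_id r).sub_const (2 * M)).mul h1.exp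
  refine h2.congr_deriv ?_
  simp only [id]
  field_simp
  ring

theorem radiusFun_strictMonoOn {M : ℝ} (hM : 0 < M) : StrictMonoOn (radiusFun M) (Ici 0) := by
  apply strictMonoOn_of_deriv_pos (convex_Ici 0)
  · exact fun r _ => (hasDerivAt_radiusFun hM r).continuousAt.continuousWithinAt
  · intro r hr
    rw [interior_Ici] at hr
    have : (0 : ℝ) < r := hr
    rw [(hasDerivAt_radiusFun hM r).deriv]
    positivity

theorem radiusFun_zero (M : ℝ) : radiusFun M 0 = -(2 * M) := by simp [radiusFun]

theorem radiusFun_surj {M : ℝ} (hM : 0 < M) {z : ℝ} (hz : -(2 * M) < z) :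
    ∃ r ∈ Ioi (0 : ℝ), radiusFun M r = z := by
  have hc : ContinuousOn (radiusFun M) (Icc 0 (2 * M + |z|)) :=
    fun r _ => (hasDerivAt_radiusFun hM r).continuousAt.continuousWithinAt
  have h0 : (0 : ℝ) ≤ 2 * M + |z| := by positivity
  have hb : z ≤ radiusFun M (2 * M + |z|) := by
    have : 1 ≤ Real.exp ((2 * M + |z|) / (2 * M)) := Real.one_le_exp (by positivity)
    have h3 := le_abs_self z
    have h4 := abs_nonneg z
    unfold radiusFun
    nlinarith
  obtain ⟨r, hr, hrz⟩ := intermediate_value_Icc h0 hc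
    ⟨by rw [radiusFun_zero]; exact hz.le, hb⟩
  refine ⟨r, lt_of_le_of_ne hr.1 ?_, hrz⟩
  rintro rfl
  rw [radiusFun_zero] at hrz
  exact hz.ne hrz

/-- The area radius as a function of `z = X² - T²`. -/
noncomputable def areaRadius (M z : ℝ) : ℝ := Function.invFunOn (radiusFun M) (Ioi 0) z

theorem kruskalR_eq_areaRadius (M T X : ℝ) : kruskalR M T X = areaRadius M (X ^ 2 - T ^ 2) := rfl

theorem areaRadius_spec {M : ℝ} (hM : 0 < M) {z : ℝ} (hz : -(2 * M) < z) :
    0 < areaRadius M z ∧ radiusFun M (areaRadius M z) = z :=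
  Function.invFunOn_pos (radiusFun_surj hM hz)

theorem areaRadius_radiusFun {M : ℝ} (hM : 0 < M) {r : ℝ} (hr : 0 < r) :
    areaRadius M (radiusFun M r) = r := by
  have h0 : -(2 * M) < radiusFun M r := by
    rw [← radiusFun_zero]
    exact radiusFun_strictMonoOn hM (mem_Ici.2 le_rfl) hr.le hr
  have h := areaRadius_spec hM h0
  exact (radiusFun_strictMonoOn hM).injOn h.1.le hr.le h.2

theorem neg_lt_radiusFun {M : ℝ} (hM : 0 < M) {r : ℝ} (hr : 0 < r) :
    -(2 * M) < radiusFun M r := by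
  rw [← radiusFun_zero]
  exact radiusFun_strictMonoOn hM (mem_Ici.2 le_rfl) hr.le hr

theorem hasDerivAt_areaRadius {M : ℝ} (hM : 0 < M) {z : ℝ} (hz : -(2 * M) < z) :
    HasDerivAt (areaRadius M)
      (2 * M * Real.exp (-(areaRadius M z) / (2 * M)) / areaRadius M z) z := by
  obtain ⟨hpos, heq⟩ := areaRadius_spec hM hz
  set r := areaRadius M z with hr
  have hstrict : HasStrictDerivAt (radiusFun M) (r / (2 * M) * Real.exp (r / (2 * M))) r := by
    have hcd : ContDiff ℝ 1 (radiusFun M) := by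
      unfold radiusFun; fun_prop
    exact hcd.contDiffAt.hasStrictDerivAt' (hasDerivAt_radiusFun hM r) (by norm_num)
  have hne : r / (2 * M) * Real.exp (r / (2 * M)) ≠ 0 := by positivity
  have h1 := hstrict.to_local_left_inverse (g := areaRadius M) hne ?_
  · rw [heq] at h1
    refine h1.hasDerivAt.congr_deriv ?_
    rw [neg_div, Real.exp_neg]
    field_simp
  · filter_upwards [lt_mem_nhds hpos] with x hx using areaRadius_radiusFun hM hx

theorem kruskalR_eq_of {M : ℝ} (hM : 0 < M) {T X r : ℝ} (hr : 0 < r)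
    (h : X ^ 2 - T ^ 2 = (r - 2 * M) * Real.exp (r / (2 * M))) : kruskalR M T X = r := by
  rw [kruskalR_eq_areaRadius, h]
  exact areaRadius_radiusFun hM hr

theorem kruskalA_pos {M : ℝ} (hM : 0 < M) {T X : ℝ} (h : -(2 * M) < X ^ 2 - T ^ 2) :
    0 < kruskalA M T X := by
  have hr : 0 < kruskalR M T X := (areaRadius_spec hM h).1
  unfold kruskalA
  positivity

/-! ### Coordinate derivatives of the Kruskal metric. -/

/-- The covector `a dT + b dX + c dθ`. -/
noncomputable def coordCovector (a b c : ℝ) : (Fin 4 → ℝ) →L[ℝ] ℝ :=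
  a • ContinuousLinearMap.proj 0 + b • ContinuousLinearMap.proj 1 + c • ContinuousLinearMap.proj 2

theorem hasFDerivAt_coord (i : Fin 4) (x : Fin 4 → ℝ) :
    HasFDerivAt (fun y : Fin 4 → ℝ => y i)
      (ContinuousLinearMap.proj (R := ℝ) (φ := fun _ : Fin 4 => ℝ) i) x :=
  (ContinuousLinearMap.proj (R := ℝ) (φ := fun _ : Fin 4 => ℝ) i).hasFDerivAt

theorem pd_eq_of_hasFDerivAt {f : (Fin 4 → ℝ) → ℝ} {a b c : ℝ} {x : Fin 4 → ℝ}
    (h : HasFDerivAt f (coordCovector a b c) x) (i : Fin 4) : pd i f x = ![a, b, c, 0] i := by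
  unfold pd
  rw [h.fderiv]
  fin_cases i <;> simp [coordCovector]

theorem pd_const (i : Fin 4) (c : ℝ) (x : Fin 4 → ℝ) : pd i (fun _ => c) x = 0 := by
  simp [pd]

/-- Here κ is dr/dz for z = X² − T². The conformal factor of the metric is 8Mκ, so κ is the only
exponential quantity that the curvature formulas need. -/
theorem hasFDerivAt_kruskalR {M : ℝ} (hM : 0 < M) {x : Fin 4 → ℝ}
    (h : -(2 * M) < x 1 ^ 2 - x 0 ^ 2) {r κ : ℝ} (hr : kruskalR M (x 0) (x 1) = r)
    (hκ : κ = 2 * M * Real.exp (-r / (2 * M)) / r) :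
    HasFDerivAt (fun y : Fin 4 → ℝ => kruskalR M (y 0) (y 1))
      (coordCovector (-(2 * x 0 * κ)) (2 * x 1 * κ) 0) x := by
  have h0 := hasFDerivAt_coord 0 x
  have h1 := hasFDerivAt_coord 1 x
  have h2 := (hasDerivAt_areaRadius hM h).comp_hasFDerivAt x ((h1.pow 2).sub (h0.pow 2))
  refine h2.congr_fderiv ?_
  rw [← kruskalR_eq_areaRadius, hr, ← hκ]
  ext y
  simp [coordCovector]
  ring

theorem hasFDerivAt_kruskalA {M : ℝ} (hM : 0 < M) {x : Fin 4 → ℝ}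
    (h : -(2 * M) < x 1 ^ 2 - x 0 ^ 2) {r κ : ℝ} (hr : kruskalR M (x 0) (x 1) = r)
    (hκ : κ = 2 * M * Real.exp (-r / (2 * M)) / r) :
    HasFDerivAt (fun y : Fin 4 → ℝ => kruskalA M (y 0) (y 1))
      (coordCovector (16 * M * κ ^ 2 * (1 / (2 * M) + 1 / r) * x 0)
        (-(16 * M * κ ^ 2 * (1 / (2 * M) + 1 / r) * x 1)) 0) x := by
  have hpos : 0 < r := hr ▸ (areaRadius_spec hM h).1
  have hR := hasFDerivAt_kruskalR hM h hr hκ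
  have h1 : HasDerivAt (fun s : ℝ => 16 * M ^ 2 * Real.exp (-s / (2 * M)) / s)
      (-(8 * M * κ * (1 / (2 * M) + 1 / r))) r := by
    have := (((((hasDerivAt_id r).neg.div_const (2 * M)).exp).const_mul (16 * M ^ 2)).div
      (hasDerivAt_id r) hpos.ne')
    refine this.congr_deriv ?_
    rw [hκ]
    simp only [id, Pi.neg_apply]
    field_simp
    ring
  rw [← hr] at h1
  refine (h1.comp_hasFDerivAt x hR).congr_fderiv ?_
  rw [hr]
  ext y
  simp [coordCovector]
  ring

theorem inv_kruskalMetric {M : ℝ} {x : Fin 4 → ℝ} {a r s : ℝ} (ha : kruskalA M (x 0) (x 1) = a)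
    (hr : kruskalR M (x 0) (x 1) = r) (hs : Real.sin (x 2) = s) (ha0 : a ≠ 0) (hr0 : r ≠ 0)
    (hs0 : s ≠ 0) :
    (kruskalMetric M x)⁻¹ = Matrix.diagonal ![-a⁻¹, a⁻¹, (r ^ 2)⁻¹, (r ^ 2 * s ^ 2)⁻¹] := by
  apply Matrix.inv_eq_right_inv
  unfold kruskalMetric
  rw [ha, hr, hs, Matrix.diagonal_mul_diagonal, ← Matrix.diagonal_one]
  congr 1
  ext i
  fin_cases i <;> simp <;> field_simp

/-! ### Unit normal and mean curvature of a graph T = τ(X). -/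

section LevelSet

variable {M : ℝ} {x : Fin 4 → ℝ} {a r s : ℝ}

theorem hasFDerivAt_graphFun {τ : ℝ → ℝ} {τ1 : ℝ} (hτ : HasDerivAt τ τ1 (x 1)) :
    HasFDerivAt (fun y : Fin 4 → ℝ => τ (y 1) - y 0) (coordCovector (-1) τ1 0) x := by
  have h0 := hasFDerivAt_coord 0 x
  have h1 := hasFDerivAt_coord 1 x
  refine ((hτ.comp_hasFDerivAt x h1).sub h0).congr_fderiv ?_
  ext y
  simp [coordCovector]
  ring

theorem grad_graphFun {τ : ℝ → ℝ} {τ1 : ℝ} (hτ : HasDerivAt τ τ1 (x 1))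
    (ha : kruskalA M (x 0) (x 1) = a)
    (hr : kruskalR M (x 0) (x 1) = r) (hs : Real.sin (x 2) = s) (ha0 : a ≠ 0) (hr0 : r ≠ 0)
    (hs0 : s ≠ 0) :
    grad (kruskalMetric M) (fun y => τ (y 1) - y 0) x = ![a⁻¹, τ1 * a⁻¹, 0, 0] := by
  ext i
  unfold grad
  rw [inv_kruskalMetric ha hr hs ha0 hr0 hs0]
  simp only [pd_eq_of_hasFDerivAt (hasFDerivAt_graphFun hτ)]
  fin_cases i <;> simp [Matrix.diagonal]; ring

theorem gradSq_graphFun {τ : ℝ → ℝ} {τ1 : ℝ} (hτ : HasDerivAt τ τ1 (x 1))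
    (ha : kruskalA M (x 0) (x 1) = a)
    (hr : kruskalR M (x 0) (x 1) = r) (hs : Real.sin (x 2) = s) (ha0 : a ≠ 0) (hr0 : r ≠ 0)
    (hs0 : s ≠ 0) :
    gradSq (kruskalMetric M) (fun y => τ (y 1) - y 0) x = -((1 - τ1 ^ 2) * a⁻¹) := by
  unfold gradSq
  rw [grad_graphFun hτ ha hr hs ha0 hr0 hs0]
  simp [Fin.sum_univ_four, kruskalMetric, Matrix.diagonal, ha, hr, hs]
  field_simp
  ring

theorem unitNormal_graphFun {τ : ℝ → ℝ} {τ1 : ℝ} (hτ : HasDerivAt τ τ1 (x 1))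
    (ha : kruskalA M (x 0) (x 1) = a)
    (hr : kruskalR M (x 0) (x 1) = r) (hs : Real.sin (x 2) = s) (ha0 : 0 < a) (hr0 : r ≠ 0)
    (hs0 : s ≠ 0) (h1 : 0 < 1 - τ1 ^ 2) :
    unitNormal (kruskalMetric M) (fun y => τ (y 1) - y 0) x =
      ![(√(a * (1 - τ1 ^ 2)))⁻¹, τ1 * (√(a * (1 - τ1 ^ 2)))⁻¹, 0, 0] := by
  have key : a⁻¹ / √((1 - τ1 ^ 2) * a⁻¹) = (√(a * (1 - τ1 ^ 2)))⁻¹ := by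
    have e : (1 - τ1 ^ 2) * a⁻¹ = (a * (1 - τ1 ^ 2)) / a ^ 2 := by field_simp
    rw [e, Real.sqrt_div' _ (by positivity), Real.sqrt_sq ha0.le]
    have : √(a * (1 - τ1 ^ 2)) ≠ 0 := (Real.sqrt_pos.2 (by positivity)).ne'
    field_simp
  ext i
  unfold unitNormal
  rw [grad_graphFun hτ ha hr hs ha0.ne' hr0 hs0, gradSq_graphFun hτ ha hr hs ha0.ne' hr0 hs0,
    neg_neg]
  fin_cases i
  · simpa using key
  · simp only [Fin.mk_one, Matrix.cons_val_one, Matrix.cons_val_zero]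
    rw [mul_div_assoc, key]
  · simp
  · simp

end LevelSet

theorem hasFDerivAt_normalFactor {M : ℝ} {x : Fin 4 → ℝ} {τ1 : ℝ → ℝ} {τ2 a aT aX ν : ℝ}
    (hτ : HasDerivAt τ1 τ2 (x 1)) (ha0 : 0 < a) (h1 : 0 < 1 - τ1 (x 1) ^ 2)
    (ha : kruskalA M (x 0) (x 1) = a)
    (hA : HasFDerivAt (fun y : Fin 4 → ℝ => kruskalA M (y 0) (y 1)) (coordCovector aT aX 0) x)
    (hν : ν = (√(a * (1 - τ1 (x 1) ^ 2)))⁻¹) :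
    HasFDerivAt (fun y : Fin 4 → ℝ => (√(kruskalA M (y 0) (y 1) * (1 - τ1 (y 1) ^ 2)))⁻¹)
      (coordCovector (-(ν ^ 3 * aT * (1 - τ1 (x 1) ^ 2)) / 2)
        (-(ν ^ 3 * (aX * (1 - τ1 (x 1) ^ 2) - 2 * a * τ1 (x 1) * τ2)) / 2) 0) x := by
  have hx1 := hasFDerivAt_coord 1 x
  have h2 : HasFDerivAt (fun y : Fin 4 → ℝ => τ1 (y 1)) (τ2 • ContinuousLinearMap.proj (R := ℝ) (φ := fun _ : Fin 4 => ℝ) 1) x :=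
    hτ.comp_hasFDerivAt x hx1
  have h3 := hA.mul ((h2.pow 2).const_sub 1)
  have hp : 0 < a * (1 - τ1 (x 1) ^ 2) := by positivity
  have hsq : √(a * (1 - τ1 (x 1) ^ 2)) ≠ 0 := (Real.sqrt_pos.2 hp).ne'
  have h4 : HasDerivAt (fun z => (√z)⁻¹) (-(ν ^ 3) / 2) (a * (1 - τ1 (x 1) ^ 2)) := by
    refine ((Real.hasDerivAt_sqrt hp.ne').inv hsq).congr_deriv ?_
    rw [hν]
    field_simp
  rw [← ha] at h4
  refine (h4.comp_hasFDerivAt x h3).congr_fderiv ?_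
  ext y
  simp [coordCovector, ha]
  ring

/-- The nonzero derivatives `∂ᵢ gⱼⱼ` of the Kruskal metric. -/
theorem pd_kruskalMetric {M : ℝ} {x : Fin 4 → ℝ} {aT aX rT rX r : ℝ}
    (hr : kruskalR M (x 0) (x 1) = r)
    (dA : HasFDerivAt (fun y : Fin 4 → ℝ => kruskalA M (y 0) (y 1)) (coordCovector aT aX 0) x)
    (dR : HasFDerivAt (fun y : Fin 4 → ℝ => kruskalR M (y 0) (y 1)) (coordCovector rT rX 0) x)
    (i j l : Fin 4) :
    pd i (fun y => kruskalMetric M y j l) x =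
      (!![-aT, aT, 2 * r * rT, 2 * r * rT * Real.sin (x 2) ^ 2;
         -aX, aX, 2 * r * rX, 2 * r * rX * Real.sin (x 2) ^ 2;
         0, 0, 0, 2 * r ^ 2 * Real.sin (x 2) * Real.cos (x 2);
         0, 0, 0, 0] : Matrix (Fin 4) (Fin 4) ℝ) i j * (if j = l then 1 else 0) := by
  by_cases hjl : j = l
  · subst hjl
    have h0 : HasFDerivAt (fun y : Fin 4 → ℝ => -kruskalA M (y 0) (y 1))
        (coordCovector (-aT) (-aX) 0) x := by
      refine dA.neg.congr_fderiv ?_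
      ext y; simp [coordCovector]; ring
    have h2 : HasFDerivAt (fun y : Fin 4 → ℝ => kruskalR M (y 0) (y 1) ^ 2)
        (coordCovector (2 * r * rT) (2 * r * rX) 0) x := by
      refine (dR.pow 2).congr_fderiv ?_
      ext y; simp [coordCovector, hr]; ring
    have h3 : HasFDerivAt (fun y : Fin 4 → ℝ => kruskalR M (y 0) (y 1) ^ 2 * Real.sin (y 2) ^ 2)
        (coordCovector (2 * r * rT * Real.sin (x 2) ^ 2) (2 * r * rX * Real.sin (x 2) ^ 2)
          (2 * r ^ 2 * Real.sin (x 2) * Real.cos (x 2))) x := by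
      refine (h2.mul ((hasFDerivAt_coord 2 x).sin.pow 2)).congr_fderiv ?_
      ext y; simp [coordCovector, hr]; ring
    fin_cases j
    · simp only [kruskalMetric, Matrix.diagonal_apply_eq]
      refine (pd_eq_of_hasFDerivAt h0 i).trans ?_
      fin_cases i <;> simp
    · simp only [kruskalMetric, Matrix.diagonal_apply_eq]
      refine (pd_eq_of_hasFDerivAt dA i).trans ?_
      fin_cases i <;> simp
    · simp only [kruskalMetric, Matrix.diagonal_apply_eq]
      refine (pd_eq_of_hasFDerivAt h2 i).trans ?_
      fin_cases i <;> simp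
    · simp only [kruskalMetric, Matrix.diagonal_apply_eq]
      refine (pd_eq_of_hasFDerivAt h3 i).trans ?_
      fin_cases i <;> simp
  · simp only [kruskalMetric, Matrix.diagonal_apply_ne _ hjl, pd_const, if_neg hjl, mul_zero]

/-- The normal is N = ν(∂_T + τ' ∂_X), hence N(r) = 2κν(τ'X − T). Each of the two sphere directions
contributes N(r)/r. In the plane the metric is conformal to the flat one: this leaves aν³τ'' and
half of N(log a), where d(log a)/dr = −(1/(2M) + 1/r). -/
theorem meanCurvature_graphFun {M : ℝ} (hM : 0 < M) {x : Fin 4 → ℝ} {τ τ1 : ℝ → ℝ}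
    {τ2 a r κ ν : ℝ} (h : -(2 * M) < x 1 ^ 2 - x 0 ^ 2) (hs : Real.sin (x 2) ≠ 0)
    (hτ : ∀ᶠ z in 𝓝 (x 1), HasDerivAt τ (τ1 z) z) (hτ1 : HasDerivAt τ1 τ2 (x 1))
    (h1 : 0 < 1 - τ1 (x 1) ^ 2) (hr : kruskalR M (x 0) (x 1) = r)
    (hκ : κ = 2 * M * Real.exp (-r / (2 * M)) / r) (ha : a = 8 * M * κ)
    (hν : ν = (√(a * (1 - τ1 (x 1) ^ 2)))⁻¹) :
    meanCurvature (kruskalMetric M) (fun y => τ (y 1) - y 0) x =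
      (1 / 3) * (a * ν ^ 3 * τ2 + 2 * κ * ν * (τ1 (x 1) * x 1 - x 0) *
        (2 / r - (1 / 2) * (1 / (2 * M) + 1 / r))) := by
  have hr0 : 0 < r := hr ▸ (areaRadius_spec hM h).1
  have hκ0 : 0 < κ := by rw [hκ]; positivity
  have ha0 : 0 < a := by rw [ha]; positivity
  have hA : kruskalA M (x 0) (x 1) = a := by
    unfold kruskalA; rw [hr, ha, hκ]; ring
  have dA := hasFDerivAt_kruskalA hM h hr hκ
  have dR := hasFDerivAt_kruskalR hM h hr hκ
  have dν := hasFDerivAt_normalFactor hτ1 ha0 h1 hA dA hν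
  have hx1 := hasFDerivAt_coord 1 x
  have dτν : HasFDerivAt
      (fun y : Fin 4 → ℝ => τ1 (y 1) * (√(kruskalA M (y 0) (y 1) * (1 - τ1 (y 1) ^ 2)))⁻¹) _ x :=
    (hτ1.comp_hasFDerivAt x hx1).mul dν
  set νT := -(ν ^ 3 * (16 * M * κ ^ 2 * (1 / (2 * M) + 1 / r) * x 0) * (1 - τ1 (x 1) ^ 2)) / 2
    with hνT
  set νX := -(ν ^ 3 * (-(16 * M * κ ^ 2 * (1 / (2 * M) + 1 / r) * x 1) * (1 - τ1 (x 1) ^ 2) -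
    2 * a * τ1 (x 1) * τ2)) / 2 with hνX
  have dτν' : HasFDerivAt
      (fun y : Fin 4 → ℝ => τ1 (y 1) * (√(kruskalA M (y 0) (y 1) * (1 - τ1 (y 1) ^ 2)))⁻¹)
      (coordCovector (τ1 (x 1) * νT) (τ1 (x 1) * νX + τ2 * ν) 0) x := by
    refine dτν.congr_fderiv ?_
    ext y
    simp [coordCovector, hA, hν]
    ring
  have hN : ∀ᶠ y in 𝓝 x, unitNormal (kruskalMetric M) (fun y => τ (y 1) - y 0) y =
      ![(√(kruskalA M (y 0) (y 1) * (1 - τ1 (y 1) ^ 2)))⁻¹,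
        τ1 (y 1) * (√(kruskalA M (y 0) (y 1) * (1 - τ1 (y 1) ^ 2)))⁻¹, 0, 0] := by
    have c1 : Tendsto (fun y : Fin 4 → ℝ => y 1) (𝓝 x) (𝓝 (x 1)) := (continuous_apply 1).tendsto x
    have e1 : ∀ᶠ y in 𝓝 x, -(2 * M) < y 1 ^ 2 - y 0 ^ 2 := by
      have : Continuous fun y : Fin 4 → ℝ => y 1 ^ 2 - y 0 ^ 2 := by fun_prop
      exact this.continuousAt.eventually (lt_mem_nhds h)
    have e2 : ∀ᶠ y in 𝓝 x, Real.sin (y 2) ≠ 0 := by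
      have : Continuous fun y : Fin 4 → ℝ => Real.sin (y 2) := by fun_prop
      exact this.continuousAt.eventually_ne hs
    have e3 : ∀ᶠ z in 𝓝 (x 1), 0 < 1 - τ1 z ^ 2 :=
      (continuousAt_const.sub (hτ1.continuousAt.pow 2)).eventually (lt_mem_nhds h1)
    filter_upwards [e1, e2, c1.eventually e3, c1.eventually hτ] with y y1 y2 y3 y4
    exact unitNormal_graphFun y4 rfl rfl rfl (kruskalA_pos hM y1) (areaRadius_spec hM y1).1.ne' y2 y3
  have hNx := hN.self_of_nhds
  rw [hA, ← hν] at hNx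
  have p0 : ∀ i, pd i (fun y => unitNormal (kruskalMetric M) (fun y => τ (y 1) - y 0) y 0) x =
      ![νT, νX, 0, 0] i := fun i =>
    pd_eq_of_hasFDerivAt (dν.congr_of_eventuallyEq (hN.mono fun y hy => by rw [hy]; simp)) i
  have p1 : ∀ i, pd i (fun y => unitNormal (kruskalMetric M) (fun y => τ (y 1) - y 0) y 1) x =
      ![τ1 (x 1) * νT, τ1 (x 1) * νX + τ2 * ν, 0, 0] i := fun i =>
    pd_eq_of_hasFDerivAt (dτν'.congr_of_eventuallyEq (hN.mono fun y hy => by rw [hy]; simp)) i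
  have hz : HasFDerivAt (fun _ : Fin 4 → ℝ => (0 : ℝ)) (coordCovector 0 0 0) x :=
    (hasFDerivAt_const 0 x).congr_fderiv (by ext y; simp [coordCovector])
  have p2 : ∀ i, pd i (fun y => unitNormal (kruskalMetric M) (fun y => τ (y 1) - y 0) y 2) x =
      ![0, 0, 0, 0] i := fun i =>
    pd_eq_of_hasFDerivAt (hz.congr_of_eventuallyEq (hN.mono fun y hy => by rw [hy]; simp)) i
  have p3 : ∀ i, pd i (fun y => unitNormal (kruskalMetric M) (fun y => τ (y 1) - y 0) y 3) x =
      ![0, 0, 0, 0] i := fun i =>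
    pd_eq_of_hasFDerivAt (hz.congr_of_eventuallyEq (hN.mono fun y hy => by rw [hy]; simp)) i
  have hν2 : ν ^ 2 * (a * (1 - τ1 (x 1) ^ 2)) = 1 := by
    have hp : 0 < a * (1 - τ1 (x 1) ^ 2) := by positivity
    rw [hν, inv_pow, Real.sq_sqrt hp.le, inv_mul_cancel₀ hp.ne']
  unfold meanCurvature covDeriv christoffel
  rw [inv_kruskalMetric hA hr rfl ha0.ne' hr0.ne' hs]
  simp only [hNx, pd_kruskalMetric hr dA dR, Fin.sum_univ_four, p0, p1, p2, p3]
  simp [kruskalMetric, hA, hr]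
  -- Expressing the inverse conformal factor through ν leaves an identity that is a multiple of the
  -- single relation ν²a(1 − τ'²) = 1.
  have hai : a⁻¹ = ν ^ 2 * (1 - τ1 (x 1) ^ 2) := by
    refine inv_eq_of_mul_eq_one_right ?_
    linear_combination hν2
  have hθ : (r ^ 2)⁻¹ *
      (r ^ 2 *
        (-(2⁻¹ * ((r ^ 2)⁻¹ * (2 * r * (2 * x 0 * κ))) * ν) +
          2⁻¹ * ((r ^ 2)⁻¹ * (2 * r * (2 * x 1 * κ))) * (τ1 (x 1) * ν))) =
      2 * κ * ν * (τ1 (x 1) * x 1 - x 0) * r⁻¹ := by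
    field_simp
    ring
  have hφ : (Real.sin (x 2) ^ 2)⁻¹ * (r ^ 2)⁻¹ *
      (r ^ 2 * Real.sin (x 2) ^ 2 *
        (-(2⁻¹ * ((Real.sin (x 2) ^ 2)⁻¹ * (r ^ 2)⁻¹ *
            (2 * r * (2 * x 0 * κ) * Real.sin (x 2) ^ 2)) * ν) +
          2⁻¹ * ((Real.sin (x 2) ^ 2)⁻¹ * (r ^ 2)⁻¹ *
            (2 * r * (2 * x 1 * κ) * Real.sin (x 2) ^ 2)) * (τ1 (x 1) * ν))) =
      2 * κ * ν * (τ1 (x 1) * x 1 - x 0) * r⁻¹ := by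
    field_simp
    ring
  rw [hθ, hφ, hai, hνT, hνX]
  simp only [div_eq_mul_inv, mul_inv, one_mul]
  generalize τ1 (x 1) = c at *
  rw [ha] at hν2 ⊢
  linear_combination (κ * (M⁻¹ * 2⁻¹ + r⁻¹) * ν * (x 0 - c * x 1) *
    (8 * M * κ * ν ^ 2 * (1 - c ^ 2) + 1)) * hν2

/-! ### Profile curves in null coordinates and their curvature equation. -/

/-- `H r + c / r²`, the derivative of Schwarzschild time along the profile curve of an SS-CMC
hypersurface, times `h`. -/
noncomputable def boostRate (H c r : ℝ) : ℝ := H * r + c / r ^ 2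

theorem hasDerivAt_boostRate (H c : ℝ) {r : ℝ} (hr : r ≠ 0) :
    HasDerivAt (boostRate H c) (H - 2 * c / r ^ 3) r := by
  have h := ((hasDerivAt_id r).const_mul H).add
    ((hasDerivAt_const r c).div ((hasDerivAt_id r).pow 2) (pow_ne_zero 2 hr))
  refine h.congr_deriv ?_
  simp only [id, Pi.pow_apply]
  field_simp
  push_cast
  ring

/-- The profile curve `(U, V)` of an SS-CMC hypersurface in null coordinates `U = X - T`,
`V = X + T`, near the parameter value `v`: `R` is the area radius, `ds = dv / σ` the proper length,
`S = dR / ds`, `p = dU / ds` and `q = dV / ds`. -/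
structure CMCAt (M H c : ℝ) (R S σ U V p q : ℝ → ℝ) (v : ℝ) : Prop where
  R_pos : 0 < R v
  σ_pos : 0 < σ v
  p_pos : 0 < p v
  q_pos : 0 < q v
  mul : U v * V v = (R v - 2 * M) * Real.exp (R v / (2 * M))
  unit : 16 * M ^ 2 * Real.exp (-R v / (2 * M)) * (p v * q v) = R v
  relU : 4 * M * Real.exp (-R v / (2 * M)) * (U v * q v) = R v * (S v + boostRate H c (R v))
  relV : 4 * M * Real.exp (-R v / (2 * M)) * (V v * p v) = R v * (S v - boostRate H c (R v))
  ne : U v ≠ 0 ∨ V v ≠ 0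
  dR : HasDerivAt R (S v / σ v) v
  dS : HasDerivAt S ((M / R v ^ 2 + boostRate H c (R v) * (H - 2 * c / R v ^ 3)) / σ v) v
  dU : HasDerivAt U (p v / σ v) v
  dV : HasDerivAt V (q v / σ v) v
  dp : DifferentiableAt ℝ p v
  dq : DifferentiableAt ℝ q v
  smoothU : ContDiffAt ℝ ∞ U v
  smoothV : ContDiffAt ℝ ∞ V v

section Curvature

variable {M H c : ℝ} {R S σ U V p q : ℝ → ℝ} {v : ℝ}

/-- `eU` and `eunit` are the derivatives of `relU` and `unit` along the curve, and are linear in p'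
and q'. Since U = 4M(S + w)p, the assumption U ≠ 0 gives S + w ≠ 0, so `eU` can be solved for q';
then `eunit` supplies the p' term. The relation S² = w² + h already follows from the four
undifferentiated identities. -/
theorem curvature_algebra {M r E s w w' S U V p q p' q' : ℝ} (hM : 0 < M) (hr : 0 < r)
    (unit : 16 * M ^ 2 * E * (p * q) = r)
    (relU : 4 * M * E * (U * q) = r * (S + w))
    (mul : U * V * E = r - 2 * M)
    (relV : 4 * M * E * (V * p) = r * (S - w))
    (hU : U ≠ 0)
    (eU : 4 * M * E * (-S / (2 * M) * (U * q) + p * q + s * (U * q')) =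
      S * (S + w) + r * (M / r ^ 2 + w * w' + w' * S))
    (eunit : 16 * M ^ 2 * E * (-S / (2 * M) * (p * q) + s * (p' * q + p * q')) = S) :
    8 * M ^ 2 * E / r * (s * (q' * p - p' * q)) =
      w' + 1 / 2 * (1 / (2 * M) + 1 / r) * w := by
  have hS : S ^ 2 = w ^ 2 + 1 - 2 * M / r := by
    have h1 : r ^ 2 * (S ^ 2 - w ^ 2) = r * (r - 2 * M) := by
      linear_combination (-(r * (S + w))) * relV - (4 * M * E * (V * p)) * relU +
        (16 * M ^ 2 * E * (p * q)) * mul + (r - 2 * M) * unit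
    field_simp
    have : r * (r * (S ^ 2 - w ^ 2)) = r * (r - 2 * M) := by linear_combination h1
    have := mul_left_cancel₀ hr.ne' this
    linear_combination this
  have hUD : U = 4 * M * (S + w) * p := by
    have h1 : r * U = r * (4 * M * (S + w) * p) := by
      linear_combination (-U) * unit + 4 * M * p * relU
    exact mul_left_cancel₀ hr.ne' h1
  have hD : S + w ≠ 0 := by
    intro h0
    rw [h0] at hUD
    simp at hUD
    exact hU hUD
  -- Written with h = (S + w)(S − w), so that every term of `eU` contains the factor S + w that `h3`
  -- cancels.
  have hm : M / r - r / (4 * M) =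
      -(1 / 2 * r * (1 / (2 * M) + 1 / r) * ((S + w) * (S - w))) := by
    have h2 : (S + w) * (S - w) = 1 - 2 * M / r := by linear_combination hS
    rw [h2]
    field_simp
    ring
  have h3 : 16 * M ^ 2 * E * s * p * q' =
      S + r * w' + r * S / (2 * M) - 1 / 2 * r * (1 / (2 * M) + 1 / r) * (S - w) := by
    apply mul_left_cancel₀ hD
    have h4 : 4 * M * E * (-S / (2 * M) * (U * q)) = -S / (2 * M) * (r * (S + w)) := by
      rw [← relU]; ring
    have h5 : 4 * M * E * (p * q) = r / (4 * M) := by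
      field_simp
      linear_combination unit
    have h6 : r * (M / r ^ 2) = M / r := by field_simp
    have h7 : 4 * M * E * (s * (U * q')) = (S + w) * (16 * M ^ 2 * E * s * p * q') := by
      rw [hUD]; ring
    linear_combination eU - h4 - h5 + h6 - h7 + hm
  have h8 : 16 * M ^ 2 * E * (S / (2 * M) * (p * q)) = S / (2 * M) * r := by
    linear_combination (S / (2 * M)) * unit
  have h9 : 8 * M ^ 2 * E * (s * (q' * p - p' * q)) =
      r * (w' + 1 / 2 * (1 / (2 * M) + 1 / r) * w) := by
    have h10 : r * (1 / (2 * M) + 1 / r) = r / (2 * M) + 1 := by field_simp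
    have h11 : r * S / (2 * M) = S / (2 * M) * r := by ring
    linear_combination h3 - (1 / 2) * eunit - (1 / 2) * h8 + (-S / 2) * h10 - h11 / 2 + h11 - h11
  rw [div_mul_eq_mul_div, h9]
  field_simp

namespace CMCAt

theorem radiusFun_eq (h : CMCAt M H c R S σ U V p q v) : U v * V v = radiusFun M (R v) := h.mul

theorem mul_exp_neg (h : CMCAt M H c R S σ U V p q v) :
    U v * V v * Real.exp (-R v / (2 * M)) = R v - 2 * M := by
  rw [h.mul, mul_assoc, ← Real.exp_add]
  simp [neg_div]

/-- The mean curvature equation in null coordinates. -/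
theorem curvature (hM : 0 < M) (h : ∀ᶠ x in 𝓝 v, CMCAt M H c R S σ U V p q x) :
    8 * M ^ 2 * Real.exp (-R v / (2 * M)) / R v * (σ v * (deriv q v * p v - deriv p v * q v)) =
      H - 2 * c / R v ^ 3 + 1 / 2 * (1 / (2 * M) + 1 / R v) * boostRate H c (R v) := by
  have hv := h.self_of_nhds
  have hσ := hv.σ_pos.ne'
  have dE : HasDerivAt (fun x => Real.exp (-R x / (2 * M)))
      (Real.exp (-R v / (2 * M)) * (-(S v / σ v) / (2 * M))) v :=
    (hv.dR.neg.div_const _).exp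
  have dw : HasDerivAt (fun x => boostRate H c (R x))
      ((H - 2 * c / R v ^ 3) * (S v / σ v)) v :=
    (hasDerivAt_boostRate H c hv.R_pos.ne').comp v hv.dR
  have dp := hv.dp.hasDerivAt
  have dq := hv.dq.hasDerivAt
  set w' := H - 2 * c / R v ^ 3 with hw'
  have eunit : 16 * M ^ 2 * Real.exp (-R v / (2 * M)) * (-S v / (2 * M) * (p v * q v) +
      σ v * (deriv p v * q v + p v * deriv q v)) = S v := by
    have d1 := (dE.const_mul (16 * M ^ 2)).mul (dp.mul dq)
    have d2 := hv.dR.congr_of_eventuallyEq (h.mono fun x hx => hx.unit)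
    have := d1.unique d2
    simp only [Pi.mul_apply] at this
    field_simp at this ⊢
    linear_combination this
  have eU : 4 * M * Real.exp (-R v / (2 * M)) * (-S v / (2 * M) * (U v * q v) + p v * q v +
      σ v * (U v * deriv q v)) = S v * (S v + boostRate H c (R v)) +
      R v * (M / R v ^ 2 + boostRate H c (R v) * w' + w' * S v) := by
    have d1 := (dE.const_mul (4 * M)).mul (hv.dU.mul dq)
    have d2 := (hv.dR.mul (hv.dS.add dw)).congr_of_eventuallyEq (h.mono fun x hx => hx.relU)
    have := d1.unique d2
    simp only [Pi.mul_apply, Pi.add_apply, ← hw'] at this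
    generalize w' = y at *
    generalize M / R v ^ 2 = z at *
    field_simp at this ⊢
    linear_combination this
  have eV : 4 * M * Real.exp (-R v / (2 * M)) * (-S v / (2 * M) * (V v * p v) + q v * p v +
      σ v * (V v * deriv p v)) = S v * (S v - boostRate H c (R v)) +
      R v * (M / R v ^ 2 + boostRate H c (R v) * w' - w' * S v) := by
    have d1 := (dE.const_mul (4 * M)).mul (hv.dV.mul dp)
    have d2 := (hv.dR.mul (hv.dS.sub dw)).congr_of_eventuallyEq (h.mono fun x hx => hx.relV)
    have := d1.unique d2
    simp only [Pi.mul_apply, Pi.sub_apply, ← hw'] at this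
    generalize w' = y at *
    generalize M / R v ^ 2 = z at *
    field_simp at this ⊢
    linear_combination this
  -- Where U vanishes, V does not, and the same algebra applies after exchanging U with V, p with q
  -- and w with −w; both sides of the equation change sign.
  rcases hv.ne with hne | hne
  · exact curvature_algebra hM hv.R_pos hv.unit hv.relU hv.mul_exp_neg hv.relV
      hne eU eunit
  · have e := curvature_algebra (w := -boostRate H c (R v)) (w' := -w') (S := S v)
      (E := Real.exp (-R v / (2 * M))) (s := σ v)
      (U := V v) (V := U v) (p := q v) (q := p v) (p' := deriv q v) (q' := deriv p v)
      hM hv.R_pos (by linear_combination hv.unit) (by linear_combination hv.relV)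
      (by linear_combination hv.mul_exp_neg) (by linear_combination hv.relU) hne
      (by rw [eV]; ring) (by linear_combination eunit)
    linear_combination -e

end CMCAt

end Curvature

/-! ### The hypersurface swept out by a profile curve has mean curvature H. -/

/-- The point `(T, X)` of the Kruskal plane with null coordinates `U = X - T`, `V = X + T`. -/
noncomputable def nullPoint (U V : ℝ → ℝ) (v : ℝ) : ℝ × ℝ := ((V v - U v) / 2, (U v + V v) / 2)

theorem sphericallySymmetric_sweep (K : Set ℝ) (γ : ℝ → ℝ × ℝ) :
    SphericallySymmetric (sweep K γ) := fun _ _ _ _ _ _ h => h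

section Profile

variable {M H c : ℝ} {R S σ U V p q : ℝ → ℝ}

namespace CMCAt

variable {v : ℝ}

theorem hasDerivAt_X (h : CMCAt M H c R S σ U V p q v) :
    HasDerivAt (fun v => (U v + V v) / 2) ((p v + q v) / (2 * σ v)) v := by
  refine ((h.dU.add h.dV).div_const 2).congr_deriv ?_
  have := h.σ_pos.ne'
  field_simp

theorem hasDerivAt_T (h : CMCAt M H c R S σ U V p q v) :
    HasDerivAt (fun v => (V v - U v) / 2) ((q v - p v) / (2 * σ v)) v := by
  refine ((h.dV.sub h.dU).div_const 2).congr_deriv ?_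
  have := h.σ_pos.ne'
  field_simp

theorem X_deriv_pos (h : CMCAt M H c R S σ U V p q v) : 0 < (p v + q v) / (2 * σ v) := by
  have := h.σ_pos
  have := h.p_pos
  have := h.q_pos
  positivity

theorem contDiffAt_X (h : CMCAt M H c R S σ U V p q v) :
    ContDiffAt ℝ ∞ (fun v => (U v + V v) / 2) v := (h.smoothU.add h.smoothV).div_const 2

theorem sq_sub_sq (h : CMCAt M H c R S σ U V p q v) :
    ((U v + V v) / 2) ^ 2 - ((V v - U v) / 2) ^ 2 = radiusFun M (R v) := by
  rw [← h.radiusFun_eq]; ring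

theorem kruskalR_eq (hM : 0 < M) (h : CMCAt M H c R S σ U V p q v) :
    kruskalR M ((V v - U v) / 2) ((U v + V v) / 2) = R v :=
  kruskalR_eq_of hM h.R_pos h.sq_sub_sq

theorem mem_kruskal (hM : 0 < M) (h : CMCAt M H c R S σ U V p q v) :
    -(2 * M) < ((U v + V v) / 2) ^ 2 - ((V v - U v) / 2) ^ 2 := by
  rw [h.sq_sub_sq]; exact neg_lt_radiusFun hM h.R_pos

theorem kruskalA_mul (hM : 0 < M) (h : CMCAt M H c R S σ U V p q v) :
    kruskalA M ((V v - U v) / 2) ((U v + V v) / 2) * (p v * q v) = 1 := by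
  have h1 := h.unit
  have h2 := h.R_pos
  unfold kruskalA
  rw [h.kruskalR_eq hM, div_mul_eq_mul_div, h1, div_self h2.ne']

end CMCAt

theorem strictMono_X (hall : ∀ v, CMCAt M H c R S σ U V p q v) : StrictMono fun v => (U v + V v) / 2 :=
  strictMono_of_hasDerivAt_pos (fun v => (hall v).hasDerivAt_X) fun v => (hall v).X_deriv_pos

theorem hasStrictDerivAt_X (hall : ∀ v, CMCAt M H c R S σ U V p q v) (v : ℝ) :
    HasStrictDerivAt (fun v => (U v + V v) / 2) ((p v + q v) / (2 * σ v)) v :=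
  (hall v).contDiffAt_X.hasStrictDerivAt' (hall v).hasDerivAt_X (by simp)

theorem isOpenMap_X (hall : ∀ v, CMCAt M H c R S σ U V p q v) : IsOpenMap fun v => (U v + V v) / 2 :=
  isOpenMap_of_hasStrictDerivAt (hasStrictDerivAt_X hall) fun v => (hall v).X_deriv_pos.ne'

/-- The parameter value as a function of `X`. -/
noncomputable def paramOfX (U V : ℝ → ℝ) : ℝ → ℝ := Function.invFun fun v => (U v + V v) / 2

theorem paramOfX_X (hall : ∀ v, CMCAt M H c R S σ U V p q v) (v : ℝ) :
    paramOfX U V ((U v + V v) / 2) = v :=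
  Function.leftInverse_invFun (strictMono_X hall).injective v

theorem hasDerivAt_paramOfX (hall : ∀ v, CMCAt M H c R S σ U V p q v) (v : ℝ) :
    HasDerivAt (paramOfX U V) ((p v + q v) / (2 * σ v))⁻¹ ((U v + V v) / 2) :=
  ((hasStrictDerivAt_X hall v).to_local_left_inverse (hall v).X_deriv_pos.ne'
    (Eventually.of_forall (paramOfX_X hall))).hasDerivAt

/-- Injectivity of X identifies the global inverse near the point with the local one of the inverse
function theorem, which is smooth. -/
theorem contDiffAt_paramOfX (hall : ∀ v, CMCAt M H c R S σ U V p q v) (v : ℝ) :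
    ContDiffAt ℝ ∞ (paramOfX U V) ((U v + V v) / 2) := by
  have hs := (hall v).contDiffAt_X
  have hd : HasFDerivAt (fun v => (U v + V v) / 2)
      ((ContinuousLinearEquiv.unitsEquivAut ℝ
        (Units.mk0 _ (hall v).X_deriv_pos.ne') : ℝ ≃L[ℝ] ℝ) : ℝ →L[ℝ] ℝ) v := by
    refine (hall v).hasDerivAt_X.hasFDerivAt.congr_fderiv ?_
    ext
    simp
  have hloc := hs.to_localInverse hd (by simp)
  refine hloc.congr_of_eventuallyEq ?_
  have hst := hs.hasStrictFDerivAt' hd (by simp)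
  filter_upwards [hst.eventually_right_inverse] with z hz
  have := paramOfX_X hall (hst.localInverse _ _ _ z)
  rw [hz] at this
  exact this

/-- X increases strictly along the curve, so the surface is a graph T = τ(X) with τ' = (q − p)/(q +
p), and |τ'| < 1 because p and q are positive. An open set K of parameters suffices, which covers
the pieces between horizons together with their unions. -/
theorem isSSCMC_sweep (hall : ∀ v, CMCAt M H c R S σ U V p q v) (hM : 0 < M) {K : Set ℝ}
    (hK : IsOpen K) :
    IsSSCMC M H (sweep K (nullPoint U V)) := by
  refine ⟨?_, sphericallySymmetric_sweep _ _, ?_⟩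
  · rintro ⟨T, X, z⟩ ⟨v, -, hv⟩
    simp only [nullPoint, Prod.mk.injEq] at hv
    have := (hall v).mem_kruskal hM
    rw [← hv.1, ← hv.2] at this
    exact this
  intro x hx2 hxS
  set g := paramOfX U V with hg
  have hgd := hasDerivAt_paramOfX hall
  have hgX := paramOfX_X hall
  rw [← hg] at hgd hgX
  have hτ : ∀ v, HasDerivAt (fun z => (V (g z) - U (g z)) / 2)
      ((q v - p v) / (q v + p v)) ((U v + V v) / 2) := by
    intro v
    have h1 := (hall v).hasDerivAt_T
    rw [← hgX v] at h1
    have h2 := h1.comp _ (hgd v)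
    rw [hgX v] at h2
    refine h2.congr_deriv ?_
    have a1 := (hall v).p_pos
    have a2 := (hall v).q_pos
    have a3 := (hall v).σ_pos
    field_simp
    ring
  have hOopen : IsOpen ((fun v => (U v + V v) / 2) '' K) := isOpenMap_X hall K hK
  -- `paramOfX` is an inverse only on the range of X. Restricting to the open image of K also makes
  -- the level set consist of points of this piece alone.
  refine ⟨{y | y 1 ∈ (fun v => (U v + V v) / 2) '' K ∧ y 2 ∈ Ioo 0 Real.pi},
    fun y => (V (g (y 1)) - U (g (y 1))) / 2 - y 0, ?_, ?_, ?_, ?_⟩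
  · have c1 : Continuous fun y : Fin 4 → ℝ => y 1 := continuous_apply 1
    have c2 : Continuous fun y : Fin 4 → ℝ => y 2 := continuous_apply 2
    exact (hOopen.preimage c1).inter (isOpen_Ioo.preimage c2)
  · obtain ⟨v, hvK, hv⟩ := hxS
    simp only [nullPoint, chartPoint, Prod.mk.injEq] at hv
    exact ⟨⟨v, hvK, hv.2.symm⟩, hx2⟩
  · rintro y ⟨⟨v, -, hv⟩, -⟩
    have hgy : g (y 1) = v := by rw [← hv]; exact hgX v
    have c1 : ContDiffAt ℝ ∞ (fun y : Fin 4 → ℝ => g (y 1)) y := by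
      have := contDiffAt_paramOfX hall v
      rw [show (U v + V v) / 2 = y 1 from hv] at this
      exact this.comp y (contDiff_apply ℝ ℝ (1 : Fin 4)).contDiffAt
    have sU := (hall v).smoothU
    have sV := (hall v).smoothV
    rw [← hgy] at sU sV
    have c2 : ContDiffAt ℝ ∞ (fun y : Fin 4 → ℝ => U (g (y 1))) y := sU.comp y c1
    have c3 : ContDiffAt ℝ ∞ (fun y : Fin 4 → ℝ => V (g (y 1))) y := sV.comp y c1
    exact (((c3.sub c2).div_const 2).sub
      (contDiff_apply ℝ ℝ (0 : Fin 4)).contDiffAt).contDiffWithinAt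
  · rintro y ⟨⟨v, hvK, hv⟩, hy2⟩
    have hv' : (U v + V v) / 2 = y 1 := hv
    have hgy : g (y 1) = v := by rw [← hv]; exact hgX v
    refine ⟨?_, ?_⟩
    · beta_reduce
      rw [hgy]
      constructor
      · rintro ⟨v', -, h'⟩
        simp only [nullPoint, chartPoint, Prod.mk.injEq] at h'
        have : v' = v := by rw [← hgX v', ← h'.2, hgy]
        rw [h'.1, this, sub_self]
      · intro h0
        refine ⟨v, hvK, ?_⟩
        simp only [nullPoint, chartPoint, Prod.mk.injEq]
        exact ⟨by linarith, hv'.symm⟩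
    · intro h0
      beta_reduce at h0
      rw [hgy] at h0
      have hy0 : y 0 = (V v - U v) / 2 := by linarith
      have a1 := (hall v).p_pos
      have a2 := (hall v).q_pos
      have a3 := (hall v).σ_pos
      have aR := (hall v).R_pos
      have hsin : Real.sin (y 2) ≠ 0 := (Real.sin_pos_of_mem_Ioo hy2).ne'
      have hkr : kruskalR M (y 0) (y 1) = R v := by
        rw [hy0, ← hv']; exact (hall v).kruskalR_eq hM
      have hkA : kruskalA M (y 0) (y 1) * (p v * q v) = 1 := by
        rw [hy0, ← hv']; exact (hall v).kruskalA_mul hM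
      have hmem : -(2 * M) < y 1 ^ 2 - y 0 ^ 2 := by
        rw [hy0, ← hv']; exact (hall v).mem_kruskal hM
      have hApos := kruskalA_pos hM hmem
      have hτv := hτ v
      rw [hv'] at hτv
      have hlt : 1 - ((q v - p v) / (q v + p v)) ^ 2 = 4 * (p v * q v) / (p v + q v) ^ 2 := by
        field_simp
        ring
      have hlt0 : 0 < 1 - ((q v - p v) / (q v + p v)) ^ 2 := by rw [hlt]; positivity
      refine ⟨?_, ?_, ?_⟩
      · rw [gradSq_graphFun hτv rfl rfl rfl hApos.ne' (hkr ▸ aR.ne') hsin]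
        have : 0 < (kruskalA M (y 0) (y 1))⁻¹ := by positivity
        have := mul_pos hlt0 this
        linarith
      · rw [grad_graphFun hτv rfl rfl rfl hApos.ne' (hkr ▸ aR.ne') hsin]
        simpa using hApos
      · set τ1 : ℝ → ℝ := fun z => (q (g z) - p (g z)) / (q (g z) + p (g z)) with hτ1
        have hτ1y : τ1 (y 1) = (q v - p v) / (q v + p v) := by simp only [hτ1, hgy]
        have hev : ∀ᶠ z in 𝓝 (y 1),
            HasDerivAt (fun z => (V (g z) - U (g z)) / 2) (τ1 z) z := by
          filter_upwards [hOopen.mem_nhds ⟨v, hvK, hv⟩]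
          rintro z ⟨v', -, rfl⟩
          simp only [hτ1, hgX v']
          exact hτ v'
        have hdq : DifferentiableAt ℝ q (g (y 1)) := hgy ▸ (hall v).dq
        have hdp : DifferentiableAt ℝ p (g (y 1)) := hgy ▸ (hall v).dp
        have hgdy := hgd v
        rw [hv'] at hgdy
        have hτ2 : HasDerivAt τ1
            (4 * σ v * (deriv q v * p v - deriv p v * q v) / (p v + q v) ^ 3) (y 1) := by
          have e1 := hdq.hasDerivAt.comp _ hgdy
          have e2 := hdp.hasDerivAt.comp _ hgdy
          have hne : q (g (y 1)) + p (g (y 1)) ≠ 0 := by rw [hgy]; positivity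
          refine ((e1.sub e2).div (e1.add e2) hne).congr_deriv ?_
          simp only [Pi.add_apply, Pi.sub_apply, Function.comp, hgy]
          field_simp
          ring
        set κ := 2 * M * Real.exp (-R v / (2 * M)) / R v with hκ
        have hAκ : kruskalA M (y 0) (y 1) = 8 * M * κ := by
          unfold kruskalA; rw [hkr, hκ]; ring
        rw [hAκ] at hkA hApos
        -- Unit speed means a p q = 1, and 1 − τ'² = 4pq/(p + q)², so a(1 − τ'²) = (2/(p + q))².
        have hν : (p v + q v) / 2 = (√(8 * M * κ * (1 - τ1 (y 1) ^ 2)))⁻¹ := by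
          have e : 8 * M * κ * (1 - τ1 (y 1) ^ 2) = (2 / (p v + q v)) ^ 2 := by
            rw [hτ1y, hlt]
            field_simp
            linear_combination 4 * hkA
          rw [e, Real.sqrt_sq (by positivity), inv_div]
        rw [meanCurvature_graphFun hM hmem hsin hev hτ2 (hτ1y ▸ hlt0) hkr hκ rfl hν, hτ1y, hy0,
          ← hv']
        have hcurv := CMCAt.curvature hM (Eventually.of_forall hall) (v := v)
        have relU := (hall v).relU
        have relV := (hall v).relV
        have hw : κ * (q v * U v - p v * V v) = boostRate H c (R v) := by
          have e : boostRate H c (R v) = (R v * (S v + boostRate H c (R v)) -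
              R v * (S v - boostRate H c (R v))) / (2 * R v) := by field_simp; ring
          rw [e, ← relU, ← relV, hκ]
          ring
        have hκ2 : 8 * M ^ 2 * Real.exp (-R v / (2 * M)) / R v = 4 * M * κ := by
          rw [hκ]; ring
        rw [hκ2] at hcurv
        have t1 : 8 * M * κ * ((p v + q v) / 2) ^ 3 *
            (4 * σ v * (deriv q v * p v - deriv p v * q v) / (p v + q v) ^ 3) =
            4 * M * κ * (σ v * (deriv q v * p v - deriv p v * q v)) := by
          field_simp
          ring
        have t2 : 2 * κ * ((p v + q v) / 2) * ((q v - p v) / (q v + p v) * ((U v + V v) / 2) -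
            (V v - U v) / 2) = boostRate H c (R v) := by
          rw [← hw]
          field_simp
          ring
        rw [t1, t2, hcurv]
        -- The terms with 1/(2M) + 1/r cancel, and what is left is w' + 2w/r = 3H for w = Hr + c/r².
        unfold boostRate
        field_simp
        ring

end Profile

/-! ### Ends -/

/-- A space with a continuous function all of whose level bands are compact, and whose upper and
lower parts are nonempty and connected, has exactly two ends. -/
theorem ncard_spaceEnds_eq_two {Y : Type*} [TopologicalSpace Y] {f : Y → ℝ} (hf : Continuous f)
    (hcpt : ∀ a b : ℝ, IsCompact (f ⁻¹' Icc a b))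
    (htop : ∀ a : ℝ, IsConnected (f ⁻¹' Ioi a)) (hbot : ∀ a : ℝ, IsConnected (f ⁻¹' Iio a)) :
    (spaceEnds Y).ncard = 2 := by
  let band : ℝ → TopologicalSpace.Compacts Y := fun a => ⟨f ⁻¹' Icc (-a) a, hcpt _ _⟩
  have hband : ∀ K : TopologicalSpace.Compacts Y, ∃ a : ℝ, 0 < a ∧ K ≤ band a := by
    intro K
    obtain ⟨b, hb⟩ := (K.isCompact.image hf).isBounded.subset_closedBall 0
    refine ⟨max b 1, by positivity, fun y hy => ?_⟩
    have := hb (mem_image_of_mem f hy)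
    rw [Real.closedBall_eq_Icc] at this
    simp only [zero_sub, zero_add] at this
    exact ⟨by linarith [this.1, le_max_left b 1], this.2.trans (le_max_left _ _)⟩
  choose bd hbd0 hbd using hband
  choose yt hyt using fun a => (htop a).nonempty
  choose yb hyb using fun a => (hbot (-a)).nonempty
  have htopsub : ∀ K : TopologicalSpace.Compacts Y, ∀ a, K ≤ band a →
      f ⁻¹' Ioi a ⊆ (K : Set Y)ᶜ := fun K a hKa y hy hyK =>
    absurd (hKa hyK).2 (not_le.2 hy)
  have hbotsub : ∀ K : TopologicalSpace.Compacts Y, ∀ a, K ≤ band a →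
      f ⁻¹' Iio (-a) ⊆ (K : Set Y)ᶜ := fun K a hKa y hy hyK =>
    absurd (hKa hyK).1 (not_le.2 hy)
  have htopcomp : ∀ K : TopologicalSpace.Compacts Y, ∀ a, K ≤ band a → ∀ y, a < f y →
      f ⁻¹' Ioi a ⊆ connectedComponentIn (K : Set Y)ᶜ y := fun K a hKa y hy =>
    (htop a).isPreconnected.subset_connectedComponentIn hy (htopsub K a hKa)
  have hbotcomp : ∀ K : TopologicalSpace.Compacts Y, ∀ a, K ≤ band a → ∀ y, f y < -a →
      f ⁻¹' Iio (-a) ⊆ connectedComponentIn (K : Set Y)ᶜ y := fun K a hKa y hy =>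
    (hbot (-a)).isPreconnected.subset_connectedComponentIn hy (hbotsub K a hKa)
  -- The two candidate ends: for each K, the component of the complement containing all points where
  -- f is large, and the one containing all points where −f is large. The next two facts show that
  -- the far point chosen does not matter.
  let et : TopologicalSpace.Compacts Y → Set Y := fun K =>
    connectedComponentIn (K : Set Y)ᶜ (yt (bd K))
  let eb : TopologicalSpace.Compacts Y → Set Y := fun K =>
    connectedComponentIn (K : Set Y)ᶜ (yb (bd K))
  have het : ∀ K a y, K ≤ band a → a < f y → et K = connectedComponentIn (K : Set Y)ᶜ y := by
    intro K a y hKa hy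
    have h1 := htopcomp K (bd K) (hbd K) _ (hyt (bd K))
    have h2 := htopcomp K a hKa y hy
    let z := yt (max a (bd K))
    have hz : max a (bd K) < f z := hyt _
    have hz1 : z ∈ et K := h1 ((le_max_right _ _).trans_lt hz)
    have hz2 : z ∈ connectedComponentIn (K : Set Y)ᶜ y := h2 ((le_max_left _ _).trans_lt hz)
    exact (connectedComponentIn_eq hz1).trans (connectedComponentIn_eq hz2).symm
  have heb : ∀ K a y, K ≤ band a → f y < -a → eb K = connectedComponentIn (K : Set Y)ᶜ y := by
    intro K a y hKa hy
    have h1 := hbotcomp K (bd K) (hbd K) _ (hyb (bd K))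
    have h2 := hbotcomp K a hKa y hy
    let z := yb (max a (bd K))
    have hz : f z < -(max a (bd K)) := hyb _
    have hz1 : z ∈ eb K := h1 (hz.trans_le (neg_le_neg (le_max_right _ _)))
    have hz2 : z ∈ connectedComponentIn (K : Set Y)ᶜ y :=
      h2 (hz.trans_le (neg_le_neg (le_max_left _ _)))
    exact (connectedComponentIn_eq hz1).trans (connectedComponentIn_eq hz2).symm
  have hmono : ∀ K L : TopologicalSpace.Compacts Y, K ≤ L → (L : Set Y)ᶜ ⊆ (K : Set Y)ᶜ :=
    fun K L h => compl_subset_compl.2 h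
  have hbm : ∀ a b : ℝ, a ≤ b → band a ≤ band b := fun a b hab y hy =>
    ⟨(neg_le_neg hab).trans hy.1, hy.2.trans hab⟩
  have het_mem : et ∈ spaceEnds Y := by
    refine ⟨fun K => ⟨_, htopsub K _ (hbd K) (hyt _), rfl⟩, fun K L hKL => ?_⟩
    rw [het K (bd L) (yt (bd L)) (hKL.trans (hbd L)) (hyt _)]
    exact connectedComponentIn_mono _ (hmono K L hKL)
  have heb_mem : eb ∈ spaceEnds Y := by
    refine ⟨fun K => ⟨_, hbotsub K _ (hbd K) (hyb _), rfl⟩, fun K L hKL => ?_⟩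
    rw [heb K (bd L) (yb (bd L)) (hKL.trans (hbd L)) (hyb _)]
    exact connectedComponentIn_mono _ (hmono K L hKL)
  -- The band of height 0 is the zero level of f, so f has constant sign on each component of its
  -- complement.
  have hside : ∀ y, f y ≠ 0 →
      (0 < f y → connectedComponentIn ((band 0 : TopologicalSpace.Compacts Y) : Set Y)ᶜ y ⊆ f ⁻¹' Ioi 0) ∧
      (f y < 0 → connectedComponentIn ((band 0 : TopologicalSpace.Compacts Y) : Set Y)ᶜ y ⊆ f ⁻¹' Iio 0) := by
    intro y hy
    have hsub := connectedComponentIn_subset ((band 0 : TopologicalSpace.Compacts Y) : Set Y)ᶜ y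
    have hne : ∀ z ∈ connectedComponentIn ((band 0 : TopologicalSpace.Compacts Y) : Set Y)ᶜ y,
        f z ≠ 0 := fun z hz h0 => hsub hz (by
          change f z ∈ Icc (-0) 0
          rw [h0]; simp)
    have hy' : y ∈ ((band 0 : TopologicalSpace.Compacts Y) : Set Y)ᶜ := fun h => hy (by
      have h' : f y ∈ Icc (-0 : ℝ) 0 := h
      rw [neg_zero] at h'
      exact le_antisymm h'.2 h'.1)
    have hyc := mem_connectedComponentIn hy'
    have hpre := (isPreconnected_connectedComponentIn
      (F := ((band 0 : TopologicalSpace.Compacts Y) : Set Y)ᶜ) (x := y)).image f hf.continuousOn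
    constructor
    · intro h0 z hz
      by_contra hz0
      have := hpre.Icc_subset (mem_image_of_mem f hz) (mem_image_of_mem f hyc)
        ⟨not_lt.1 hz0, h0.le⟩
      obtain ⟨z', hz', h'⟩ := this
      exact hne z' hz' h'
    · intro h0 z hz
      by_contra hz0
      have := hpre.Icc_subset (mem_image_of_mem f hyc) (mem_image_of_mem f hz)
        ⟨h0.le, not_lt.1 hz0⟩
      obtain ⟨z', hz', h'⟩ := this
      exact hne z' hz' h'
  have hnotband : ∀ a y, y ∈ ((band a : TopologicalSpace.Compacts Y) : Set Y)ᶜ →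
      a < f y ∨ f y < -a := by
    intro a y hy
    by_contra! h
    exact hy ⟨h.2, h.1⟩
  have hne : et ≠ eb := by
    intro h
    have h1 : et (band 0) ⊆ f ⁻¹' Ioi 0 := by
      have hp : 0 < f (yt 0) := hyt 0
      rw [het (band 0) 0 (yt 0) le_rfl hp]
      exact (hside _ hp.ne').1 hp
    have h2 : eb (band 0) ⊆ f ⁻¹' Iio 0 := by
      have hp : f (yb 0) < 0 := by simpa using hyb 0
      rw [heb (band 0) 0 (yb 0) le_rfl (by simpa using hp)]
      exact (hside _ hp.ne).2 hp
    have h3 : yt (bd (band 0)) ∈ et (band 0) :=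
      mem_connectedComponentIn (htopsub _ _ (hbd _) (hyt _))
    have h4 := h1 h3
    rw [h] at h3
    exact lt_asymm (show f _ < 0 from h2 h3) h4
  -- The sign of f on e (band 0) decides which end e is. A point of e (band (bd K)) lies in e (band
  -- 0), so it has that sign; being outside the larger band it is far out, and it also lies in e K.
  have hcover : ∀ e ∈ spaceEnds Y, e = et ∨ e = eb := by
    intro e ⟨he1, he2⟩
    obtain ⟨y0, hy0, hey0⟩ := he1 (band 0)
    rcases hnotband 0 y0 hy0 with h0 | h0
    · left
      funext K
      obtain ⟨y, hy, hey⟩ := he1 (band (bd K))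
      have hye : y ∈ e (band (bd K)) := hey ▸ mem_connectedComponentIn hy
      have hy1 : y ∈ e (band 0) := he2 _ _ (hbm 0 _ (hbd0 K).le) hye
      rw [hey0] at hy1
      have hpos : 0 < f y := (hside y0 h0.ne').1 h0 hy1
      have hgt : bd K < f y := by
        rcases hnotband _ y hy with h | h
        · exact h
        · linarith [hbd0 K]
      rw [het K (bd K) y (hbd K) hgt]
      have hyK : y ∈ e K := he2 _ _ (hbd K) hye
      obtain ⟨y', -, hey'⟩ := he1 K
      rw [hey'] at hyK ⊢
      exact connectedComponentIn_eq hyK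
    · right
      rw [neg_zero] at h0
      funext K
      obtain ⟨y, hy, hey⟩ := he1 (band (bd K))
      have hye : y ∈ e (band (bd K)) := hey ▸ mem_connectedComponentIn hy
      have hy1 : y ∈ e (band 0) := he2 _ _ (hbm 0 _ (hbd0 K).le) hye
      rw [hey0] at hy1
      have hneg : f y < 0 := (hside y0 h0.ne).2 h0 hy1
      have hlt : f y < -bd K := by
        rcases hnotband _ y hy with h | h
        · linarith [hbd0 K]
        · exact h
      rw [heb K (bd K) y (hbd K) hlt]
      have hyK : y ∈ e K := he2 _ _ (hbd K) hye
      obtain ⟨y', -, hey'⟩ := he1 K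
      rw [hey'] at hyK ⊢
      exact connectedComponentIn_eq hyK
  have : spaceEnds Y = {et, eb} := by
    ext e
    constructor
    · exact hcover e
    · rintro (rfl | rfl)
      · exact het_mem
      · exact heb_mem
  rw [this, ncard_pair hne]

theorem isConnected_univ_S2 : IsConnected (univ : Set S2) := by
  have h : IsConnected (Metric.sphere (0 : E3) 1) := by
    apply isConnected_sphere _ _ zero_le_one
    rw [← Module.finrank_eq_rank]
    simp
  exact isConnected_iff_connectedSpace.1 h |>.toPreconnectedSpace.isPreconnected_univ |> fun hp =>
    ⟨⟨⟨_, h.nonempty.some_mem⟩, mem_univ _⟩, hp⟩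

/-- A curve whose speed is integrable up to the end of its interval of definition converges. -/
theorem exists_tendsto_of_norm_deriv_le {E : Type*} [NormedAddCommGroup E] [NormedSpace ℝ E]
    [CompleteSpace E] {f f' : ℝ → E} {g : ℝ → ℝ} {a b : ℝ} (hab : a < b)
    (hd : ∀ s ∈ Ioo a b, HasDerivAt f (f' s) s) (hc : ContinuousOn f' (Ioo a b))
    (hg : IntegrableOn g (Ioo a b)) (hle : ∀ s ∈ Ioo a b, ‖f' s‖ ≤ g s) :
    ∃ l, Tendsto f (𝓝[<] b) (𝓝 l) := by
  have hint : IntegrableOn f' (Ioo a b) := by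
    refine Integrable.mono' hg (hc.aestronglyMeasurable measurableSet_Ioo) ?_
    exact (ae_restrict_iff' measurableSet_Ioo).2 (Eventually.of_forall hle)
  obtain ⟨m, hm⟩ := exists_between hab
  have hint' : IntegrableOn f' (uIcc m b) := by
    rw [uIcc_of_le hm.2.le]
    rw [integrableOn_Icc_iff_integrableOn_Ioo]
    exact hint.mono_set (Ioo_subset_Ioo_left hm.1.le)
  have hcont := intervalIntegral.continuousOn_primitive_interval hint'
  have hb : Tendsto (fun s => ∫ t in m..s, f' t) (𝓝[<] b) (𝓝 (∫ t in m..b, f' t)) := by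
    have h1 := hcont b right_mem_uIcc
    rw [uIcc_of_le hm.2.le] at h1
    refine h1.mono_left ?_
    rw [← nhdsWithin_Ioo_eq_nhdsLT hm.2]
    exact nhdsWithin_mono _ Ioo_subset_Icc_self
  refine ⟨f m + ∫ t in m..b, f' t, (hb.const_add (f m)).congr' ?_⟩
  rw [← nhdsWithin_Ioo_eq_nhdsLT hm.2]
  filter_upwards [self_mem_nhdsWithin] with s hs
  have hsub : uIcc m s ⊆ Ioo a b := by
    rw [uIcc_of_le hs.1.le]
    exact fun t ht => ⟨hm.1.trans_le ht.1, ht.2.trans_lt hs.2⟩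
  rw [intervalIntegral.integral_eq_sub_of_hasDerivAt (fun t ht => hd t (hsub ht))
    (hc.mono hsub).intervalIntegrable]
  abel

/-! ### Topology, closedness and completeness of the swept hypersurface. -/

section Profile

variable {M H c : ℝ} {R S σ U V p q : ℝ → ℝ}

/-- The parametrization of the hypersurface by `ℝ × S²`. -/
noncomputable def sweepMap (U V : ℝ → ℝ) (x : ℝ × S2) : KPoint :=
  ((V x.1 - U x.1) / 2, (U x.1 + V x.1) / 2, x.2)

theorem range_sweepMap (U V : ℝ → ℝ) (K : Set ℝ) :
    sweepMap U V '' (K ×ˢ univ) = sweep K (nullPoint U V) := by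
  ext ⟨T, X, z⟩
  constructor
  · rintro ⟨⟨v, z'⟩, ⟨hv, -⟩, h⟩
    simp only [sweepMap, Prod.mk.injEq] at h
    exact ⟨v, hv, by simp [nullPoint, h.1, h.2.1]⟩
  · rintro ⟨v, hv, h⟩
    simp only [nullPoint, Prod.mk.injEq] at h
    exact ⟨(v, z), ⟨hv, mem_univ _⟩, by simp [sweepMap, h.1, h.2]⟩

theorem continuous_sweepMap (hall : ∀ v, CMCAt M H c R S σ U V p q v) :
    Continuous (sweepMap U V) := by
  have hU : Continuous U := continuous_iff_continuousAt.2 fun v => (hall v).dU.continuousAt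
  have hV : Continuous V := continuous_iff_continuousAt.2 fun v => (hall v).dV.continuousAt
  unfold sweepMap
  fun_prop

theorem isConnected_sweep (hall : ∀ v, CMCAt M H c R S σ U V p q v) {K : Set ℝ}
    (hK : IsConnected K) : IsConnected (sweep K (nullPoint U V)) := by
  rw [← range_sweepMap]
  exact (hK.prod isConnected_univ_S2).image _ (continuous_sweepMap hall).continuousOn

/-- The curve parameter, recovered from X, is a continuous function on the surface. Its level bands
are images of [a, b] × S², hence compact, and its upper and lower parts are images of half-lines
times S², hence connected. -/
theorem ncard_spaceEnds_sweep (hall : ∀ v, CMCAt M H c R S σ U V p q v) :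
    (spaceEnds (sweep univ (nullPoint U V))).ncard = 2 := by
  let Φ : ℝ × S2 → sweep univ (nullPoint U V) := fun x =>
    ⟨sweepMap U V x, by rw [← range_sweepMap]; exact mem_image_of_mem _ ⟨mem_univ _, mem_univ _⟩⟩
  have hΦ : Continuous Φ := (continuous_sweepMap hall).subtype_mk _
  let f : sweep univ (nullPoint U V) → ℝ := fun y => paramOfX U V y.1.2.1
  have hfΦ : ∀ x, f (Φ x) = x.1 := fun x => paramOfX_X hall x.1
  have hsurj : ∀ y, Φ (f y, y.1.2.2) = y := by
    rintro ⟨⟨T, X, z⟩, v, -, h⟩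
    simp only [nullPoint, Prod.mk.injEq] at h
    obtain ⟨rfl, rfl⟩ := h
    apply Subtype.ext
    simp [Φ, f, sweepMap, paramOfX_X hall]
  have hf : Continuous f := by
    rw [continuous_iff_continuousAt]
    rintro ⟨⟨T, X, z⟩, v, hv, h⟩
    simp only [nullPoint, Prod.mk.injEq] at h
    have h1 := (hasDerivAt_paramOfX hall v).continuousAt
    rw [← h.2] at h1
    have h2 : Continuous fun y : sweep univ (nullPoint U V) => y.1.2.1 := by fun_prop
    exact ContinuousAt.comp (f := fun y : sweep univ (nullPoint U V) => y.1.2.1) h1 h2.continuousAt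
  have himg : ∀ K : Set ℝ, f ⁻¹' K = Φ '' (K ×ˢ univ) := by
    intro K
    ext y
    constructor
    · intro hy
      exact ⟨(f y, y.1.2.2), ⟨hy, mem_univ _⟩, hsurj y⟩
    · rintro ⟨x, hx, rfl⟩
      change f (Φ x) ∈ K
      rw [hfΦ]
      exact hx.1
  apply ncard_spaceEnds_eq_two hf
  · intro a b
    rw [himg]
    exact (isCompact_Icc.prod isCompact_univ).image hΦ
  · intro a
    rw [himg]
    exact (isConnected_Ioi.prod isConnected_univ_S2).image _ hΦ.continuousOn
  · intro a
    rw [himg]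
    exact (isConnected_Iio.prod isConnected_univ_S2).image _ hΦ.continuousOn

/-- If the parameter is bounded where `r` lies in a compact subset of `(0, ∞)` and `V` is bounded,
then the hypersurface is closed. -/
theorem sweep_closed (hM : 0 < M) (hall : ∀ v, CMCAt M H c R S σ U V p q v)
    (hprop : ∀ ε C : ℝ, 0 < ε → ∃ B, ∀ v, ε ≤ R v → R v ≤ C → |V v| ≤ C → |v| ≤ B) :
    Kruskal M ∩ closure (sweep univ (nullPoint U V)) ⊆ sweep univ (nullPoint U V) := by
  rintro ⟨T, X, z⟩ ⟨hk, hcl⟩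
  have hk' : -(2 * M) < X ^ 2 - T ^ 2 := hk
  have hpos : 0 < kruskalR M T X := (areaRadius_spec hM hk').1
  set r := kruskalR M T X with hr
  have hcontR : ContinuousAt (fun y : KPoint => kruskalR M y.1 y.2.1) (T, X, z) := by
    have h1 := (hasDerivAt_areaRadius hM hk').continuousAt
    have h2 : Continuous fun y : KPoint => y.2.1 ^ 2 - y.1 ^ 2 := by fun_prop
    exact ContinuousAt.comp (f := fun y : KPoint => y.2.1 ^ 2 - y.1 ^ 2) h1 h2.continuousAt
  have hcontV : Continuous fun y : KPoint => |y.1 + y.2.1| := by fun_prop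
  -- Near the limit point, r stays between half its value and its value plus 1, and V stays bounded,
  -- so only parameters in a compact interval contribute.
  obtain ⟨B, hB⟩ := hprop (r / 2) (r + 1 + |T + X|) (by positivity)
  have hsub : ∀ᶠ y in 𝓝 ((T, X, z) : KPoint), y ∈ sweep univ (nullPoint U V) →
      y ∈ sweep (Icc (-B) B) (nullPoint U V) := by
    have e1 : ∀ᶠ y in 𝓝 ((T, X, z) : KPoint), r / 2 < kruskalR M y.1 y.2.1 :=
      hcontR.eventually (lt_mem_nhds (show r / 2 < r by linarith))
    have e2 : ∀ᶠ y in 𝓝 ((T, X, z) : KPoint), kruskalR M y.1 y.2.1 < r + 1 :=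
      hcontR.eventually (gt_mem_nhds (show r < r + 1 by linarith))
    have e3 : ∀ᶠ y in 𝓝 ((T, X, z) : KPoint), |y.1 + y.2.1| < 1 + |T + X| :=
      hcontV.continuousAt.eventually (gt_mem_nhds (by simp))
    filter_upwards [e1, e2, e3]
    rintro ⟨T', X', z'⟩ h1 h2 h3 ⟨v, -, hv⟩
    refine ⟨v, abs_le.1 (hB v ?_ ?_ ?_), hv⟩
    all_goals
      simp only [nullPoint, Prod.mk.injEq] at hv
      simp only [hv.1, hv.2, (hall v).kruskalR_eq hM] at h1 h2 h3
    · exact h1.le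
    · have := abs_nonneg (T + X)
      linarith
    · rw [show (V v - U v) / 2 + (U v + V v) / 2 = V v by ring] at h3
      linarith
  have hclosed : IsClosed (sweep (Icc (-B) B) (nullPoint U V)) := by
    rw [← range_sweepMap]
    exact ((isCompact_Icc.prod isCompact_univ).image (continuous_sweepMap hall)).isClosed
  have hmem : (T, X, z) ∈ closure (sweep (Icc (-B) B) (nullPoint U V)) := by
    rw [mem_closure_iff_frequently] at hcl ⊢
    exact (hcl.and_eventually hsub).mono fun y hy => hy.2 hy.1
  rw [hclosed.closure_eq] at hmem
  obtain ⟨v, -, hv⟩ := hmem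
  exact ⟨v, mem_univ _, hv⟩

/-- Completeness in terms of the proper length `ℓ` along the profile curve. -/
theorem isCompleteIn_sweep (hM : 0 < M) (hall : ∀ v, CMCAt M H c R S σ U V p q v)
    (hprop : ∀ ε C : ℝ, 0 < ε → ∃ B, ∀ v, ε ≤ R v → R v ≤ C → |V v| ≤ C → |v| ≤ B)
    {ℓ : ℝ → ℝ} (hℓ : ∀ v, HasDerivAt ℓ (1 / σ v) v) (htop : ∀ C, ∃ v, C < ℓ v)
    (hbot : (∀ C, ∃ v, ℓ v < C) ∨ Tendsto R atBot (𝓝 0)) :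
    IsCompleteIn M (sweep univ (nullPoint U V)) := by
  refine ⟨sweep_closed hM hall hprop, ?_⟩
  intro γ hT hX hω hS hint
  have hℓmono : StrictMono ℓ := strictMono_of_hasDerivAt_pos hℓ fun v => by
    have := (hall v).σ_pos
    positivity
  have hℓcont : Continuous ℓ := continuous_iff_continuousAt.2 fun v => (hℓ v).continuousAt
  set w : ℝ → ℝ := fun s => paramOfX U V (γ s).2.1 with hw
  have hwv : ∀ s ∈ Ioo (0 : ℝ) 1, (γ s).1 = (V (w s) - U (w s)) / 2 ∧
      (γ s).2.1 = (U (w s) + V (w s)) / 2 := by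
    intro s hs
    obtain ⟨v, -, hv⟩ := hS s hs
    simp only [nullPoint, Prod.mk.injEq] at hv
    have : w s = v := by simp only [hw, hv.2]; exact paramOfX_X hall v
    rw [this]
    exact hv
  have hmemnhds : ∀ s ∈ Ioo (0 : ℝ) 1, Ioo (0 : ℝ) 1 ∈ 𝓝 s := fun s hs => isOpen_Ioo.mem_nhds hs
  have hXd : ∀ s ∈ Ioo (0 : ℝ) 1,
      HasDerivAt (fun u => (γ u).2.1) (deriv (fun u => (γ u).2.1) s) s := fun s hs =>
    ((hX.contDiffAt (hmemnhds s hs)).differentiableAt (by simp)).hasDerivAt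
  have hωd : ∀ s ∈ Ioo (0 : ℝ) 1,
      HasDerivAt (fun u => ((γ u).2.2 : E3)) (deriv (fun u => ((γ u).2.2 : E3)) s) s :=
    fun s hs => ((hω.contDiffAt (hmemnhds s hs)).differentiableAt (by simp)).hasDerivAt
  have hXc : ContinuousOn (deriv fun u => (γ u).2.1) (Ioo 0 1) :=
    hX.continuousOn_deriv_of_isOpen isOpen_Ioo le_rfl
  have hωc : ContinuousOn (deriv fun u => ((γ u).2.2 : E3)) (Ioo 0 1) :=
    hω.continuousOn_deriv_of_isOpen isOpen_Ioo le_rfl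
  -- The signed rate of proper length along the profile, using dX = (p + q)/2 · dℓ.
  set D : ℝ → ℝ := fun s =>
    deriv (fun u => (γ u).2.1) s * (2 / (p (w s) + q (w s))) with hD
  have hwd : ∀ s ∈ Ioo (0 : ℝ) 1, HasDerivAt w (D s * σ (w s)) s := by
    intro s hs
    have h1 := hasDerivAt_paramOfX hall (w s)
    rw [← (hwv s hs).2] at h1
    refine (h1.comp s (hXd s hs)).congr_deriv ?_
    have a1 := (hall (w s)).p_pos
    have a2 := (hall (w s)).q_pos
    have a3 := (hall (w s)).σ_pos
    simp only [hD]
    field_simp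
  have hwc : ContinuousOn w (Ioo 0 1) := fun s hs => (hwd s hs).continuousAt.continuousWithinAt
  have hLd : ∀ s ∈ Ioo (0 : ℝ) 1, HasDerivAt (fun s => ℓ (w s)) (D s) s := by
    intro s hs
    refine ((hℓ (w s)).comp s (hwd s hs)).congr_deriv ?_
    have a3 := (hall (w s)).σ_pos
    field_simp
  have hDc : ContinuousOn D (Ioo 0 1) := by
    have hp : Continuous p := continuous_iff_continuousAt.2 fun v => (hall v).dp.continuousAt
    have hq : Continuous q := continuous_iff_continuousAt.2 fun v => (hall v).dq.continuousAt
    refine hXc.mul (continuousOn_const.div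
      ((hp.comp_continuousOn hwc).add (hq.comp_continuousOn hwc)) fun s _ => ?_)
    have a1 := (hall (w s)).p_pos
    have a2 := (hall (w s)).q_pos
    positivity
  have hkR : ∀ s ∈ Ioo (0 : ℝ) 1, kruskalR M (γ s).1 (γ s).2.1 = R (w s) := fun s hs => by
    rw [(hwv s hs).1, (hwv s hs).2]; exact (hall (w s)).kruskalR_eq hM
  have hspeed : ∀ s ∈ Ioo (0 : ℝ) 1, speed M γ s =
      √(D s ^ 2 + (R (w s) * ‖deriv (fun u => ((γ u).2.2 : E3)) s‖) ^ 2) := by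
    intro s hs
    have hTd : HasDerivAt (fun u => (γ u).1) ((q (w s) - p (w s)) / (2 * σ (w s)) *
        (D s * σ (w s))) s := by
      refine ((hall (w s)).hasDerivAt_T.comp s (hwd s hs)).congr_of_eventuallyEq ?_
      filter_upwards [hmemnhds s hs] with u hu
      exact (hwv u hu).1
    have hXd' : deriv (fun u => (γ u).2.1) s = (p (w s) + q (w s)) / 2 * D s := by
      have a1 := (hall (w s)).p_pos
      have a2 := (hall (w s)).q_pos
      simp only [hD]
      field_simp
    have hA := (hall (w s)).kruskalA_mul hM
    have a3 := (hall (w s)).σ_pos.ne'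
    rw [← (hwv s hs).1, ← (hwv s hs).2] at hA
    unfold speed
    rw [hTd.deriv, hXd', hkR s hs]
    congr 1
    have e : (q (w s) - p (w s)) / (2 * σ (w s)) * (D s * σ (w s)) =
      (q (w s) - p (w s)) / 2 * D s := by field_simp
    rw [e]
    linear_combination (D s) ^ 2 * hA
  -- The profile component |D| is at most the speed, so finite length forces ℓ to converge along the
  -- curve.
  obtain ⟨l, hl⟩ := exists_tendsto_of_norm_deriv_le zero_lt_one hLd hDc hint fun s hs => by
    rw [hspeed s hs, Real.norm_eq_abs]
    exact Real.abs_le_sqrt (le_add_of_nonneg_right (sq_nonneg _))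
  have hev : ∀ᶠ s in 𝓝[<] (1 : ℝ), s ∈ Ioo (0 : ℝ) 1 := Ioo_mem_nhdsLT zero_lt_one
  by_cases hex : ∃ v, ℓ v = l
  · left
    obtain ⟨v, rfl⟩ := hex
    have hwlim : Tendsto w (𝓝[<] 1) (𝓝 v) := by
      rw [tendsto_order]
      constructor
      · intro a ha
        filter_upwards [hl.eventually (lt_mem_nhds (hℓmono ha))] with s hs
        exact hℓmono.lt_iff_lt.1 hs
      · intro a ha
        filter_upwards [hl.eventually (gt_mem_nhds (hℓmono ha))] with s hs
        exact hℓmono.lt_iff_lt.1 hs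
    have hRv := (hall v).R_pos
    have hRlim : Tendsto (fun s => R (w s)) (𝓝[<] 1) (𝓝 (R v)) :=
      (hall v).dR.continuousAt.tendsto.comp hwlim
    -- With r bounded below, the speed also dominates the motion on the sphere, which therefore
    -- converges too.
    have hRge : ∀ᶠ s in 𝓝[<] (1 : ℝ), R v / 2 < R (w s) ∧ s ∈ Ioo (0 : ℝ) 1 :=
      (hRlim.eventually (lt_mem_nhds (half_lt_self hRv))).and hev
    obtain ⟨a, ha1, ha⟩ := (mem_nhdsLT_iff_exists_Ioo_subset).1 hRge
    have ha1' : a < 1 := ha1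
    obtain ⟨z, hz⟩ := exists_tendsto_of_norm_deriv_le (f := fun u => ((γ u).2.2 : E3))
      (g := fun s => speed M γ s * (2 / R v)) ha1'
      (fun s hs => hωd s (ha hs).2) (hωc.mono fun s hs => (ha hs).2)
      ((hint.mono_set fun s hs => (ha hs).2).mul_const _) (fun s hs => by
        have hb := (ha hs).1
        have h1 : R (w s) * ‖deriv (fun u => ((γ u).2.2 : E3)) s‖ ≤ speed M γ s := by
          rw [hspeed s (ha hs).2]
          exact Real.le_sqrt_of_sq_le (le_add_of_nonneg_left (sq_nonneg _))
        have h2 : R v / 2 * ‖deriv (fun u => ((γ u).2.2 : E3)) s‖ ≤ speed M γ s :=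
          (mul_le_mul_of_nonneg_right hb.le (norm_nonneg _)).trans h1
        calc _ = R v / 2 * ‖deriv (fun u => ((γ u).2.2 : E3)) s‖ * (2 / R v) := by field_simp
          _ ≤ _ := mul_le_mul_of_nonneg_right h2 (by positivity))
    have hzS : z ∈ Metric.sphere (0 : E3) 1 :=
      Metric.isClosed_sphere.mem_of_tendsto hz (Eventually.of_forall fun s => (γ s).2.2.2)
    refine ⟨sweepMap U V (v, ⟨z, hzS⟩), ?_, ?_⟩
    · exact ⟨v, mem_univ _, rfl⟩
    · have hTl : Tendsto (fun s => (γ s).1) (𝓝[<] 1) (𝓝 ((V v - U v) / 2)) :=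
        ((hall v).hasDerivAt_T.continuousAt.tendsto.comp hwlim).congr'
          (hev.mono fun s hs => (hwv s hs).1.symm)
      have hXl : Tendsto (fun s => (γ s).2.1) (𝓝[<] 1) (𝓝 ((U v + V v) / 2)) :=
        ((hall v).hasDerivAt_X.continuousAt.tendsto.comp hwlim).congr'
          (hev.mono fun s hs => (hwv s hs).2.symm)
      have hzl : Tendsto (fun s => (γ s).2.2) (𝓝[<] 1) (𝓝 (⟨z, hzS⟩ : S2)) :=
        tendsto_subtype_rng.2 hz
      exact hTl.prodMk_nhds (hXl.prodMk_nhds hzl)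
  · right
    -- The limit l is not a value of ℓ. As ℓ is continuous and unbounded above, all its values
    -- exceed l; this excludes the case where ℓ is unbounded below, and otherwise pushes the
    -- parameter to −∞, where r → 0.
    obtain ⟨v₀, hv₀⟩ := htop l
    have hall_gt : ∀ v, l < ℓ v := by
      intro v
      by_contra! h
      obtain ⟨v', hv'⟩ := mem_range_of_exists_le_of_exists_ge hℓcont ⟨v, h⟩ ⟨v₀, hv₀.le⟩
      exact hex ⟨v', hv'⟩
    rcases hbot with hbot | hbot
    · obtain ⟨v, hv⟩ := hbot l
      exact absurd hv (hall_gt v).not_gt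
    · have hwlim : Tendsto w (𝓝[<] 1) atBot := by
        rw [tendsto_atBot]
        intro b
        filter_upwards [hl.eventually (gt_mem_nhds (hall_gt b))] with s hs
        exact (hℓmono.lt_iff_lt.1 hs).le
      exact (hbot.comp hwlim).congr' (hev.mono fun s hs => (hkR s hs).symm)

end Profile

/-! ### The maximum of `kTilde`. -/

section Peak

variable {M H : ℝ}

theorem kTilde_radicand_pos {r : ℝ} (hr : r ∈ Ioo 0 (2 * M)) : 0 < r ^ 3 * (2 * M - r) :=
  mul_pos (pow_pos hr.1 3) (sub_pos.2 hr.2)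

theorem hasDerivAt_sqrt_radicand {r : ℝ} (hr : r ∈ Ioo 0 (2 * M)) :
    HasDerivAt (fun r => √(r ^ 3 * (2 * M - r)))
      (r ^ 2 * (3 * M - 2 * r) / √(r ^ 3 * (2 * M - r))) r := by
  have h0 := kTilde_radicand_pos hr
  have h1 : HasDerivAt (fun r : ℝ => r ^ 3 * (2 * M - r)) (2 * (r ^ 2 * (3 * M - 2 * r))) r := by
    refine ((hasDerivAt_pow 3 r).mul ((hasDerivAt_id r).const_sub (2 * M))).congr_deriv ?_
    simp only [id]
    push_cast
    ring
  refine (h1.sqrt h0.ne').congr_deriv ?_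
  have := (Real.sqrt_pos.2 h0).ne'
  field_simp

theorem hasDerivAt_kTilde {r : ℝ} (hr : r ∈ Ioo 0 (2 * M)) :
    HasDerivAt (kTilde M H)
      (r ^ 2 * ((3 * M - 2 * r) / √(r ^ 3 * (2 * M - r)) - 3 * H)) r := by
  refine (((hasDerivAt_pow 3 r).const_mul (-H)).add (hasDerivAt_sqrt_radicand hr)).congr_deriv ?_
  push_cast
  ring

theorem continuous_kTilde : Continuous (kTilde M H) := by
  unfold kTilde
  fun_prop

/-- The derivative of `kTilde` is r² times the difference of this function and 3H, so strict
monotonicity leaves a single critical point and fixes the sign on either side of it. -/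
theorem strictAntiOn_kTilde_slope :
    StrictAntiOn (fun r => (3 * M - 2 * r) / √(r ^ 3 * (2 * M - r))) (Ioo 0 (2 * M)) := by
  have hd : ∀ r ∈ Ioo 0 (2 * M), HasDerivAt (fun r => (3 * M - 2 * r) / √(r ^ 3 * (2 * M - r)))
      (-(2 * (r ^ 3 * (2 * M - r)) + (r * (3 * M - 2 * r)) ^ 2) /
        √(r ^ 3 * (2 * M - r)) ^ 3) r := by
    intro r hr
    have h0 := Real.sqrt_pos.2 (kTilde_radicand_pos hr)
    have h1 : HasDerivAt (fun r : ℝ => 3 * M - 2 * r) (-2) r := by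
      simpa using ((hasDerivAt_id r).const_mul 2).const_sub (3 * M)
    refine (h1.div (hasDerivAt_sqrt_radicand hr) h0.ne').congr_deriv ?_
    have h2 := Real.sq_sqrt (kTilde_radicand_pos hr).le
    generalize √(r ^ 3 * (2 * M - r)) = x at *
    rw [← h2]
    field_simp
    ring
  apply strictAntiOn_of_deriv_neg (convex_Ioo _ _)
  · exact fun r hr => (hd r hr).continuousAt.continuousWithinAt
  · intro r hr
    rw [interior_Ioo] at hr
    rw [(hd r hr).deriv]
    have h0 := kTilde_radicand_pos hr
    have h1 := Real.sqrt_pos.2 h0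
    exact div_neg_of_neg_of_pos (neg_neg_of_pos (by positivity)) (by positivity)

/-- The maximum point of `kTilde`. -/
theorem exists_peak (hM : 0 < M) (H : ℝ) : ∃ R ∈ Ioo 0 (2 * M),
    (3 * M - 2 * R) / √(R ^ 3 * (2 * M - R)) = 3 * H ∧
    StrictMonoOn (kTilde M H) (Icc 0 R) ∧ StrictAntiOn (kTilde M H) (Icc R (2 * M)) := by
  -- The critical equation cleared of its denominator is continuous up to the endpoints, with values
  -- 3M at 0 and −M at 2M.
  have hc : ContinuousOn (fun r => 3 * M - 2 * r - 3 * H * √(r ^ 3 * (2 * M - r)))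
      (Icc 0 (2 * M)) := by fun_prop
  obtain ⟨R, hR, hR0⟩ := intermediate_value_Icc' (by positivity) hc
    (show (0 : ℝ) ∈ Icc _ _ from ⟨by simp; linarith, by simp; linarith⟩)
  beta_reduce at hR0
  have hRmem : R ∈ Ioo 0 (2 * M) := by
    refine ⟨lt_of_le_of_ne hR.1 ?_, lt_of_le_of_ne hR.2 ?_⟩
    · rintro rfl
      simp at hR0
      exact hM.ne' hR0
    · rintro rfl
      simp at hR0
      linarith
  have hq := Real.sqrt_pos.2 (kTilde_radicand_pos hRmem)
  have hcrit : (3 * M - 2 * R) / √(R ^ 3 * (2 * M - R)) = 3 * H := by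
    rw [div_eq_iff hq.ne']
    linarith
  refine ⟨R, hRmem, hcrit, ?_, ?_⟩
  · apply strictMonoOn_of_deriv_pos (convex_Icc _ _) continuous_kTilde.continuousOn
    intro r hr
    rw [interior_Icc] at hr
    have hr' : r ∈ Ioo 0 (2 * M) := ⟨hr.1, hr.2.trans hRmem.2⟩
    rw [(hasDerivAt_kTilde hr').deriv, ← hcrit]
    have := strictAntiOn_kTilde_slope hr' hRmem hr.2
    beta_reduce at this
    exact mul_pos (pow_pos hr.1 2) (by linarith)
  · apply strictAntiOn_of_deriv_neg (convex_Icc _ _) continuous_kTilde.continuousOn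
    intro r hr
    rw [interior_Icc] at hr
    have hr' : r ∈ Ioo 0 (2 * M) := ⟨hRmem.1.trans hr.1, hr.2⟩
    rw [(hasDerivAt_kTilde hr').deriv, ← hcrit]
    have := strictAntiOn_kTilde_slope hRmem hr' hr.1
    beta_reduce at this
    exact mul_neg_of_pos_of_neg (pow_pos hr'.1 2) (by linarith)

theorem isPeak_of {R : ℝ} (hR : R ∈ Ioo 0 (2 * M))
    (hcrit : (3 * M - 2 * R) / √(R ^ 3 * (2 * M - R)) = 3 * H)
    (hmono : StrictMonoOn (kTilde M H) (Icc 0 R))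
    (hanti : StrictAntiOn (kTilde M H) (Icc R (2 * M))) : IsPeak M H R := by
  refine ⟨hR, ?_, ?_⟩
  · have hq := Real.sqrt_pos.2 (kTilde_radicand_pos hR)
    rw [div_eq_iff hq.ne'] at hcrit
    linarith
  · intro r hr hne
    rcases lt_or_gt_of_ne hne with h | h
    · exact hmono ⟨hr.1.le, h.le⟩ ⟨hR.1.le, le_rfl⟩ h
    · exact hanti ⟨le_rfl, hR.2.le⟩ ⟨h.le, hr.2.le⟩ h

theorem kTilde_two_mul : kTilde M H (2 * M) = -8 * M ^ 3 * H := by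
  simp [kTilde]
  ring

end Peak

/-! ### The first integral S² = h + w² and the slope dt/dr. -/

/-- `h + (H r + c / r²)²`, the square of the derivative of the area radius with respect to the
proper length along the profile curve. -/
noncomputable def slopeSq (M H c r : ℝ) : ℝ := hS M r + boostRate H c r ^ 2

section Slopes

variable {M H c r : ℝ}

/-- A difference of squares inside the horizon: it is positive once Hr³ + c exceeds r^{3/2}(2M −
r)^{1/2}, which is the condition that `kTilde` is less than c. -/
theorem pow_four_mul_slopeSq (hr : r ≠ 0) :
    r ^ 4 * slopeSq M H c r = (H * r ^ 3 + c) ^ 2 - r ^ 3 * (2 * M - r) := by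
  unfold slopeSq hS boostRate
  field_simp
  ring

theorem slopeSq_pos_of_kTilde_lt (hr : r ∈ Ioo 0 (2 * M)) (h : kTilde M H r < c) :
    0 < slopeSq M H c r ∧ 0 < boostRate H c r := by
  have hq := kTilde_radicand_pos hr
  have h1 : √(r ^ 3 * (2 * M - r)) < H * r ^ 3 + c := by
    unfold kTilde at h
    linarith
  have h2 := Real.sqrt_nonneg (r ^ 3 * (2 * M - r))
  have h3 : 0 < H * r ^ 3 + c := h2.trans_lt h1
  constructor
  · have h4 := pow_four_mul_slopeSq (M := M) (H := H) (c := c) hr.1.ne'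
    have h5 : r ^ 3 * (2 * M - r) < (H * r ^ 3 + c) ^ 2 := (Real.sqrt_lt hq.le h3.le).1 h1
    have h6 : 0 < r ^ 4 * slopeSq M H c r := by rw [h4]; linarith
    exact pos_of_mul_pos_right h6 (by have := hr.1; positivity)
  · have : boostRate H c r = (H * r ^ 3 + c) / r ^ 2 := by
      have := hr.1.ne'
      unfold boostRate
      field_simp
    rw [this]
    have := hr.1
    positivity

theorem hS_pos (hM : 0 < M) (hr : 2 * M < r) : 0 < hS M r := by
  have : 0 < r := by linarith
  unfold hS
  rw [sub_pos, div_lt_one this]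
  exact hr

theorem hS_neg (hr : r ∈ Ioo 0 (2 * M)) : hS M r < 0 := by
  unfold hS
  rw [sub_neg, one_lt_div hr.1]
  exact hr.2

theorem slopeSq_pos_of_lt (hM : 0 < M) (hr : 2 * M < r) : 0 < slopeSq M H c r :=
  add_pos_of_pos_of_nonneg (hS_pos hM hr) (sq_nonneg _)

theorem slopeSq_two_mul (hM : 0 < M) : slopeSq M H c (2 * M) = boostRate H c (2 * M) ^ 2 := by
  unfold slopeSq hS
  rw [div_self (by positivity)]
  ring

theorem boostRate_two_mul_pos (hM : 0 < M) (hc : -8 * M ^ 3 * H < c) :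
    0 < boostRate H c (2 * M) := by
  have : boostRate H c (2 * M) = (8 * M ^ 3 * H + c) / (2 * M) ^ 2 := by
    unfold boostRate
    field_simp
    ring
  rw [this]
  exact div_pos (by linarith) (by positivity)

/-- `dt / dr` along the profile curve. -/
noncomputable def timeSlope (M H c r : ℝ) : ℝ := boostRate H c r / (hS M r * √(slopeSq M H c r))

/-- Since 1 + l₁² = (h + w²)/h, and in region II' similarly l₄² − 1 = (h + w²)/(−h), all the
integrands of the explicit solutions are ± w/(h √(h + w²)). -/
theorem f1_integrand (hM : 0 < M) (hr : 2 * M < r) :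
    l1 M H c r / hS M r * √(1 / (1 + l1 M H c r ^ 2)) = timeSlope M H c r := by
  have h := hS_pos hM hr
  have hs := Real.sqrt_pos.2 h
  have h2 := Real.sq_sqrt h.le
  have hP : 0 < slopeSq M H c r := slopeSq_pos_of_lt hM hr
  have e1 : 1 / (1 + l1 M H c r ^ 2) = hS M r / slopeSq M H c r := by
    have : 1 + l1 M H c r ^ 2 = slopeSq M H c r / hS M r := by
      unfold l1 slopeSq boostRate
      rw [mul_pow, div_pow, h2]
      field_simp
    rw [this, one_div_div]
  have hP' := Real.sqrt_pos.2 hP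
  rw [e1, Real.sqrt_div h.le]
  have e2 : l1 M H c r = boostRate H c r / √(hS M r) := by
    unfold l1 boostRate; ring
  rw [e2]
  unfold timeSlope
  field_simp

theorem f3_integrand (hM : 0 < M) (hr : 2 * M < r) :
    l3 M H c r / hS M r * √(1 / (1 + l3 M H c r ^ 2)) = -timeSlope M H c r := by
  have e : l3 M H c r = -l1 M H c r := by unfold l1 l3; ring
  rw [e, ← f1_integrand hM hr]
  ring_nf

/-- The square root of l₄² forgets the sign of w; positivity of w restores it. -/
theorem f4slope_eq (hr : r ∈ Ioo 0 (2 * M)) (hP : 0 < slopeSq M H c r)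
    (hw : 0 < boostRate H c r) : f4slope M H c r = -timeSlope M H c r := by
  have h : 0 < -hS M r := neg_pos.2 (hS_neg hr)
  have h2 := Real.sq_sqrt h.le
  have hP' := Real.sqrt_pos.2 hP
  have e1 : l4 M H c r ^ 2 = boostRate H c r ^ 2 / (-hS M r) := by
    unfold l4
    rw [mul_pow, div_pow, h2]
    unfold boostRate
    ring
  have e2 : l4 M H c r ^ 2 / (l4 M H c r ^ 2 - 1) = boostRate H c r ^ 2 / slopeSq M H c r := by
    have hS' : hS M r ≠ 0 := (hS_neg hr).ne
    have key : boostRate H c r ^ 2 / (-hS M r) - 1 = slopeSq M H c r / (-hS M r) := by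
      unfold slopeSq
      field_simp
      ring
    rw [e1, key, div_div_div_cancel_right₀ h.ne']
  unfold f4slope timeSlope
  rw [e2, Real.sqrt_div (sq_nonneg _), Real.sqrt_sq hw.le]
  have hS' : hS M r ≠ 0 := (hS_neg hr).ne
  field_simp

theorem f4dec_integrand (hr : r ∈ Ioo 0 (2 * M)) (hP : 0 < slopeSq M H c r)
    (hw : 0 < boostRate H c r) :
    1 / hS M r * √(l4 M H c r ^ 2 / (l4 M H c r ^ 2 - 1)) = timeSlope M H c r := by
  have h := f4slope_eq hr hP hw
  unfold f4slope at h
  have hS' : hS M r ≠ 0 := (hS_neg hr).ne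
  rw [← neg_inj, ← h]
  field_simp

theorem hasDerivAt_slopeSq (hr : r ≠ 0) :
    HasDerivAt (slopeSq M H c)
      (2 * (M / r ^ 2 + boostRate H c r * (H - 2 * c / r ^ 3))) r := by
  have h1 : HasDerivAt (hS M) (2 * M / r ^ 2) r := by
    refine (((hasDerivAt_inv hr).const_mul (2 * M)).const_sub 1).congr_deriv ?_
    field_simp
  refine (h1.add ((hasDerivAt_boostRate H c hr).pow 2)).congr_deriv ?_
  push_cast
  ring

end Slopes

/-! ### Symmetries of profile curves, and Schwarzschild time along them. -/

namespace CMCAt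

variable {M H c : ℝ} {R S σ U V p q : ℝ → ℝ} {v : ℝ}

theorem congr {R' S' σ' U' V' p' q' : ℝ → ℝ} (h : CMCAt M H c R S σ U V p q v)
    (hR : R' =ᶠ[𝓝 v] R) (hS : S' =ᶠ[𝓝 v] S) (hσ : σ' =ᶠ[𝓝 v] σ) (hU : U' =ᶠ[𝓝 v] U)
    (hV : V' =ᶠ[𝓝 v] V) (hp : p' =ᶠ[𝓝 v] p) (hq : q' =ᶠ[𝓝 v] q) :
    CMCAt M H c R' S' σ' U' V' p' q' v := by
  have eR := hR.self_of_nhds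
  have eS := hS.self_of_nhds
  have eσ := hσ.self_of_nhds
  have eU := hU.self_of_nhds
  have eV := hV.self_of_nhds
  have ep := hp.self_of_nhds
  have eq := hq.self_of_nhds
  constructor
  · rw [eR]; exact h.R_pos
  · rw [eσ]; exact h.σ_pos
  · rw [ep]; exact h.p_pos
  · rw [eq]; exact h.q_pos
  · rw [eR, eU, eV]; exact h.mul
  · rw [eR, ep, eq]; exact h.unit
  · rw [eR, eU, eq, eS]; exact h.relU
  · rw [eR, eV, ep, eS]; exact h.relV
  · rw [eU, eV]; exact h.ne
  · rw [eS, eσ]; exact h.dR.congr_of_eventuallyEq hR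
  · rw [eR, eσ]; exact h.dS.congr_of_eventuallyEq hS
  · rw [ep, eσ]; exact h.dU.congr_of_eventuallyEq hU
  · rw [eq, eσ]; exact h.dV.congr_of_eventuallyEq hV
  · exact h.dp.congr_of_eventuallyEq hp
  · exact h.dq.congr_of_eventuallyEq hq
  · exact h.smoothU.congr_of_eventuallyEq hU
  · exact h.smoothV.congr_of_eventuallyEq hV

/-- The time translations `(U, V) ↦ (k U, V / k)`. -/
theorem boost (h : CMCAt M H c R S σ U V p q v) {k : ℝ} (hk : 0 < k) :
    CMCAt M H c R S σ (fun v => k * U v) (fun v => k⁻¹ * V v) (fun v => k * p v)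
      (fun v => k⁻¹ * q v) v := by
  have hk' := hk.ne'
  have e : ∀ a b : ℝ, k * a * (k⁻¹ * b) = a * b := fun a b => by field_simp
  have e' : ∀ a b : ℝ, k⁻¹ * a * (k * b) = a * b := fun a b => by field_simp
  constructor
  · exact h.R_pos
  · exact h.σ_pos
  · exact mul_pos hk h.p_pos
  · exact mul_pos (inv_pos.2 hk) h.q_pos
  · rw [e]; exact h.mul
  · rw [e]; exact h.unit
  · rw [e]; exact h.relU
  · rw [e']; exact h.relV
  · exact h.ne.imp (mul_ne_zero hk') (mul_ne_zero (inv_ne_zero hk'))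
  · exact h.dR
  · exact h.dS
  · exact (h.dU.const_mul k).congr_deriv (by ring)
  · exact (h.dV.const_mul k⁻¹).congr_deriv (by ring)
  · exact h.dp.const_mul k
  · exact h.dq.const_mul k⁻¹
  · exact contDiffAt_const.mul h.smoothU
  · exact contDiffAt_const.mul h.smoothV

/-- The reflection `X ↦ -X`. -/
theorem mirror (h : CMCAt M H c R S σ U V p q (-v)) :
    CMCAt M H c (fun v => R (-v)) (fun v => -S (-v)) (fun v => σ (-v)) (fun v => -V (-v))
      (fun v => -U (-v)) (fun v => q (-v)) (fun v => p (-v)) v := by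
  have hneg : HasDerivAt (fun v : ℝ => -v) (-1) v := hasDerivAt_neg v
  have sneg : ContDiffAt ℝ ∞ (fun v : ℝ => -v) v := contDiff_neg.contDiffAt
  constructor
  · exact h.R_pos
  · exact h.σ_pos
  · exact h.q_pos
  · exact h.p_pos
  · linear_combination h.mul
  · linear_combination h.unit
  · linear_combination -h.relV
  · linear_combination -h.relU
  · exact h.ne.symm.imp neg_ne_zero.2 neg_ne_zero.2
  · exact (h.dR.comp v hneg).congr_deriv (by ring)
  · exact (h.dS.comp v hneg).neg.congr_deriv (by ring)
  · exact (h.dV.comp v hneg).neg.congr_deriv (by ring)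
  · exact (h.dU.comp v hneg).neg.congr_deriv (by ring)
  · exact h.dq.comp v hneg.differentiableAt
  · exact h.dp.comp v hneg.differentiableAt
  · exact (h.smoothV.comp v sneg).neg
  · exact (h.smoothU.comp v sneg).neg

/-- It turns dU/ds = p into a linear equation for U that involves only r and S. Uniqueness and the
construction of the curve both rest on it. -/
theorem U_eq (h : CMCAt M H c R S σ U V p q v) :
    U v = 4 * M * (S v + boostRate H c (R v)) * p v := by
  apply mul_left_cancel₀ h.R_pos.ne'
  linear_combination (-U v) * h.unit + 4 * M * p v * h.relU

/-- Schwarzschild time along the profile curve. -/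
theorem hasDerivAt_time (hM : 0 < M) (h : CMCAt M H c R S σ U V p q v) (hU : U v ≠ 0)
    (hV : V v ≠ 0) :
    HasDerivAt (fun v => 2 * M * (Real.log (V v) - Real.log (U v)))
      (boostRate H c (R v) / (hS M (R v) * σ v)) v := by
  refine (((h.dV.log hV).sub (h.dU.log hU)).const_mul (2 * M)).congr_deriv ?_
  have hR := h.R_pos.ne'
  have hσ := h.σ_pos.ne'
  have hE := (Real.exp_pos (-R v / (2 * M))).ne'
  have hmul := h.mul_exp_neg
  have hne : R v - 2 * M ≠ 0 := by
    rw [← hmul]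
    exact mul_ne_zero (mul_ne_zero hU hV) hE
  have e1 : hS M (R v) = (R v - 2 * M) / R v := by
    unfold hS; field_simp
  have e2 : q v * U v - p v * V v =
      boostRate H c (R v) * R v / (2 * M * Real.exp (-R v / (2 * M))) := by
    rw [eq_div_iff (by positivity)]
    linear_combination (1 / 2) * h.relU - (1 / 2) * h.relV
  have e3 : 2 * M * (q v / σ v / V v - p v / σ v / U v) =
      2 * M * (q v * U v - p v * V v) / (σ v * (U v * V v)) := by
    field_simp
  rw [e3, e2, e1]
  generalize Real.exp (-R v / (2 * M)) = E at *
  rw [← hmul]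
  field_simp

end CMCAt

/-! ### Construction of the curve where S + w > 0, across the horizon V = 0. -/

section HalfCurve

/-- The logarithmic derivative of `U` along the profile curve. -/
noncomputable def logRate (M H c : ℝ) (R S σ : ℝ → ℝ) (v : ℝ) : ℝ :=
  1 / (4 * M * σ v * (S v + boostRate H c (R v)))

/-- The solution `U` with `U v₀ = k`. -/
noncomputable def halfU (M H c : ℝ) (R S σ : ℝ → ℝ) (v₀ k v : ℝ) : ℝ :=
  k * Real.exp (∫ x in v₀..v, logRate M H c R S σ x)

noncomputable def halfV (M H c : ℝ) (R S σ : ℝ → ℝ) (v₀ k v : ℝ) : ℝ :=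
  (R v - 2 * M) * Real.exp (R v / (2 * M)) / halfU M H c R S σ v₀ k v

noncomputable def halfP (M H c : ℝ) (R S σ : ℝ → ℝ) (v₀ k v : ℝ) : ℝ :=
  halfU M H c R S σ v₀ k v / (4 * M * (S v + boostRate H c (R v)))

noncomputable def halfQ (M H c : ℝ) (R S σ : ℝ → ℝ) (v₀ k v : ℝ) : ℝ :=
  (S v + boostRate H c (R v)) * (R v * Real.exp (R v / (2 * M))) /
    (4 * M * halfU M H c R S σ v₀ k v)

variable {M H c : ℝ} {R S σ : ℝ → ℝ} {v₀ k : ℝ}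

theorem halfU_pos (hk : 0 < k) (v : ℝ) : 0 < halfU M H c R S σ v₀ k v :=
  mul_pos hk (Real.exp_pos _)

theorem halfU_self : halfU M H c R S σ v₀ k v₀ = k := by simp [halfU]

theorem contDiffAt_logRate (hM : 0 < M) {v : ℝ} (sR : ContDiffAt ℝ ∞ R v)
    (sS : ContDiffAt ℝ ∞ S v) (sσ : ContDiffAt ℝ ∞ σ v) (hR : 0 < R v) (hσ : 0 < σ v)
    (hpos : 0 < S v + boostRate H c (R v)) : ContDiffAt ℝ ∞ (logRate M H c R S σ) v := by
  have sw : ContDiffAt ℝ ∞ (fun v => boostRate H c (R v)) v :=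
    (contDiffAt_const.mul sR).add (contDiffAt_const.div (sR.pow 2) (pow_ne_zero 2 hR.ne'))
  exact contDiffAt_const.div ((contDiffAt_const.mul sσ).mul (sS.add sw)) (by positivity)

/-- U is obtained by integrating its logarithmic derivative, V from the product UV, p from U = 4M(S
+ w)p and q from unit speed. Nothing degenerates at r = 2M, because r − 2M = r(S − w)(S + w)
vanishes there only through S − w. -/
theorem cmcAt_half (hM : 0 < M) (hk : 0 < k) {I : Set ℝ} (hI : IsOpen I) (hIc : I.OrdConnected)
    (hv₀ : v₀ ∈ I) (sR : ∀ v ∈ I, ContDiffAt ℝ ∞ R v) (sS : ∀ v ∈ I, ContDiffAt ℝ ∞ S v)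
    (sσ : ∀ v ∈ I, ContDiffAt ℝ ∞ σ v) (hR : ∀ v ∈ I, 0 < R v) (hσ : ∀ v ∈ I, 0 < σ v)
    (hpos : ∀ v ∈ I, 0 < S v + boostRate H c (R v))
    (hsq : ∀ v ∈ I, S v ^ 2 = slopeSq M H c (R v)) (dR : ∀ v ∈ I, HasDerivAt R (S v / σ v) v)
    (dS : ∀ v ∈ I, HasDerivAt S
      ((M / R v ^ 2 + boostRate H c (R v) * (H - 2 * c / R v ^ 3)) / σ v) v) :
    ∀ v ∈ I, CMCAt M H c R S σ (halfU M H c R S σ v₀ k) (halfV M H c R S σ v₀ k)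
      (halfP M H c R S σ v₀ k) (halfQ M H c R S σ v₀ k) v := by
  have srate : ∀ v ∈ I, ContDiffAt ℝ ∞ (logRate M H c R S σ) v := fun v hv =>
    contDiffAt_logRate hM (sR v hv) (sS v hv) (sσ v hv) (hR v hv) (hσ v hv) (hpos v hv)
  have dG : ∀ v ∈ I, HasDerivAt (fun v => ∫ x in v₀..v, logRate M H c R S σ x)
      (logRate M H c R S σ v) v := by
    intro v hv
    have hc : ContinuousOn (logRate M H c R S σ) I := fun x hx =>
      (srate x hx).continuousAt.continuousWithinAt
    exact intervalIntegral.integral_hasDerivAt_right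
      (hc.mono (hIc.uIcc_subset hv₀ hv)).intervalIntegrable
      (hc.stronglyMeasurableAtFilter hI v hv) (srate v hv).continuousAt
  have sG : ∀ v ∈ I, ContDiffAt ℝ ∞ (fun v => ∫ x in v₀..v, logRate M H c R S σ x) v := by
    have : ContDiffOn ℝ ∞ (fun v => ∫ x in v₀..v, logRate M H c R S σ x) I := by
      rw [contDiffOn_infty_iff_deriv_of_isOpen hI]
      refine ⟨fun v hv => (dG v hv).differentiableAt.differentiableWithinAt, ?_⟩
      exact ContDiffOn.congr (fun v hv => (srate v hv).contDiffWithinAt) fun v hv => (dG v hv).deriv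
    exact fun v hv => this.contDiffAt (hI.mem_nhds hv)
  intro v hv
  have hUpos := halfU_pos (M := M) (H := H) (c := c) (R := R) (S := S) (σ := σ) (v₀ := v₀) hk v
  have sU : ContDiffAt ℝ ∞ (halfU M H c R S σ v₀ k) v :=
    contDiffAt_const.mul (sG v hv).exp
  have dU : HasDerivAt (halfU M H c R S σ v₀ k)
      (halfU M H c R S σ v₀ k v * logRate M H c R S σ v) v := by
    refine ((dG v hv).exp.const_mul k).congr_deriv ?_
    unfold halfU
    ring
  have hRv := hR v hv
  have hσv := hσ v hv
  have hposv := hpos v hv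
  have sw : ContDiffAt ℝ ∞ (fun v => boostRate H c (R v)) v :=
    (contDiffAt_const.mul (sR v hv)).add
      (contDiffAt_const.div ((sR v hv).pow 2) (pow_ne_zero 2 hRv.ne'))
  have sE : ContDiffAt ℝ ∞ (fun v => Real.exp (R v / (2 * M))) v := ((sR v hv).div_const _).exp
  have sV : ContDiffAt ℝ ∞ (halfV M H c R S σ v₀ k) v :=
    (((sR v hv).sub contDiffAt_const).mul sE).div sU hUpos.ne'
  have sP : ContDiffAt ℝ ∞ (halfP M H c R S σ v₀ k) v :=
    sU.div (contDiffAt_const.mul ((sS v hv).add sw)) (by positivity)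
  have sQ : ContDiffAt ℝ ∞ (halfQ M H c R S σ v₀ k) v :=
    (((sS v hv).add sw).mul ((sR v hv).mul sE)).div (contDiffAt_const.mul sU) (by positivity)
  have hR2 : R v - 2 * M = R v * ((S v - boostRate H c (R v)) * (S v + boostRate H c (R v))) := by
    have h1 := hsq v hv
    have h2 : R v * slopeSq M H c (R v) = R v - 2 * M + R v * boostRate H c (R v) ^ 2 := by
      unfold slopeSq hS
      field_simp
    rw [← h1] at h2
    linear_combination -h2
  have hexp : Real.exp (-R v / (2 * M)) = (Real.exp (R v / (2 * M)))⁻¹ := by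
    rw [neg_div, Real.exp_neg]
  have hEpos := Real.exp_pos (R v / (2 * M))
  constructor
  · exact hRv
  · exact hσv
  · unfold halfP; positivity
  · unfold halfQ; positivity
  · unfold halfV; field_simp
  · unfold halfP halfQ; rw [hexp]; field_simp; ring
  · unfold halfQ; rw [hexp]; field_simp
  · unfold halfP halfV; rw [hexp, hR2]; field_simp
  · exact Or.inl hUpos.ne'
  · exact dR v hv
  · exact dS v hv
  · refine dU.congr_deriv ?_
    unfold halfP logRate
    field_simp
  · have d1 : HasDerivAt (halfV M H c R S σ v₀ k) _ v :=
      (((dR v hv).sub_const (2 * M)).mul ((dR v hv).div_const (2 * M)).exp).div dU hUpos.ne'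
    refine d1.congr_deriv ?_
    simp only [Pi.mul_apply]
    unfold halfQ logRate
    generalize halfU M H c R S σ v₀ k v = u at *
    generalize Real.exp (R v / (2 * M)) = E at *
    field_simp
    linear_combination (-2) * hR2
  · exact sP.differentiableAt (by simp)
  · exact sQ.differentiableAt (by simp)
  · exact sU
  · exact sV

end HalfCurve

/-! ### Uniqueness, and extension by reflection at a turning point. -/

section Glue

variable {M H c : ℝ} {R S σ : ℝ → ℝ}

/-- Two profile curves with the same area radius that agree at `0` agree. -/
theorem cmcAt_unique (hM : 0 < M) {b : ℝ} {U V p q U' V' p' q' : ℝ → ℝ}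
    (h : ∀ v ∈ Ioo (-b) b, CMCAt M H c R S σ U V p q v)
    (h' : ∀ v ∈ Ioo (-b) b, CMCAt M H c R S σ U' V' p' q' v)
    (hU : ∀ v ∈ Ioo (-b) b, 0 < U v) (h0 : U 0 = U' 0) :
    ∀ v ∈ Ioo (-b) b, U' v = U v ∧ V' v = V v ∧ p' v = p v ∧ q' v = q v := by
  have hratio : ∀ v ∈ Ioo (-b) b, U' v = U v := by
    intro v hv
    have hb : 0 < b := by have := hv.1.trans hv.2; linarith
    -- Both curves have the same r and S, so U and U' have the same logarithmic derivative and their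
    -- ratio is constant.
    have hd : ∀ x ∈ Ioo (-b) b, HasDerivAt (fun x => U' x / U x) 0 x := by
      intro x hx
      refine ((h' x hx).dU.div (h x hx).dU (hU x hx).ne').congr_deriv ?_
      rw [div_eq_zero_iff]
      left
      have e1 := (h x hx).U_eq
      have e2 := (h' x hx).U_eq
      rw [e1, e2]
      ring
    have := (convex_Ioo (-b) b).is_const_of_fderivWithin_eq_zero (𝕜 := ℝ)
      (f := fun x => U' x / U x)
      (fun x hx => (hd x hx).differentiableAt.differentiableWithinAt) (fun x hx => by
        rw [fderivWithin_of_isOpen isOpen_Ioo hx]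
        ext
        simp [(hd x hx).deriv]) hv (show (0 : ℝ) ∈ Ioo (-b) b from ⟨by linarith, hb⟩)
    beta_reduce at this
    have h00 := (hU 0 ⟨by linarith, hb⟩).ne'
    rw [← h0, div_self h00, div_eq_one_iff_eq (hU v hv).ne'] at this
    exact this
  intro v hv
  have hUv := (hU v hv).ne'
  have e := hratio v hv
  have e1 := (h v hv).U_eq
  have e2 := (h' v hv).U_eq
  have hp : p' v = p v := by
    rw [e, e1] at e2
    have hne : 4 * M * (S v + boostRate H c (R v)) ≠ 0 := by
      intro h00
      rw [h00, zero_mul] at e1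
      exact hUv e1
    exact (mul_left_cancel₀ hne e2).symm
  refine ⟨e, ?_, hp, ?_⟩
  · have m1 := (h v hv).mul
    have m2 := (h' v hv).mul
    rw [← m1, e] at m2
    exact mul_left_cancel₀ hUv m2
  · have m1 := (h v hv).unit
    have m2 := (h' v hv).unit
    rw [hp] at m2
    have m2 := m2.trans m1.symm
    have hE : 16 * M ^ 2 * Real.exp (-R v / (2 * M)) ≠ 0 := by positivity
    exact mul_left_cancel₀ (h v hv).p_pos.ne' (mul_left_cancel₀ hE m2)

/-- `f` to the right of `0` and `g` to the left. -/
noncomputable def glue (f g : ℝ → ℝ) (v : ℝ) : ℝ := if 0 ≤ v then f v else g v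

theorem glue_eq_left {f g : ℝ → ℝ} {b : ℝ} (h : ∀ v ∈ Ioo (-b) b, g v = f v) {v : ℝ}
    (hv : -b < v) : glue f g v = f v := by
  unfold glue
  split_ifs with h0
  · rfl
  · exact h v ⟨hv, by linarith⟩

theorem glue_eq_right {f g : ℝ → ℝ} {b : ℝ} (h : ∀ v ∈ Ioo (-b) b, g v = f v) {v : ℝ}
    (hv : v < b) : glue f g v = g v := by
  unfold glue
  split_ifs with h0
  · exact (h v ⟨by linarith, hv⟩).symm
  · rfl

/-- A profile curve on `(-b, ∞)` that is normalized at its turning point `0` extends to `ℝ` by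
reflection. -/
theorem exists_reflected_extension (hM : 0 < M) {b : ℝ} (hb : 0 < b) {U V p q : ℝ → ℝ}
    (h : ∀ v ∈ Ioi (-b), CMCAt M H c R S σ U V p q v) (hRe : ∀ v, R (-v) = R v)
    (hSo : ∀ v, S (-v) = -S v) (hσe : ∀ v, σ (-v) = σ v) (hUpos : ∀ v ∈ Ioi (-b), 0 < U v)
    (h0 : U 0 = -V 0) :
    ∃ U' V' p' q' : ℝ → ℝ, (∀ v, CMCAt M H c R S σ U' V' p' q' v) ∧
      (∀ v, -b < v → U' v = U v ∧ V' v = V v) ∧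
      (∀ v, v < b → U' v = -V (-v) ∧ V' v = -U (-v)) := by
  have hm : ∀ v ∈ Iio b, CMCAt M H c R S σ (fun v => -V (-v)) (fun v => -U (-v))
      (fun v => q (-v)) (fun v => p (-v)) v := by
    intro v hv
    have := (h (-v) (mem_Ioi.2 (neg_lt_neg hv))).mirror
    simp only [hRe, hSo, hσe, neg_neg] at this
    exact this
  -- By the parities of R, S and σ the mirror image solves the same system on (−∞, b). Its null
  -- coordinate at 0 is −V(0), so the normalization `h0` makes the two curves agree on the overlap.
  have huniq := cmcAt_unique hM (fun v hv => h v hv.1) (fun v hv => hm v hv.2)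
    (fun v hv => hUpos v hv.1)
    (by simpa using h0)
  have gl : ∀ {f g : ℝ → ℝ}, (∀ v ∈ Ioo (-b) b, g v = f v) → ∀ v ∈ Ioi (-b),
      glue f g =ᶠ[𝓝 v] f := fun hfg v hv =>
    (isOpen_Ioi.eventually_mem hv).mono fun x hx => glue_eq_left hfg hx
  have gr : ∀ {f g : ℝ → ℝ}, (∀ v ∈ Ioo (-b) b, g v = f v) → ∀ v ∈ Iio b,
      glue f g =ᶠ[𝓝 v] g := fun hfg v hv =>
    (isOpen_Iio.eventually_mem hv).mono fun x hx => glue_eq_right hfg hx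
  have u1 := fun v hv => (huniq v hv).1
  have u2 := fun v hv => (huniq v hv).2.1
  have u3 := fun v hv => (huniq v hv).2.2.1
  have u4 := fun v hv => (huniq v hv).2.2.2
  refine ⟨glue U fun v => -V (-v), glue V fun v => -U (-v), glue p fun v => q (-v),
    glue q fun v => p (-v), ?_, ?_, ?_⟩
  · intro v
    rcases lt_or_ge (-b) v with hv | hv
    · exact (h v hv).congr .rfl .rfl .rfl (gl u1 v hv) (gl u2 v hv) (gl u3 v hv) (gl u4 v hv)
    · have hv' : v ∈ Iio b := lt_of_le_of_lt hv (by linarith)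
      exact (hm v hv').congr .rfl .rfl .rfl (gr u1 v hv') (gr u2 v hv') (gr u3 v hv') (gr u4 v hv')
  · exact fun v hv => ⟨glue_eq_left u1 hv, glue_eq_left u2 hv⟩
  · exact fun v hv => ⟨glue_eq_right u1 hv, glue_eq_right u2 hv⟩

end Glue

/-! ### Null coordinates in the regions I, I' and II'. -/

section Regions

variable {M r u v : ℝ}

/-- Two positive numbers are determined by their product and their quotient, and here x/y = e^{t/2M}
with t = 2M(log x − log y). -/
theorem null_coordinates_of_time (hM : 0 < M) {x y : ℝ} (hx : 0 < x) (hy : 0 < y)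
    (h : y * x = |r - 2 * M| * Real.exp (r / (2 * M))) :
    √|r - 2 * M| * Real.exp ((r + 2 * M * (Real.log x - Real.log y)) / (4 * M)) = x ∧
    √|r - 2 * M| * Real.exp ((r - 2 * M * (Real.log x - Real.log y)) / (4 * M)) = y := by
  have hx2 : Real.exp (Real.log x) = x := Real.exp_log hx
  have hy2 : Real.exp (Real.log y) = y := Real.exp_log hy
  have key : ∀ t : ℝ, √|r - 2 * M| * Real.exp ((r + t) / (4 * M)) =
      √(|r - 2 * M| * Real.exp (r / (2 * M)) * Real.exp (t / (2 * M))) := by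
    intro t
    rw [mul_assoc, Real.sqrt_mul (abs_nonneg _), ← Real.exp_add, Real.sqrt_eq_rpow (Real.exp _),
      ← Real.exp_mul]
    congr 2
    field_simp
    ring
  constructor
  · rw [key, ← h]
    have : 2 * M * (Real.log x - Real.log y) / (2 * M) = Real.log x - Real.log y := by field_simp
    rw [this, Real.exp_sub, hx2, hy2, show y * x * (x / y) = x ^ 2 by field_simp,
      Real.sqrt_sq hx.le]
  · rw [sub_eq_add_neg r (2 * M * _), key, ← h]
    have : -(2 * M * (Real.log x - Real.log y)) / (2 * M) = Real.log y - Real.log x := by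
      field_simp
      ring
    rw [this, Real.exp_sub, hx2, hy2, show y * x * (y / x) = y ^ 2 by field_simp,
      Real.sqrt_sq hy.le]

/-- Because `Real.log` is the logarithm of the absolute value, one formula for t serves all three
regions. -/
theorem regionI_eq (hM : 0 < M) (hr : 2 * M < r) (hu : 0 < u) (hv : 0 < v)
    (h : u * v = (r - 2 * M) * Real.exp (r / (2 * M))) :
    regionI M (2 * M * (Real.log v - Real.log u)) r = ((v - u) / 2, (u + v) / 2) := by
  have ha : |r - 2 * M| = r - 2 * M := abs_of_pos (by linarith)
  obtain ⟨h1, h2⟩ := null_coordinates_of_time hM hv hu (r := r) (by rw [ha]; exact h)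
  rw [ha] at h1 h2
  unfold regionI
  rw [mul_sub (√(r - 2 * M)), mul_add (√(r - 2 * M)), h1, h2, add_comm v u]

theorem regionI'_eq (hM : 0 < M) (hr : 2 * M < r) (hu : u < 0) (hv : v < 0)
    (h : u * v = (r - 2 * M) * Real.exp (r / (2 * M))) :
    regionI' M (2 * M * (Real.log v - Real.log u)) r = ((v - u) / 2, (u + v) / 2) := by
  have ha : |r - 2 * M| = r - 2 * M := abs_of_pos (by linarith)
  obtain ⟨h1, h2⟩ := null_coordinates_of_time hM (neg_pos.2 hv) (neg_pos.2 hu) (r := r)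
    (by rw [ha, neg_mul_neg]; exact h)
  rw [ha, Real.log_neg_eq_log, Real.log_neg_eq_log] at h1 h2
  unfold regionI'
  rw [mul_sub (√(r - 2 * M)), mul_add (√(r - 2 * M)), h1, h2]
  ext <;> ring

theorem regionII'_eq (hM : 0 < M) (hr : r < 2 * M) (hu : 0 < u) (hv : v < 0)
    (h : u * v = (r - 2 * M) * Real.exp (r / (2 * M))) :
    regionII' M (2 * M * (Real.log v - Real.log u)) r = ((v - u) / 2, (u + v) / 2) := by
  have ha : |r - 2 * M| = 2 * M - r := by rw [abs_of_neg (by linarith)]; ring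
  obtain ⟨h1, h2⟩ := null_coordinates_of_time hM (neg_pos.2 hv) hu (r := r)
    (by rw [ha]; linear_combination -h)
  rw [ha, Real.log_neg_eq_log] at h1 h2
  unfold regionII'
  rw [mul_sub (√(2 * M - r)), mul_add (√(2 * M - r)), h1, h2]
  ext <;> ring

end Regions

/-- Exchanges the parametrization of a piece by r for the one by the curve parameter; ρ and R are
inverse to each other. -/
theorem sweep_eq_of_inverse {J K : Set ℝ} {δ γ : ℝ → ℝ × ℝ} {ρ R : ℝ → ℝ}
    (h1 : ∀ r ∈ J, ρ r ∈ K ∧ γ (ρ r) = δ r) (h2 : ∀ v ∈ K, R v ∈ J ∧ ρ (R v) = v) :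
    sweep J δ = sweep K γ := by
  ext y
  constructor
  · rintro ⟨r, hr, hy⟩
    exact ⟨ρ r, (h1 r hr).1, hy.trans (h1 r hr).2.symm⟩
  · rintro ⟨v, hv, hy⟩
    refine ⟨R v, (h2 v hv).1, hy.trans ?_⟩
    rw [← (h1 _ (h2 v hv).1).2, (h2 v hv).2]

theorem sweep_union (J K : Set ℝ) (γ : ℝ → ℝ × ℝ) : sweep J γ ∪ sweep K γ = sweep (J ∪ K) γ := by
  ext y
  constructor
  · rintro (⟨v, hv, hy⟩ | ⟨v, hv, hy⟩)
    · exact ⟨v, Or.inl hv, hy⟩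
    · exact ⟨v, Or.inr hv, hy⟩
  · rintro ⟨v, hv | hv, hy⟩
    · exact Or.inl ⟨v, hv, hy⟩
    · exact Or.inr ⟨v, hv, hy⟩

theorem sphereOver_eq_sweep {T X v : ℝ} {γ : ℝ → ℝ × ℝ} (h : γ v = (T, X)) :
    sphereOver T X = sweep {v} γ := by
  ext ⟨T', X', z⟩
  constructor
  · rintro ⟨rfl, rfl⟩
    exact ⟨v, rfl, h.symm⟩
  · rintro ⟨_, rfl, hy⟩
    rw [h] at hy
    simpa [sphereOver] using hy

/-- The fundamental theorem of calculus for an integrand of constant sign. -/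
theorem intervalIntegral_eq_sub_of_deriv_nonneg {θ θ' : ℝ → ℝ} {a b : ℝ}
    (hc : ContinuousOn θ (uIcc a b)) (hd : ∀ x ∈ Ioo (min a b) (max a b), HasDerivAt θ (θ' x) x)
    (hpos : ∀ x ∈ Ioo (min a b) (max a b), 0 ≤ θ' x) :
    IntervalIntegrable θ' volume a b ∧ ∫ x in a..b, θ' x = θ b - θ a := by
  have key : ∀ {a b : ℝ}, a ≤ b → ContinuousOn θ (Icc a b) →
      (∀ x ∈ Ioo a b, HasDerivAt θ (θ' x) x) → (∀ x ∈ Ioo a b, 0 ≤ θ' x) →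
      IntervalIntegrable θ' volume a b ∧ ∫ x in a..b, θ' x = θ b - θ a := by
    intro a b hab hc hd hpos
    have hi : IntervalIntegrable θ' volume a b :=
      (intervalIntegrable_iff_integrableOn_Ioc_of_le hab).2
        (intervalIntegral.integrableOn_deriv_of_nonneg hc hd hpos)
    exact ⟨hi, intervalIntegral.integral_eq_sub_of_hasDerivAt_of_le hab hc hd hi⟩
  rcases le_total a b with hab | hab
  · rw [uIcc_of_le hab] at hc
    rw [min_eq_left hab, max_eq_right hab] at hd hpos
    exact key hab hc hd hpos
  · rw [uIcc_of_ge hab] at hc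
    rw [min_eq_right hab, max_eq_left hab] at hd hpos
    obtain ⟨h1, h2⟩ := key hab hc hd hpos
    refine ⟨h1.symm, ?_⟩
    rw [intervalIntegral.integral_symm, h2]
    ring

/-! ### The explicit graphs as pieces of one profile curve. -/

section Branch

variable {M H c : ℝ} {R S σ U V p q : ℝ → ℝ}

/-- Schwarzschild time. -/
noncomputable def nullTime (M : ℝ) (U V : ℝ → ℝ) (v : ℝ) : ℝ :=
  2 * M * (Real.log (V v) - Real.log (U v))

theorem hasDerivAt_nullTime_comp (hM : 0 < M) (hall : ∀ v, CMCAt M H c R S σ U V p q v)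
    {ρ : ℝ → ℝ} {r : ℝ} (hr : R (ρ r) = r) (hρ : HasDerivAt ρ (σ (ρ r) / S (ρ r)) r)
    (hU : U (ρ r) ≠ 0) (hV : V (ρ r) ≠ 0) :
    HasDerivAt (fun r => nullTime M U V (ρ r)) (boostRate H c r / (hS M r * S (ρ r))) r := by
  have h1 := ((hall (ρ r)).hasDerivAt_time hM hU hV).comp r hρ
  refine h1.congr_deriv ?_
  rw [hr]
  have := (hall (ρ r)).σ_pos.ne'
  field_simp

theorem CMCAt.V_pos {v : ℝ} (h : CMCAt M H c R S σ U V p q v) (hr : 2 * M < R v) (hU : 0 < U v) :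
    0 < V v := by
  have h1 : 0 < U v * V v := by
    rw [h.mul]; exact mul_pos (by linarith) (Real.exp_pos _)
  exact pos_of_mul_pos_right h1 hU.le

theorem CMCAt.V_neg {v : ℝ} (h : CMCAt M H c R S σ U V p q v) (hr : R v < 2 * M) (hU : 0 < U v) :
    V v < 0 := by
  have h1 : U v * V v < 0 := by
    rw [h.mul]; exact mul_neg_of_neg_of_pos (by linarith) (Real.exp_pos _)
  exact neg_of_mul_neg_right h1 hU.le

theorem CMCAt.V_neg' {v : ℝ} (h : CMCAt M H c R S σ U V p q v) (hr : 2 * M < R v) (hU : U v < 0) :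
    V v < 0 := by
  have h1 : 0 < U v * V v := by
    rw [h.mul]; exact mul_pos (by linarith) (Real.exp_pos _)
  by_contra! h0
  exact (mul_nonpos_of_nonpos_of_nonneg hU.le h0).not_gt h1

/-- With ρ the inverse of r along the piece K, both time along the curve and f₁ have derivative
`timeSlope` in r, and their constants are matched at r₁. -/
theorem Sigma1_eq_sweep (hM : 0 < M) (hall : ∀ v, CMCAt M H c R S σ U V p q v) {ρ : ℝ → ℝ}
    {K : Set ℝ} {r₁ cbar : ℝ} (hr₁ : 2 * M < r₁)
    (hρ : ∀ r, 2 * M < r → ρ r ∈ K ∧ R (ρ r) = r ∧ S (ρ r) = √(slopeSq M H c r) ∧ 0 < U (ρ r) ∧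
      HasDerivAt ρ (σ (ρ r) / S (ρ r)) r)
    (hR : ∀ v ∈ K, 2 * M < R v ∧ ρ (R v) = v) (hcbar : nullTime M U V (ρ r₁) = cbar) :
    Sigma1 M H c r₁ cbar = sweep K (nullPoint U V) := by
  have hV : ∀ r, 2 * M < r → 0 < V (ρ r) := fun r hr =>
    (hall _).V_pos (by rw [(hρ r hr).2.1]; exact hr) (hρ r hr).2.2.2.1
  have hd : ∀ r, 2 * M < r → HasDerivAt (fun r => nullTime M U V (ρ r)) (timeSlope M H c r) r := by
    intro r hr
    obtain ⟨-, h2, h3, h4, h5⟩ := hρ r hr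
    have := hasDerivAt_nullTime_comp hM hall h2 h5 h4.ne' (hV r hr).ne'
    rw [h3] at this
    exact this
  refine sweep_eq_of_inverse (ρ := ρ) (R := R) (fun r hr => ?_) hR
  have hr' : 2 * M < r := hr
  obtain ⟨h1, h2, h3, h4, h5⟩ := hρ r hr
  refine ⟨h1, ?_⟩
  have hsub : ∀ x ∈ uIcc r₁ r, 2 * M < x := fun x hx =>
    (lt_min hr₁ hr').trans_le hx.1
  have hf : f1 M H c r₁ cbar r = nullTime M U V (ρ r) := by
    unfold f1
    rw [intervalIntegral.integral_congr (g := timeSlope M H c)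
      (fun x hx => f1_integrand hM (hsub x hx)),
      intervalIntegral.integral_eq_sub_of_hasDerivAt (fun x hx => hd x (hsub x hx)), hcbar]
    · ring
    · apply ContinuousOn.intervalIntegrable
      intro x hx
      have hx' := hsub x hx
      have hx0 : x ≠ 0 := by linarith
      have c1 := (hasDerivAt_boostRate H c hx0).continuousAt
      have c2 := (hasDerivAt_slopeSq (M := M) (H := H) (c := c) hx0).continuousAt
      have c3 : ContinuousAt (hS M) x := by
        unfold hS
        exact continuousAt_const.sub (continuousAt_const.div continuousAt_id hx0)
      exact (c1.div (c3.mul c2.sqrt) (mul_pos (hS_pos hM hx')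
        (Real.sqrt_pos.2 (slopeSq_pos_of_lt hM hx'))).ne').continuousWithinAt
  have hm := (hall (ρ r)).mul
  rw [h2] at hm
  rw [hf]
  exact (regionI_eq hM hr' h4 (hV r hr) hm).symm

theorem Sigma3_eq_sweep (hM : 0 < M) (hall : ∀ v, CMCAt M H c R S σ U V p q v) {ρ : ℝ → ℝ}
    {K : Set ℝ} {r₃ cbar : ℝ} (hr₃ : 2 * M < r₃)
    (hρ : ∀ r, 2 * M < r → ρ r ∈ K ∧ R (ρ r) = r ∧ S (ρ r) = -√(slopeSq M H c r) ∧ U (ρ r) < 0 ∧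
      HasDerivAt ρ (σ (ρ r) / S (ρ r)) r)
    (hR : ∀ v ∈ K, 2 * M < R v ∧ ρ (R v) = v) (hcbar : nullTime M U V (ρ r₃) = cbar) :
    Sigma3 M H c r₃ cbar = sweep K (nullPoint U V) := by
  have hV : ∀ r, 2 * M < r → V (ρ r) < 0 := fun r hr =>
    (hall _).V_neg' (by rw [(hρ r hr).2.1]; exact hr) (hρ r hr).2.2.2.1
  have hd : ∀ r, 2 * M < r → HasDerivAt (fun r => nullTime M U V (ρ r)) (-timeSlope M H c r) r := by
    intro r hr
    obtain ⟨-, h2, h3, h4, h5⟩ := hρ r hr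
    have := hasDerivAt_nullTime_comp hM hall h2 h5 h4.ne (hV r hr).ne
    rw [h3, mul_neg, div_neg] at this
    exact this
  refine sweep_eq_of_inverse (ρ := ρ) (R := R) (fun r hr => ?_) hR
  have hr' : 2 * M < r := hr
  obtain ⟨h1, h2, h3, h4, h5⟩ := hρ r hr
  refine ⟨h1, ?_⟩
  have hsub : ∀ x ∈ uIcc r₃ r, 2 * M < x := fun x hx =>
    (lt_min hr₃ hr').trans_le hx.1
  have hf : f3 M H c r₃ cbar r = nullTime M U V (ρ r) := by
    unfold f3
    rw [intervalIntegral.integral_congr (g := fun x => -timeSlope M H c x)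
      (fun x hx => f3_integrand hM (hsub x hx)),
      intervalIntegral.integral_eq_sub_of_hasDerivAt (fun x hx => hd x (hsub x hx)), hcbar]
    · ring
    · apply ContinuousOn.intervalIntegrable
      intro x hx
      have hx' := hsub x hx
      have hx0 : x ≠ 0 := by linarith
      have c1 := (hasDerivAt_boostRate H c hx0).continuousAt
      have c2 := (hasDerivAt_slopeSq (M := M) (H := H) (c := c) hx0).continuousAt
      have c3 : ContinuousAt (hS M) x := by
        unfold hS
        exact continuousAt_const.sub (continuousAt_const.div continuousAt_id hx0)
      exact (c1.div (c3.mul c2.sqrt) (mul_pos (hS_pos hM hx')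
        (Real.sqrt_pos.2 (slopeSq_pos_of_lt hM hx'))).ne').neg.continuousWithinAt
  have hm := (hall (ρ r)).mul
  rw [h2] at hm
  rw [hf]
  exact (regionI'_eq hM hr' h4 (hV r hr) hm).symm

theorem timeSlope_neg {r : ℝ} (hr : r ∈ Ioo 0 (2 * M)) (hk : kTilde M H r < c) :
    timeSlope M H c r < 0 := by
  obtain ⟨h1, h2⟩ := slopeSq_pos_of_kTilde_lt hr hk
  exact div_neg_of_pos_of_neg h2 (mul_neg_of_neg_of_pos (hS_neg hr) (Real.sqrt_pos.2 h1))

/-- Both graphs in region II', for the sign `e = ±1` of `dr / ds`. -/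
theorem integral_timeSlope_eq (hM : 0 < M) (hall : ∀ v, CMCAt M H c R S σ U V p q v) {ρ : ℝ → ℝ}
    {J : Set ℝ} {e r₀ r₄ r : ℝ} (he : e ^ 2 = 1) (hr₀ : 0 ≤ r₀) (hJc : J.OrdConnected)
    (hJsub : J ⊆ Ico r₀ (2 * M)) (hk : ∀ r ∈ Ioo r₀ (2 * M), kTilde M H r < c)
    (hr₄ : r₄ ∈ J) (hr : r ∈ J) (hρc : ContinuousOn ρ J)
    (hρ : ∀ r ∈ J, R (ρ r) = r ∧ 0 < U (ρ r))
    (hρd : ∀ r ∈ J, r₀ < r → S (ρ r) = e * √(slopeSq M H c r) ∧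
      HasDerivAt ρ (σ (ρ r) / S (ρ r)) r) :
    IntervalIntegrable (fun x => -timeSlope M H c x) volume r₄ r ∧
    ∫ x in r₄..r, -timeSlope M H c x =
      -e * (nullTime M U V (ρ r) - nullTime M U V (ρ r₄)) := by
  have hsub : uIcc r₄ r ⊆ J := hJc.uIcc_subset hr₄ hr
  have hV : ∀ r ∈ J, V (ρ r) < 0 := fun r hr =>
    (hall _).V_neg (by rw [(hρ r hr).1]; exact (hJsub hr).2) (hρ r hr).2
  have hin : ∀ x ∈ Ioo (min r₄ r) (max r₄ r), x ∈ J ∧ x ∈ Ioo r₀ (2 * M) := by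
    intro x hx
    have hxJ : x ∈ J := hsub ⟨hx.1.le, hx.2.le⟩
    refine ⟨hxJ, lt_of_le_of_lt (le_min (hJsub hr₄).1 (hJsub hr).1) hx.1, (hJsub hxJ).2⟩
  -- Only continuity of time is needed at r₀: at a turning point the integrand blows up there, and
  -- integrability comes from its constant sign.
  have hθc : ContinuousOn (fun r => -e * nullTime M U V (ρ r)) (uIcc r₄ r) := by
    intro x hx
    have hxJ := hsub hx
    have c1 : ContinuousAt (nullTime M U V) (ρ x) :=
      ((hall (ρ x)).hasDerivAt_time hM (hρ x hxJ).2.ne' (hV x hxJ).ne).continuousAt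
    exact (continuousWithinAt_const.mul
      (c1.comp_continuousWithinAt (hρc x hxJ))).mono hsub
  have h := intervalIntegral_eq_sub_of_deriv_nonneg (θ' := fun x => -timeSlope M H c x) hθc
    (fun x hx => by
      obtain ⟨hxJ, hxI⟩ := hin x hx
      obtain ⟨s1, s2⟩ := hρd x hxJ hxI.1
      have hd := (hasDerivAt_nullTime_comp hM hall (hρ x hxJ).1 s2 (hρ x hxJ).2.ne'
        (hV x hxJ).ne).const_mul (-e)
      refine hd.congr_deriv ?_
      rw [s1]
      unfold timeSlope
      have he0 : e ≠ 0 := by rintro rfl; norm_num at he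
      have hP := Real.sqrt_pos.2
        (slopeSq_pos_of_kTilde_lt ⟨hr₀.trans_lt hxI.1, hxI.2⟩ (hk x hxI)).1
      have hh := (hS_neg (M := M) ⟨hr₀.trans_lt hxI.1, hxI.2⟩).ne
      field_simp)
    (fun x hx => by
      obtain ⟨-, hxI⟩ := hin x hx
      exact neg_nonneg.2 (timeSlope_neg ⟨hr₀.trans_lt hxI.1, hxI.2⟩ (hk x hxI)).le)
  refine ⟨h.1, h.2.trans ?_⟩
  ring

end Branch

section Branch

variable {M H c : ℝ} {R S σ U V p q : ℝ → ℝ} {ρ : ℝ → ℝ} {K : Set ℝ} {r₀ r₄ : ℝ}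

theorem nullPoint_eq_regionII' (hM : 0 < M) (hall : ∀ v, CMCAt M H c R S σ U V p q v) {v r : ℝ}
    (hr : R v = r) (hr2 : r < 2 * M) (hU : 0 < U v) :
    nullPoint U V v = regionII' M (nullTime M U V v) r := by
  subst hr
  exact (regionII'_eq hM hr2 hU ((hall v).V_neg hr2 hU) (hall v).mul).symm

theorem Sigma4dec_eq_sweep (hM : 0 < M) (hall : ∀ v, CMCAt M H c R S σ U V p q v)
    (hr₀ : 0 ≤ r₀) (hJc : (f4OuterDomain M H c).OrdConnected)
    (hJsub : f4OuterDomain M H c ⊆ Ico r₀ (2 * M))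
    (hk : ∀ r ∈ Ioo r₀ (2 * M), kTilde M H r < c) (hr₄ : r₄ ∈ f4OuterDomain M H c)
    (hρc : ContinuousOn ρ (f4OuterDomain M H c))
    (hρ : ∀ r ∈ f4OuterDomain M H c, ρ r ∈ K ∧ R (ρ r) = r ∧ 0 < U (ρ r))
    (hρd : ∀ r ∈ f4OuterDomain M H c, r₀ < r → S (ρ r) = √(slopeSq M H c r) ∧
      HasDerivAt ρ (σ (ρ r) / S (ρ r)) r)
    (hR : ∀ v ∈ K, R v ∈ f4OuterDomain M H c ∧ ρ (R v) = v) :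
    Sigma4dec M H c r₄ (nullTime M U V (ρ r₄)) = sweep K (nullPoint U V) := by
  refine sweep_eq_of_inverse (ρ := ρ) (R := R) (fun r hr => ⟨(hρ r hr).1, ?_⟩) hR
  rw [nullPoint_eq_regionII' hM hall (hρ r hr).2.1 (hJsub hr).2 (hρ r hr).2.2]
  congr 1
  have h := (integral_timeSlope_eq hM hall (e := 1) (by norm_num) hr₀ hJc hJsub hk hr₄ hr hρc
    (fun r hr => (hρ r hr).2) (by simpa using hρd)).2
  rw [intervalIntegral.integral_neg] at h
  have hsub : uIcc r₄ r ⊆ f4OuterDomain M H c := hJc.uIcc_subset hr₄ hr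
  unfold f4dec
  rw [intervalIntegral.integral_congr_uIoo (g := timeSlope M H c)]
  · linarith
  · intro x hx
    have hxI : x ∈ Ioo r₀ (2 * M) :=
      ⟨lt_of_le_of_lt (le_min (hJsub hr₄).1 (hJsub hr).1) hx.1, (hJsub (hsub ⟨hx.1.le, hx.2.le⟩)).2⟩
    have hx0 : x ∈ Ioo 0 (2 * M) := ⟨hr₀.trans_lt hxI.1, hxI.2⟩
    obtain ⟨h1, h2⟩ := slopeSq_pos_of_kTilde_lt hx0 (hk x hxI)
    exact f4dec_integrand hx0 h1 h2

theorem Sigma4inc_eq_sweep (hM : 0 < M) (hall : ∀ v, CMCAt M H c R S σ U V p q v)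
    (hr₀ : 0 ≤ r₀) (hJc : (f4OuterDomain M H c).OrdConnected)
    (hJsub : f4OuterDomain M H c ⊆ Ico r₀ (2 * M))
    (hk : ∀ r ∈ Ioo r₀ (2 * M), kTilde M H r < c) (hr₄ : r₄ ∈ f4OuterDomain M H c)
    (hρc : ContinuousOn ρ (f4OuterDomain M H c))
    (hρ : ∀ r ∈ f4OuterDomain M H c, ρ r ∈ K ∧ R (ρ r) = r ∧ 0 < U (ρ r))
    (hρd : ∀ r ∈ f4OuterDomain M H c, r₀ < r → S (ρ r) = -√(slopeSq M H c r) ∧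
      HasDerivAt ρ (σ (ρ r) / S (ρ r)) r)
    (hR : ∀ v ∈ K, R v ∈ f4OuterDomain M H c ∧ ρ (R v) = v) :
    Sigma4inc M H c r₄ (nullTime M U V (ρ r₄)) = sweep K (nullPoint U V) := by
  refine sweep_eq_of_inverse (ρ := ρ) (R := R) (fun r hr => ⟨(hρ r hr).1, ?_⟩) hR
  rw [nullPoint_eq_regionII' hM hall (hρ r hr).2.1 (hJsub hr).2 (hρ r hr).2.2]
  congr 1
  have h := (integral_timeSlope_eq hM hall (e := -1) (by norm_num) hr₀ hJc hJsub hk hr₄ hr hρc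
    (fun r hr => (hρ r hr).2) (by simpa using hρd)).2
  have hsub : uIcc r₄ r ⊆ f4OuterDomain M H c := hJc.uIcc_subset hr₄ hr
  unfold f4inc
  rw [intervalIntegral.integral_congr_uIoo (g := fun x => -timeSlope M H c x)]
  · linarith
  · intro x hx
    have hxI : x ∈ Ioo r₀ (2 * M) :=
      ⟨lt_of_le_of_lt (le_min (hJsub hr₄).1 (hJsub hr).1) hx.1, (hJsub (hsub ⟨hx.1.le, hx.2.le⟩)).2⟩
    have hx0 : x ∈ Ioo 0 (2 * M) := ⟨hr₀.trans_lt hxI.1, hxI.2⟩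
    obtain ⟨h1, h2⟩ := slopeSq_pos_of_kTilde_lt hx0 (hk x hxI)
    exact f4slope_eq hx0 h1 h2

theorem sweep_subset_closure (hall : ∀ v, CMCAt M H c R S σ U V p q v) {v : ℝ}
    (hv : v ∈ closure K) : sweep {v} (nullPoint U V) ⊆ closure (sweep K (nullPoint U V)) := by
  rw [← range_sweepMap, ← range_sweepMap]
  refine Subset.trans ?_ (image_closure_subset_closure_image (continuous_sweepMap hall))
  apply image_mono
  rw [closure_prod_eq, closure_univ]
  exact prod_mono (singleton_subset_iff.2 hv) Subset.rfl

/-- The pieces and the joining sphere lie on one smooth profile, so smoothness of the join is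
smoothness of that profile at v. -/
theorem joinSmoothly_sweep (hM : 0 < M) (hall : ∀ v, CMCAt M H c R S σ U V p q v) {A B : Set ℝ}
    {v : ℝ} (hA : IsOpen A) (hB : IsOpen B) (hAB : IsOpen (A ∪ {v} ∪ B)) (hvA : v ∈ closure A)
    (hvB : v ∈ closure B) :
    JoinSmoothly M H (sweep A (nullPoint U V)) (sweep {v} (nullPoint U V))
      (sweep B (nullPoint U V)) := by
  refine ⟨isSSCMC_sweep hall hM hA, isSSCMC_sweep hall hM hB, sweep_subset_closure hall hvA,
    sweep_subset_closure hall hvB, ?_⟩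
  rw [sweep_union, sweep_union]
  exact isSSCMC_sweep hall hM hAB

end Branch

/-! ### Infinite length, and bounds on the slope. -/

section Length

/-- Comparison with a logarithm: dℓ/dv = 1/σ is at least 1/(C(1 + v)), the derivative of C⁻¹ log(1 +
v). -/
theorem unbounded_of_growth {σ ℓ : ℝ → ℝ} (hσ : ∀ v, 0 < σ v) (hℓ : ∀ v, HasDerivAt ℓ (1 / σ v) v)
    {C : ℝ} (hC : ∀ v, 0 ≤ v → σ v ≤ C * (1 + v)) (B : ℝ) : ∃ v, B < ℓ v := by
  have hC0 : 0 < C := by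
    have := (hσ 0).trans_le (hC 0 le_rfl)
    simpa using this
  have hd : ∀ v ∈ Ici (0 : ℝ), HasDerivAt (fun v => ℓ v - C⁻¹ * Real.log (1 + v))
      (1 / σ v - C⁻¹ * (1 / (1 + v))) v := by
    intro v hv
    have hv' : (0 : ℝ) ≤ v := hv
    have h1 : HasDerivAt (fun v : ℝ => 1 + v) 1 v := (hasDerivAt_id v).const_add 1
    exact (hℓ v).sub ((h1.log (by positivity)).const_mul C⁻¹)
  have hmono : MonotoneOn (fun v => ℓ v - C⁻¹ * Real.log (1 + v)) (Ici 0) := by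
    apply monotoneOn_of_deriv_nonneg (convex_Ici 0)
    · exact fun v hv => (hd v hv).continuousAt.continuousWithinAt
    · intro v hv
      rw [interior_Ici] at hv
      exact (hd v (mem_Ici.2 (le_of_lt hv))).differentiableAt.differentiableWithinAt
    · intro v hv
      rw [interior_Ici] at hv
      have hv' : (0 : ℝ) < v := hv
      rw [(hd v hv'.le).deriv, sub_nonneg]
      have h1 := hC v hv'.le
      have h2 := one_div_le_one_div_of_le (hσ v) h1
      rw [one_div, mul_inv] at h2
      rw [one_div (1 + v)]
      exact h2
  have hlog : Tendsto (fun v : ℝ => C⁻¹ * Real.log (1 + v)) atTop atTop :=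
    (Real.tendsto_log_atTop.comp (tendsto_atTop_add_const_left _ 1 tendsto_id)).const_mul_atTop
      (inv_pos.2 hC0)
  obtain ⟨v, hv1, hv0⟩ :=
    ((hlog.eventually_gt_atTop (B - ℓ 0)).and (eventually_ge_atTop 0)).exists
  refine ⟨v, ?_⟩
  have := hmono (mem_Ici.2 le_rfl) (mem_Ici.2 hv0) hv0
  simp at this
  linarith

theorem unbounded_below_of_growth {σ ℓ : ℝ → ℝ} (hσ : ∀ v, 0 < σ v)
    (hℓ : ∀ v, HasDerivAt ℓ (1 / σ v) v) {C : ℝ} (hC : ∀ v, v ≤ 0 → σ v ≤ C * (1 - v)) (B : ℝ) :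
    ∃ v, ℓ v < B := by
  obtain ⟨v, hv⟩ := unbounded_of_growth (σ := fun v => σ (-v)) (ℓ := fun v => -ℓ (-v)) (C := C)
    (fun v => hσ _) (fun v => ((hℓ (-v)).comp v (hasDerivAt_neg v)).neg.congr_deriv (by ring))
    (fun v hv => by simpa using hC (-v) (by linarith)) (-B)
  exact ⟨-v, by linarith⟩

theorem exists_length {σ : ℝ → ℝ} (hσ : ∀ v, 0 < σ v) (hc : Continuous σ) :
    ∃ ℓ : ℝ → ℝ, ∀ v, HasDerivAt ℓ (1 / σ v) v := by
  have hc' : Continuous fun v => 1 / σ v := continuous_const.div hc fun v => (hσ v).ne'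
  exact ⟨fun v => ∫ x in 0..v, 1 / σ x, fun v => hc'.integral_hasStrictDerivAt 0 v |>.hasDerivAt⟩

variable {M H c : ℝ} {R S σ U V p q : ℝ → ℝ}

theorem isCompleteSSCMCWithTwoEnds_sweep (hM : 0 < M)
    (hall : ∀ v, CMCAt M H c R S σ U V p q v) (hσc : Continuous σ)
    (hprop : ∀ ε C : ℝ, 0 < ε → ∃ B, ∀ v, ε ≤ R v → R v ≤ C → |V v| ≤ C → |v| ≤ B)
    {C : ℝ} (htop : ∀ v, 0 ≤ v → σ v ≤ C * (1 + v))
    (hbot : (∃ C', ∀ v, v ≤ 0 → σ v ≤ C' * (1 - v)) ∨ Tendsto R atBot (𝓝 0)) :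
    IsCompleteSSCMCWithTwoEnds M H (sweep univ (nullPoint U V)) := by
  obtain ⟨ℓ, hℓ⟩ := exists_length (fun v => (hall v).σ_pos) hσc
  refine ⟨isSSCMC_sweep hall hM isOpen_univ, isConnected_sweep hall isConnected_univ, ?_,
    ncard_spaceEnds_sweep hall⟩
  refine isCompleteIn_sweep hM hall hprop hℓ
    (unbounded_of_growth (fun v => (hall v).σ_pos) hℓ htop) ?_
  refine hbot.imp_left ?_
  rintro ⟨C', hC'⟩
  exact unbounded_below_of_growth (fun v => (hall v).σ_pos) hℓ hC'

/-- `|dr / ds|` grows at most linearly. -/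
theorem sqrt_slopeSq_le (hM : 0 < M) {r : ℝ} (hr : 1 ≤ r) :
    √(slopeSq M H c r) ≤ (1 + |H| + |c|) * r := by
  have h0 : 0 < r := by linarith
  rw [Real.sqrt_le_left (by positivity)]
  have h1 : hS M r ≤ 1 := by
    unfold hS
    have : 0 < 2 * M / r := by positivity
    linarith
  have h2 : |boostRate H c r| ≤ (|H| + |c|) * r := by
    unfold boostRate
    have hc : |c / r ^ 2| ≤ |c| * r := by
      rw [abs_div, abs_of_pos (by positivity : 0 < r ^ 2)]
      calc |c| / r ^ 2 ≤ |c| := div_le_self (abs_nonneg c) (one_le_pow₀ hr)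
        _ ≤ |c| * r := le_mul_of_one_le_right (abs_nonneg c) hr
    calc |H * r + c / r ^ 2| ≤ |H * r| + |c / r ^ 2| := abs_add_le _ _
      _ ≤ |H| * r + |c| * r := by rw [abs_mul, abs_of_pos h0]; linarith
      _ = _ := by ring
  have h3 : boostRate H c r ^ 2 ≤ ((|H| + |c|) * r) ^ 2 := by
    rw [← sq_abs]
    exact pow_le_pow_left₀ (abs_nonneg _) h2 2
  unfold slopeSq
  have h4 : 0 ≤ (|H| + |c|) * r := by positivity
  nlinarith

/-- Positivity of the data along the branch where `r` increases. -/
theorem slope_data (hM : 0 < M) (hc : -8 * M ^ 3 * H < c) {r₀ r : ℝ} (hr₀ : 0 ≤ r₀) (hr : r₀ < r)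
    (hk : ∀ r ∈ Ioo r₀ (2 * M), kTilde M H r < c) :
    0 < slopeSq M H c r ∧ 0 < √(slopeSq M H c r) + boostRate H c r := by
  rcases lt_trichotomy r (2 * M) with h | h | h
  · obtain ⟨h1, h2⟩ := slopeSq_pos_of_kTilde_lt ⟨hr₀.trans_lt hr, h⟩ (hk r ⟨hr, h⟩)
    exact ⟨h1, by positivity⟩
  · have hw := boostRate_two_mul_pos hM hc
    subst h
    rw [slopeSq_two_mul hM, Real.sqrt_sq hw.le]
    exact ⟨by positivity, by positivity⟩
  · have h1 : 0 < slopeSq M H c r := slopeSq_pos_of_lt hM h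
    refine ⟨h1, ?_⟩
    have h2 : |boostRate H c r| < √(slopeSq M H c r) := by
      rw [← Real.sqrt_sq_eq_abs]
      apply Real.sqrt_lt_sqrt (sq_nonneg _)
      unfold slopeSq
      have := hS_pos hM h
      linarith
    have := neg_abs_le (boostRate H c r)
    linarith

end Length

section Common

variable {M H c : ℝ} {R S σ U V p q : ℝ → ℝ}

theorem contDiffAt_slopeSq {r : ℝ} (hr : r ≠ 0) : ContDiffAt ℝ ∞ (slopeSq M H c) r := by
  have h1 : ContDiffAt ℝ ∞ (hS M) r :=
    contDiffAt_const.sub (contDiffAt_const.div contDiffAt_id hr)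
  have h2 : ContDiffAt ℝ ∞ (boostRate H c) r :=
    (contDiffAt_const.mul contDiffAt_id).add
      (contDiffAt_const.div (contDiffAt_id.pow 2) (pow_ne_zero 2 hr))
  exact h1.add (h2.pow 2)

/-- A time translation that prescribes the Schwarzschild time of one point. -/
theorem exists_boost (hM : 0 < M) {v : ℝ} (hU : U v ≠ 0) (hV : V v ≠ 0) (t : ℝ) :
    ∃ k : ℝ, 0 < k ∧ nullTime M (fun v => k * U v) (fun v => k⁻¹ * V v) v = t := by
  refine ⟨Real.exp ((nullTime M U V v - t) / (4 * M)), Real.exp_pos _, ?_⟩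
  have hne := (Real.exp_pos ((nullTime M U V v - t) / (4 * M))).ne'
  unfold nullTime at *
  rw [Real.log_mul hne hU, Real.log_mul (inv_ne_zero hne) hV, Real.log_inv, Real.log_exp]
  field_simp
  ring

theorem nullPoint_horizon {v : ℝ} (h : CMCAt M H c R S σ U V p q v) (hr : R v = 2 * M)
    (hU : U v ≠ 0) : nullPoint U V v = (-(U v / 2), U v / 2) := by
  have hV : V v = 0 := by
    have := h.mul
    rw [hr, sub_self, zero_mul] at this
    exact (mul_eq_zero.1 this).resolve_left hU
  unfold nullPoint
  rw [hV]
  ext <;> ring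

end Common

/-! ### Curves without turning point: c ≥ C_H. -/

section ExpCase

variable {M H c r₀ : ℝ}

/-- The lower limit r₀ will be 0 if c > C_H and R_H if c = C_H; in both cases it corresponds to v =
−∞. The choice of σ below makes dr/dv = S/σ equal to e^v. -/
noncomputable def expR (r₀ v : ℝ) : ℝ := r₀ + Real.exp v

noncomputable def expS (M H c r₀ v : ℝ) : ℝ := √(slopeSq M H c (expR r₀ v))

noncomputable def expσ (M H c r₀ v : ℝ) : ℝ := expS M H c r₀ v / Real.exp v

theorem lt_expR (r₀ v : ℝ) : r₀ < expR r₀ v := lt_add_of_pos_right _ (Real.exp_pos v)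

theorem cmcAt_exp (hM : 0 < M) (hc : -8 * M ^ 3 * H < c) (hr₀ : 0 ≤ r₀)
    (hk : ∀ r ∈ Ioo r₀ (2 * M), kTilde M H r < c) (v : ℝ) :
    CMCAt M H c (expR r₀) (expS M H c r₀) (expσ M H c r₀)
      (halfU M H c (expR r₀) (expS M H c r₀) (expσ M H c r₀) 0 1)
      (halfV M H c (expR r₀) (expS M H c r₀) (expσ M H c r₀) 0 1)
      (halfP M H c (expR r₀) (expS M H c r₀) (expσ M H c r₀) 0 1)
      (halfQ M H c (expR r₀) (expS M H c r₀) (expσ M H c r₀) 0 1) v := by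
  have hdata := fun v => slope_data (r := expR r₀ v) hM hc hr₀ (lt_expR r₀ v) hk
  have hRpos : ∀ v, 0 < expR r₀ v := fun v => hr₀.trans_lt (lt_expR r₀ v)
  have hSpos : ∀ v, 0 < expS M H c r₀ v := fun v => Real.sqrt_pos.2 (hdata v).1
  have sR : ContDiff ℝ ∞ (expR r₀) := contDiff_const.add Real.contDiff_exp
  have sS : ∀ v, ContDiffAt ℝ ∞ (expS M H c r₀) v := fun v =>
    ((contDiffAt_slopeSq (hRpos v).ne').comp v sR.contDiffAt).sqrt (hdata v).1.ne'
  have dR : ∀ v, HasDerivAt (expR r₀) (Real.exp v) v := fun v => (Real.hasDerivAt_exp v).const_add r₀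
  have hquot : ∀ v, expS M H c r₀ v / expσ M H c r₀ v = Real.exp v := by
    intro v
    unfold expσ
    have := (hSpos v).ne'
    field_simp
  refine cmcAt_half (σ := expσ M H c r₀) hM one_pos isOpen_univ ordConnected_univ (mem_univ 0)
    (fun v _ => sR.contDiffAt) (fun v _ => sS v)
    (fun v _ => (sS v).div Real.contDiff_exp.contDiffAt (Real.exp_pos v).ne')
    (fun v _ => hRpos v) (fun v _ => div_pos (hSpos v) (Real.exp_pos v)) (fun v _ => (hdata v).2)
    (fun v _ => Real.sq_sqrt (hdata v).1.le) (fun v _ => by rw [hquot]; exact dR v)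
    (fun v _ => ?_) v (mem_univ v)
  refine (((hasDerivAt_slopeSq (hRpos v).ne').comp v (dR v)).sqrt (hdata v).1.ne').congr_deriv ?_
  have h1 := hSpos v
  unfold expσ
  change _ / (2 * expS M H c r₀ v) = _
  field_simp

/-- A linear bound on S near r₀, as at a double zero of S², bounds σ by B. Since S + w is bounded
too, the logarithmic derivative of U is bounded below by a positive constant δ, so U decays
exponentially as v → −∞. -/
theorem halfU_exp_le (hM : 0 < M) (hc : -8 * M ^ 3 * H < c) (hr₀ : 0 < r₀)
    (hk : ∀ r ∈ Ioo r₀ (2 * M), kTilde M H r < c) {B : ℝ}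
    (hB : ∀ r ∈ Ioc r₀ (r₀ + 1), √(slopeSq M H c r) ≤ B * (r - r₀)) :
    ∃ δ > 0, ∀ v ≤ 0, halfU M H c (expR r₀) (expS M H c r₀) (expσ M H c r₀) 0 1 v ≤
      Real.exp (δ * v) := by
  have hdata := fun v => slope_data (r := expR r₀ v) hM hc hr₀.le (lt_expR r₀ v) hk
  have hSpos : ∀ v, 0 < expS M H c r₀ v := fun v => Real.sqrt_pos.2 (hdata v).1
  have hσpos : ∀ v, 0 < expσ M H c r₀ v := fun v => div_pos (hSpos v) (Real.exp_pos v)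
  have hmem : ∀ v ≤ 0, expR r₀ v ∈ Ioc r₀ (r₀ + 1) := fun v hv =>
    ⟨lt_expR r₀ v, by unfold expR; linarith [Real.exp_le_one_iff.2 hv]⟩
  have hSle : ∀ v ≤ 0, expS M H c r₀ v ≤ B * Real.exp v := fun v hv => by
    have := hB _ (hmem v hv)
    rwa [show expR r₀ v - r₀ = Real.exp v by unfold expR; ring] at this
  have hσle : ∀ v ≤ 0, expσ M H c r₀ v ≤ B := fun v hv => by
    unfold expσ
    rw [div_le_iff₀ (Real.exp_pos v)]
    exact hSle v hv
  have hBpos : 0 < B := (hσpos 0).trans_le (hσle 0 le_rfl)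
  set W := B + (|H| * (r₀ + 1) + |c| / r₀ ^ 2) with hW
  have hWle : ∀ v ≤ 0, expS M H c r₀ v + boostRate H c (expR r₀ v) ≤ W := by
    intro v hv
    have h1 := hSle v hv
    have h2 : B * Real.exp v ≤ B := mul_le_of_le_one_right hBpos.le (Real.exp_le_one_iff.2 hv)
    obtain ⟨h3, h4⟩ := hmem v hv
    have h5 : H * expR r₀ v ≤ |H| * (r₀ + 1) :=
      mul_le_mul (le_abs_self H) h4 (by linarith) (abs_nonneg H)
    have h6 : c / expR r₀ v ^ 2 ≤ |c| / r₀ ^ 2 :=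
      div_le_div₀ (abs_nonneg c) (le_abs_self c) (by positivity)
        (pow_le_pow_left₀ hr₀.le h3.le 2)
    unfold boostRate
    linarith
  have hWpos : 0 < W := by
    have := abs_nonneg H
    have := abs_nonneg c
    positivity
  refine ⟨1 / (4 * M * B * W), by positivity, fun v hv => ?_⟩
  have hrate : ∀ x ≤ 0, 1 / (4 * M * B * W) ≤
      logRate M H c (expR r₀) (expS M H c r₀) (expσ M H c r₀) x := by
    intro x hx
    have h1 := (hdata x).2
    have h2 := hσpos x
    apply one_div_le_one_div_of_le
    · exact mul_pos (by positivity) h1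
    · exact mul_le_mul (mul_le_mul_of_nonneg_left (hσle x hx) (by positivity)) (hWle x hx) h1.le
        (by positivity)
  have hcont : Continuous (logRate M H c (expR r₀) (expS M H c r₀) (expσ M H c r₀)) := by
    rw [continuous_iff_continuousAt]
    intro x
    have h := cmcAt_exp hM hc hr₀.le hk x
    have hRx := h.R_pos
    have c1 := h.dR.continuousAt
    have c2 := h.dS.continuousAt
    have c3 : ContinuousAt (expσ M H c r₀) x :=
      c2.div Real.continuous_exp.continuousAt (Real.exp_pos x).ne'
    have c4 : ContinuousAt (fun x => boostRate H c (expR r₀ x)) x :=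
      (hasDerivAt_boostRate H c hRx.ne').continuousAt.comp c1
    exact continuousAt_const.div ((continuousAt_const.mul c3).mul (c2.add c4))
      (mul_pos (mul_pos (by positivity) (hσpos x)) (hdata x).2).ne'
  unfold halfU
  rw [one_mul, Real.exp_le_exp, intervalIntegral.integral_symm]
  have := intervalIntegral.integral_mono_on hv (μ := volume)
    (f := fun _ => 1 / (4 * M * B * W))
    (continuous_const.intervalIntegrable _ _) (hcont.intervalIntegrable v 0)
    (fun x hx => hrate x hx.2)
  rw [intervalIntegral.integral_const, smul_eq_mul] at this
  linarith

/-- For r₀ = 0 a lower bound on r bounds v below. For r₀ > 0 the radius stays away from 0 as v → −∞,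
but U → 0 while UV stays away from 0, so a bound on V does the same. -/
theorem proper_exp (hM : 0 < M) (hc : -8 * M ^ 3 * H < c) (hr₀ : 0 ≤ r₀) (hr₀2 : r₀ < 2 * M)
    (hk : ∀ r ∈ Ioo r₀ (2 * M), kTilde M H r < c)
    (hlow : r₀ = 0 ∨ ∃ B, ∀ r ∈ Ioc r₀ (r₀ + 1), √(slopeSq M H c r) ≤ B * (r - r₀))
    {k : ℝ} (hk0 : 0 < k) (ε C : ℝ) (hε : 0 < ε) :
    ∃ B, ∀ v, ε ≤ expR r₀ v → expR r₀ v ≤ C →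
      |k⁻¹ * halfV M H c (expR r₀) (expS M H c r₀) (expσ M H c r₀) 0 1 v| ≤ C → |v| ≤ B := by
  have hup : ∀ v, expR r₀ v ≤ C → v ≤ |C| := fun v hv => by
    have h1 := Real.add_one_le_exp v
    have h2 := le_abs_self C
    unfold expR at hv
    linarith
  suffices h : ∃ B, ∀ v, ε ≤ expR r₀ v → expR r₀ v ≤ C →
      |k⁻¹ * halfV M H c (expR r₀) (expS M H c r₀) (expσ M H c r₀) 0 1 v| ≤ C → B ≤ v by
    obtain ⟨B, hB⟩ := h
    refine ⟨max |C| |B|, fun v h1 h2 h3 => abs_le.2 ⟨?_, ?_⟩⟩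
    · have := hB v h1 h2 h3
      have h4 := neg_abs_le B
      have h5 := le_max_right |C| |B|
      linarith
    · exact (hup v h2).trans (le_max_left _ _)
  rcases hlow with h0 | ⟨B, hB⟩
  · refine ⟨Real.log ε, fun v h1 _ _ => ?_⟩
    rw [h0] at h1
    unfold expR at h1
    rw [zero_add] at h1
    exact (Real.log_le_iff_le_exp hε).2 h1
  · rcases hr₀.eq_or_lt with h00 | hpos
    · refine ⟨Real.log ε, fun v h1 _ _ => ?_⟩
      rw [← h00] at h1
      unfold expR at h1
      rw [zero_add] at h1
      exact (Real.log_le_iff_le_exp hε).2 h1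
    obtain ⟨δ, hδ, hU⟩ := halfU_exp_le hM hc hpos hk hB
    -- If e^v < d then r < 2M − d, hence |UV| ≥ d. Against this stands |UV| ≤ e^{δv} D, and D is
    -- made positive by the maximum with 1.
    set d := (2 * M - r₀) / 2 with hd
    have hd0 : 0 < d := by rw [hd]; linarith
    set D := max C 1 * k with hD
    have hD0 : 0 < D := by positivity
    refine ⟨min (min 0 (Real.log d)) (Real.log (d / D) / δ), fun v h1 h2 h3 => ?_⟩
    by_contra! hlt
    obtain ⟨⟨hv0, hvd⟩, hvδ⟩ : (v < 0 ∧ v < Real.log d) ∧ v < Real.log (d / D) / δ := by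
      simpa [lt_min_iff] using hlt
    have hexp : Real.exp v < d := (Real.lt_log_iff_exp_lt hd0).1 hvd
    have hm := (cmcAt_exp hM hc hr₀ hk v).mul
    have hUv := hU v hv0.le
    have hUpos := halfU_pos (M := M) (H := H) (c := c) (R := expR r₀) (S := expS M H c r₀)
      (σ := expσ M H c r₀) (v₀ := 0) one_pos v
    generalize halfU M H c (expR r₀) (expS M H c r₀) (expσ M H c r₀) 0 1 v = u at *
    generalize halfV M H c (expR r₀) (expS M H c r₀) (expσ M H c r₀) 0 1 v = w at *
    have hlarge : d ≤ |u * w| := by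
      have h4 : expR r₀ v - 2 * M < -d := by unfold expR; rw [hd] at hexp ⊢; linarith
      have h5 : 1 ≤ Real.exp (expR r₀ v / (2 * M)) :=
        Real.one_le_exp (div_nonneg (hr₀.trans (lt_expR r₀ v).le) (by positivity))
      rw [hm, abs_mul, abs_of_pos (Real.exp_pos _), abs_of_neg (by linarith)]
      nlinarith
    have hw : |w| ≤ D := by
      rw [abs_mul, abs_of_pos (inv_pos.2 hk0), inv_mul_le_iff₀ hk0] at h3
      rw [hD, mul_comm]
      exact h3.trans (mul_le_mul_of_nonneg_left (le_max_left _ _) hk0.le)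
    have hsmall : |u * w| ≤ Real.exp (δ * v) * D := by
      rw [abs_mul, abs_of_pos hUpos]
      exact mul_le_mul hUv hw (abs_nonneg _) (Real.exp_pos _).le
    have h6 : Real.exp (δ * v) < d / D := by
      rw [← Real.lt_log_iff_exp_lt (by positivity)]
      rw [lt_div_iff₀ hδ] at hvδ
      linarith
    rw [lt_div_iff₀ hD0] at h6
    linarith

/-- The solutions with one branch in region II'. -/
theorem two_ended_of_single_branch (hM : 0 < M) (hc : -8 * M ^ 3 * H < c) (hr₀ : 0 ≤ r₀)
    (hr₀2 : r₀ < 2 * M) (hk : ∀ r ∈ Ioo r₀ (2 * M), kTilde M H r < c)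
    (hlow : r₀ = 0 ∨ ∃ B, ∀ r ∈ Ioc r₀ (r₀ + 1), √(slopeSq M H c r) ≤ B * (r - r₀))
    (hdom : f4OuterDomain M H c = Ioo r₀ (2 * M)) {r₁ cbar₁ r₄ : ℝ} (hr₁ : 2 * M < r₁)
    (hr₄ : r₄ ∈ Ioo r₀ (2 * M)) :
    ∃ cbar₄ a : ℝ, 0 < a ∧
      JoinSmoothly M H (Sigma1 M H c r₁ cbar₁) (sphereOver (-a) a) (Sigma4dec M H c r₄ cbar₄) ∧
      IsCompleteSSCMCWithTwoEnds M H
        (Sigma1 M H c r₁ cbar₁ ∪ sphereOver (-a) a ∪ Sigma4dec M H c r₄ cbar₄) := by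
  have hall₁ := cmcAt_exp hM hc hr₀ hk
  have hprop₁ := fun k hk0 => proper_exp hM hc hr₀ hr₀2 hk hlow (k := k) hk0
  have hUpos₁ := fun v => halfU_pos (M := M) (H := H) (c := c) (R := expR r₀)
    (S := expS M H c r₀) (σ := expσ M H c r₀) (v₀ := 0) one_pos v
  generalize halfU M H c (expR r₀) (expS M H c r₀) (expσ M H c r₀) 0 1 = U₁ at *
  generalize halfV M H c (expR r₀) (expS M H c r₀) (expσ M H c r₀) 0 1 = V₁ at *
  generalize halfP M H c (expR r₀) (expS M H c r₀) (expσ M H c r₀) 0 1 = p₁ at *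
  generalize halfQ M H c (expR r₀) (expS M H c r₀) (expσ M H c r₀) 0 1 = q₁ at *
  have hρR : ∀ r, r₀ < r → expR r₀ (Real.log (r - r₀)) = r := fun r hr => by
    unfold expR
    rw [Real.exp_log (sub_pos.2 hr)]
    ring
  have hRρ : ∀ v, Real.log (expR r₀ v - r₀) = v := fun v => by
    unfold expR
    rw [add_sub_cancel_left, Real.log_exp]
  have hρ1 := hρR r₁ (hr₀2.trans hr₁)
  -- The given constant c̄₁ is the time of the curve at r₁, arranged by a time translation.
  obtain ⟨k, hk0, hkt⟩ := exists_boost (U := U₁) (V := V₁) (v := Real.log (r₁ - r₀)) hM (hUpos₁ _).ne'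
    ((hall₁ _).V_pos (by rw [hρ1]; exact hr₁) (hUpos₁ _)).ne' cbar₁
  have hall := fun v => (hall₁ v).boost hk0
  have hprop := hprop₁ k hk0
  have hUpos : ∀ v, 0 < k * U₁ v := fun v => mul_pos hk0 (hUpos₁ v)
  set U : ℝ → ℝ := fun v => k * U₁ v with hU
  set V : ℝ → ℝ := fun v => k⁻¹ * V₁ v with hV
  set vH := Real.log (2 * M - r₀) with hvH
  have hRvH : expR r₀ vH = 2 * M := hρR _ hr₀2
  have hρd : ∀ r, r₀ < r → HasDerivAt (fun r => Real.log (r - r₀))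
      (expσ M H c r₀ (Real.log (r - r₀)) / expS M H c r₀ (Real.log (r - r₀))) r := by
    intro r hr
    have h1 := (hasDerivAt_id r).sub_const r₀
    refine (h1.log (sub_pos.2 hr).ne').congr_deriv ?_
    unfold expσ
    have hS : 0 < expS M H c r₀ (Real.log (r - r₀)) :=
      Real.sqrt_pos.2 (slope_data hM hc hr₀ (lt_expR _ _) hk).1
    rw [Real.exp_log (sub_pos.2 hr)]
    have := sub_pos.2 hr
    simp only [id]
    field_simp
  have hS : ∀ r, r₀ < r → expS M H c r₀ (Real.log (r - r₀)) = √(slopeSq M H c r) := fun r hr => by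
    unfold expS
    rw [hρR r hr]
  have hlt : ∀ v, vH < v → 2 * M < expR r₀ v := fun v hv => by
    rw [← hRvH]
    exact add_lt_add_right (Real.exp_lt_exp.2 hv) r₀
  have hgt : ∀ v, v < vH → expR r₀ v < 2 * M := fun v hv => by
    rw [← hRvH]
    exact add_lt_add_right (Real.exp_lt_exp.2 hv) r₀
  have h1 : Sigma1 M H c r₁ cbar₁ = sweep (Ioi vH) (nullPoint U V) := by
    refine Sigma1_eq_sweep hM hall (ρ := fun r => Real.log (r - r₀)) hr₁ (fun r hr => ?_)
      (fun v hv => ⟨hlt v hv, hRρ v⟩) hkt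
    have hr' := hr₀2.trans hr
    exact ⟨Real.log_lt_log (sub_pos.2 hr₀2) (by linarith), hρR r hr', hS r hr', hUpos _, hρd r hr'⟩
  have h4 : Sigma4dec M H c r₄ (nullTime M U V (Real.log (r₄ - r₀))) =
      sweep (Iio vH) (nullPoint U V) := by
    refine Sigma4dec_eq_sweep hM hall (ρ := fun r => Real.log (r - r₀)) hr₀
      (by rw [hdom]; exact ordConnected_Ioo) (by rw [hdom]; exact Ioo_subset_Ico_self) hk
      (by rw [hdom]; exact hr₄) ?_ ?_ ?_ ?_
    · rw [hdom]
      exact fun r hr => (hρd r hr.1).continuousAt.continuousWithinAt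
    · rw [hdom]
      exact fun r hr => ⟨Real.log_lt_log (sub_pos.2 hr.1) (by linarith [hr.2]), hρR r hr.1, hUpos _⟩
    · exact fun r _ hr => ⟨hS r hr, hρd r hr⟩
    · rw [hdom]
      exact fun v hv => ⟨⟨lt_expR r₀ v, hgt v hv⟩, hRρ v⟩
  have hZ : sphereOver (-(U vH / 2)) (U vH / 2) = sweep {vH} (nullPoint U V) :=
    sphereOver_eq_sweep (nullPoint_horizon (hall vH) hRvH (hUpos vH).ne')
  have huniv : Ioi vH ∪ {vH} ∪ Iio vH = univ := by
    ext v
    rcases lt_trichotomy v vH with h | h | h <;> simp [h]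
  have hUH : 0 < U vH := hUpos vH
  -- After this normalization the curve is fixed, so the constant of Σ⁴ is its time at r₄ and the
  -- joining sphere its point with V = 0.
  refine ⟨nullTime M U V (Real.log (r₄ - r₀)), U vH / 2, by positivity, ?_, ?_⟩
  · rw [h1, h4, hZ]
    exact joinSmoothly_sweep hM hall isOpen_Ioi isOpen_Iio (by rw [huniv]; exact isOpen_univ)
      (by simp) (by simp)
  · rw [h1, h4, hZ, sweep_union, sweep_union, huniv]
    have hσc : Continuous (expσ M H c r₀) := by
      have : Continuous (expS M H c r₀) :=
        continuous_iff_continuousAt.2 fun v => (hall v).dS.continuousAt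
      exact this.div Real.continuous_exp fun v => (Real.exp_pos v).ne'
    -- S grows at most linearly in r ≤ (1 + r₀)e^v for v ≥ 0, so σ = S e^{−v} is even bounded
    -- towards the upper end.
    refine isCompleteSSCMCWithTwoEnds_sweep hM hall hσc hprop
      (C := (1 + |H| + |c|) * (1 + r₀)) (fun v hv => ?_) ?_
    · have hexp := Real.one_le_exp hv
      have hR1 : 1 ≤ expR r₀ v := by unfold expR; linarith
      have hb : expS M H c r₀ v ≤ (1 + |H| + |c|) * expR r₀ v := sqrt_slopeSq_le hM hR1
      have hHc : 0 ≤ 1 + |H| + |c| := by positivity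
      have h5 : expR r₀ v ≤ (1 + r₀) * Real.exp v := by
        unfold expR
        nlinarith
      have h6 : expσ M H c r₀ v ≤ (1 + |H| + |c|) * (1 + r₀) := by
        unfold expσ
        rw [div_le_iff₀ (Real.exp_pos v)]
        calc _ ≤ _ := hb
          _ ≤ (1 + |H| + |c|) * ((1 + r₀) * Real.exp v) := mul_le_mul_of_nonneg_left h5 hHc
          _ = _ := by ring
      have h7 : 0 ≤ (1 + |H| + |c|) * (1 + r₀) := by positivity
      nlinarith
    · rcases hlow with h0 | ⟨B, hB⟩
      · right
        have : expR r₀ = Real.exp := by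
          funext v
          unfold expR
          rw [h0, zero_add]
        rw [this]
        exact Real.tendsto_exp_atBot
      · left
        have hle : ∀ v ≤ 0, expσ M H c r₀ v ≤ B := fun v hv => by
          have hexp := Real.exp_le_one_iff.2 hv
          have := hB _ ⟨lt_expR r₀ v, by unfold expR; linarith⟩
          unfold expσ
          rw [div_le_iff₀ (Real.exp_pos v)]
          rwa [show expR r₀ v - r₀ = Real.exp v by unfold expR; ring] at this
        have hB0 : 0 < B := (hall 0).σ_pos.trans_le (hle 0 le_rfl)
        refine ⟨B, fun v hv => (hle v hv).trans ?_⟩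
        nlinarith

end ExpCase

/-! ### Curves with a turning point: c < C_H. -/

section Reflected

variable {M H c a : ℝ}

/-- `(slopeSq r - slopeSq a) / (r - a)`, up to the factor `r⁴`, if `slopeSq a = 0`. -/
noncomputable def quotPoly (M H c a r : ℝ) : ℝ :=
  (r ^ 3 + r ^ 2 * a + r * a ^ 2 + a ^ 3) - 2 * M * (r ^ 2 + r * a + a ^ 2) +
    H * (r ^ 2 + r * a + a ^ 2) * (H * r ^ 3 + H * a ^ 3 + 2 * c)

noncomputable def quotSlope (M H c a r : ℝ) : ℝ := quotPoly M H c a r / r ^ 4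

theorem turning_eq (hka : kTilde M H a = c) :
    H * a ^ 3 + c = √(a ^ 3 * (2 * M - a)) := by
  rw [← hka]
  unfold kTilde
  ring

theorem slopeSq_eq_mul (ha : a ∈ Ioo 0 (2 * M)) (hka : kTilde M H a = c) {r : ℝ} (hr : r ≠ 0) :
    slopeSq M H c r = (r - a) * quotSlope M H c a r := by
  have h1 := pow_four_mul_slopeSq (M := M) (H := H) (c := c) hr
  have h2 : (H * a ^ 3 + c) ^ 2 = a ^ 3 * (2 * M - a) := by
    rw [turning_eq hka, Real.sq_sqrt (kTilde_radicand_pos ha).le]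
  unfold quotSlope quotPoly
  apply mul_left_cancel₀ (pow_ne_zero 4 hr)
  rw [h1]
  field_simp
  linear_combination h2

theorem boostRate_turning_pos (ha : a ∈ Ioo 0 (2 * M)) (hka : kTilde M H a = c) :
    0 < boostRate H c a := by
  have h : boostRate H c a = (H * a ^ 3 + c) / a ^ 2 := by
    have := ha.1.ne'
    unfold boostRate
    field_simp
  rw [h, turning_eq hka]
  exact div_pos (Real.sqrt_pos.2 (kTilde_radicand_pos ha)) (pow_pos ha.1 2)

/-- At r = a the quotient is the derivative of S², and `hcrit` says that `kTilde` has negative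
derivative there, which makes it positive. Beyond a, both S² and r − a are positive. -/
theorem quotSlope_pos (hM : 0 < M) (hc : -8 * M ^ 3 * H < c) (ha : a ∈ Ioo 0 (2 * M))
    (hka : kTilde M H a = c) (hcrit : 3 * M - 2 * a < 3 * H * √(a ^ 3 * (2 * M - a)))
    (hk : ∀ r ∈ Ioo a (2 * M), kTilde M H r < c) {r : ℝ} (hr : a ≤ r) :
    0 < quotSlope M H c a r := by
  rcases hr.eq_or_lt with rfl | hr
  · have h : quotPoly M H c a a = 2 * a ^ 2 * (2 * a - 3 * M + 3 * H * (H * a ^ 3 + c)) := by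
      unfold quotPoly
      ring
    unfold quotSlope
    rw [h, turning_eq hka]
    have := ha.1
    have h2 : 0 < 2 * a - 3 * M + 3 * H * √(a ^ 3 * (2 * M - a)) := by linarith
    positivity
  · have h1 := (slope_data hM hc ha.1.le hr hk).1
    rw [slopeSq_eq_mul ha hka (ha.1.trans hr).ne'] at h1
    exact pos_of_mul_pos_right h1 (sub_pos.2 hr).le

theorem contDiffAt_quotSlope {r : ℝ} (hr : r ≠ 0) : ContDiffAt ℝ ∞ (quotSlope M H c a) r := by
  have h : ContDiff ℝ ∞ (quotPoly M H c a) := by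
    unfold quotPoly
    fun_prop
  exact h.contDiffAt.div (contDiffAt_id.pow 4) (pow_ne_zero 4 hr)

/-- The substitution r = a + v² resolves the simple zero of S² at a: the two branches ±√(S²) become
v > 0 and v < 0 of one smooth odd function, and the turning point is v = 0. -/
noncomputable def refR (a v : ℝ) : ℝ := a + v ^ 2

noncomputable def refS (M H c a v : ℝ) : ℝ := v * √(quotSlope M H c a (refR a v))

noncomputable def refσ (M H c a v : ℝ) : ℝ := √(quotSlope M H c a (refR a v)) / 2

theorem le_refR (a v : ℝ) : a ≤ refR a v := le_add_of_nonneg_right (sq_nonneg v)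

theorem refS_sq (ha : a ∈ Ioo 0 (2 * M)) (hka : kTilde M H a = c) {v : ℝ}
    (hq : 0 < quotSlope M H c a (refR a v)) :
    refS M H c a v ^ 2 = slopeSq M H c (refR a v) := by
  unfold refS
  rw [mul_pow, Real.sq_sqrt hq.le, slopeSq_eq_mul ha hka (ha.1.trans_le (le_refR a v)).ne']
  unfold refR
  ring

/-- The profile curve through the turning point `r = a`. -/
theorem exists_reflected_profile (hM : 0 < M) (hc : -8 * M ^ 3 * H < c) (ha : a ∈ Ioo 0 (2 * M))
    (hka : kTilde M H a = c) (hcrit : 3 * M - 2 * a < 3 * H * √(a ^ 3 * (2 * M - a)))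
    (hk : ∀ r ∈ Ioo a (2 * M), kTilde M H r < c) :
    ∃ U V p q : ℝ → ℝ, (∀ v, CMCAt M H c (refR a) (refS M H c a) (refσ M H c a) U V p q v) ∧
      (∀ v, -√(2 * M - a) < v → 0 < U v) ∧ (∀ v, v < -√(2 * M - a) → U v < 0) ∧
      U (-√(2 * M - a)) = 0 := by
  have hq := fun v => quotSlope_pos hM hc ha hka hcrit hk (le_refR a v)
  have hRpos : ∀ v, 0 < refR a v := fun v => ha.1.trans_le (le_refR a v)
  have hsqrt := fun v => Real.sqrt_pos.2 (hq v)
  have sR : ContDiff ℝ ∞ (refR a) := by unfold refR; fun_prop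
  have sQ : ∀ v, ContDiffAt ℝ ∞ (fun v => √(quotSlope M H c a (refR a v))) v := fun v =>
    ((contDiffAt_quotSlope (hRpos v).ne').comp v sR.contDiffAt).sqrt (hq v).ne'
  have dR : ∀ v, HasDerivAt (refR a) (2 * v) v := fun v => by
    exact ((hasDerivAt_pow 2 v).const_add a).congr_deriv (by simp)
  have dQ : ∀ v, HasDerivAt (fun v => √(quotSlope M H c a (refR a v)))
      (deriv (quotSlope M H c a) (refR a v) * (2 * v) / (2 * √(quotSlope M H c a (refR a v)))) v := by
    intro v
    have h1 := ((contDiffAt_quotSlope (M := M) (H := H) (c := c) (a := a)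
      (hRpos v).ne').differentiableAt (by simp)).hasDerivAt
    exact (h1.comp v (dR v)).sqrt (hq v).ne'
  -- The derivative of (r − a) · `quotSlope` at r − a = v². It identifies dS/dv with the equation
  -- required of S, also at v = 0 where S² = `slopeSq` cannot be divided by S.
  have hslope : ∀ v, 2 * (M / refR a v ^ 2 + boostRate H c (refR a v) * (H - 2 * c / refR a v ^ 3)) =
      quotSlope M H c a (refR a v) + v ^ 2 * deriv (quotSlope M H c a) (refR a v) := by
    intro v
    have h1 := ((contDiffAt_quotSlope (M := M) (H := H) (c := c) (a := a)
      (hRpos v).ne').differentiableAt (by simp)).hasDerivAt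
    have h2 := ((hasDerivAt_id (refR a v)).sub_const a).mul h1
    have h3 := (hasDerivAt_slopeSq (M := M) (H := H) (c := c) (hRpos v).ne')
    have h4 : slopeSq M H c =ᶠ[𝓝 (refR a v)] fun r => (r - a) * quotSlope M H c a r :=
      (lt_mem_nhds (hRpos v)).mono fun r hr => slopeSq_eq_mul ha hka hr.ne'
    have h5 := (h3.congr_of_eventuallyEq h4.symm).unique h2
    rw [h5]
    simp [refR]
  set b := √(2 * M - a) with hb
  have hb0 : 0 < b := Real.sqrt_pos.2 (sub_pos.2 ha.2)
  have hb2 : b ^ 2 = 2 * M - a := Real.sq_sqrt (sub_pos.2 ha.2).le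
  -- For −b < v < 0 the curve is inside the horizon, where h < 0 gives |S| < w, so S + w > 0
  -- although S < 0. At v = −b one has S = −w, which is why this half stops there.
  have hpos : ∀ v ∈ Ioi (-b), 0 < refS M H c a v + boostRate H c (refR a v) := by
    intro v hv
    have hv' : -b < v := hv
    rcases lt_trichotomy v 0 with h | rfl | h
    · have hlt : refR a v < 2 * M := by unfold refR; nlinarith
      have hgt : a < refR a v := by
        unfold refR
        have := sq_pos_of_neg h
        linarith
      obtain ⟨h1, h2⟩ := slopeSq_pos_of_kTilde_lt ⟨hRpos v, hlt⟩ (hk _ ⟨hgt, hlt⟩)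
      have h3 : refS M H c a v ^ 2 < boostRate H c (refR a v) ^ 2 := by
        rw [refS_sq ha hka (hq v)]
        unfold slopeSq
        have := hS_neg (M := M) ⟨hRpos v, hlt⟩
        linarith
      have h4 := abs_lt_of_sq_lt_sq h3 h2.le
      have := neg_abs_le (refS M H c a v)
      linarith
    · have h1 : refR a 0 = a := by simp [refR]
      have h2 : refS M H c a 0 = 0 := by simp [refS]
      rw [h1, h2, zero_add]
      exact boostRate_turning_pos ha hka
    · have hgt : a < refR a v := by
        unfold refR
        have := pow_pos h 2
        linarith
      have h1 := (slope_data hM hc ha.1.le hgt hk).2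
      have h2 : 0 < refS M H c a v := mul_pos h (hsqrt v)
      rw [← refS_sq ha hka (hq v), Real.sqrt_sq h2.le] at h1
      exact h1
  have hkpos : 0 < (2 * M - a) * Real.exp (a / (2 * M)) :=
    mul_pos (sub_pos.2 ha.2) (Real.exp_pos _)
  have hk0 := Real.sqrt_pos.2 hkpos
  -- At the turning point UV = −(2M − a)e^{a/2M}; the chosen value of U(0) is the one with U(0) =
  -- −V(0), as the reflection requires.
  have hhalf := cmcAt_half (M := M) (H := H) (c := c) (R := refR a) (S := refS M H c a)
    (σ := refσ M H c a) (v₀ := 0) (k := √((2 * M - a) * Real.exp (a / (2 * M)))) hM hk0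
    isOpen_Ioi ordConnected_Ioi (mem_Ioi.2 (neg_lt_zero.2 hb0)) (fun v _ => sR.contDiffAt)
    (fun v _ => contDiffAt_id.mul (sQ v)) (fun v _ => (sQ v).div_const 2) (fun v _ => hRpos v)
    (fun v _ => half_pos (hsqrt v)) hpos (fun v _ => refS_sq ha hka (hq v))
    (fun v _ => (dR v).congr_deriv (by
      unfold refS refσ
      have := (hsqrt v).ne'
      field_simp))
    (fun v _ => ((hasDerivAt_id v).mul (dQ v)).congr_deriv (by
      have h1 := hslope v
      have h2 := Real.sq_sqrt (hq v).le
      have h3 := (hsqrt v).ne'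
      have h4 : M / refR a v ^ 2 + boostRate H c (refR a v) * (H - 2 * c / refR a v ^ 3) =
        (quotSlope M H c a (refR a v) + v ^ 2 * deriv (quotSlope M H c a) (refR a v)) / 2 := by
        linarith
      rw [h4]
      unfold refσ
      simp only [id]
      rw [eq_div_iff (by positivity)]
      field_simp
      rw [h2]))
  obtain ⟨U, V, p, q, hall, hr, hl⟩ := exists_reflected_extension hM hb0 hhalf
    (fun v => by simp [refR]) (fun v => by simp [refS, refR]) (fun v => by simp [refσ, refR])
    (fun v _ => halfU_pos hk0 v) (by
      unfold halfV
      rw [halfU_self]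
      have h1 : refR a 0 = a := by simp [refR]
      rw [h1]
      have h2 := Real.sq_sqrt hkpos.le
      field_simp
      linear_combination h2)
  have hUpos : ∀ v, -b < v → 0 < U v := fun v hv => by
    rw [(hr v hv).1]
    exact halfU_pos hk0 v
  -- By symmetry V(v) = −U(−v), so the product UV determines the sign of U beyond −b from the sign
  -- already known at −v.
  have hVmul : ∀ v, v < b → U v * U (-v) = -(radiusFun M (refR a v)) := by
    intro v hv
    have h1 := (hl v hv).2
    rw [← (hr (-v) (by linarith)).1] at h1
    have h2 := (hall v).radiusFun_eq
    rw [h1] at h2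
    linear_combination -h2
  refine ⟨U, V, p, q, hall, hUpos, fun v hv => ?_, ?_⟩
  · have h1 := hVmul v (by linarith)
    have h2 := hUpos (-v) (by linarith)
    have h3 : 0 < radiusFun M (refR a v) := by
      refine mul_pos ?_ (Real.exp_pos _)
      unfold refR
      nlinarith
    by_contra! h0
    have := mul_nonneg h0 h2.le
    linarith
  · have h1 := hVmul (-b) (by linarith)
    have h2 := hUpos (- -b) (by linarith)
    have h3 : radiusFun M (refR a (-b)) = 0 := by
      unfold radiusFun refR
      rw [neg_sq, hb2]
      ring
    rw [h3, neg_zero] at h1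
    exact (mul_eq_zero.1 h1).resolve_right h2.ne'

theorem refR_sqrt {r : ℝ} (hr : a ≤ r) : refR a (√(r - a)) = r := by
  unfold refR
  rw [Real.sq_sqrt (sub_nonneg.2 hr)]
  ring

theorem refR_neg_sqrt {r : ℝ} (hr : a ≤ r) : refR a (-√(r - a)) = r := by
  unfold refR
  rw [neg_sq, Real.sq_sqrt (sub_nonneg.2 hr)]
  ring

theorem refS_sqrt (ha : a ∈ Ioo 0 (2 * M)) (hka : kTilde M H a = c) {r : ℝ} (hr : a ≤ r) :
    refS M H c a (√(r - a)) = √(slopeSq M H c r) := by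
  unfold refS
  rw [refR_sqrt hr, slopeSq_eq_mul ha hka (ha.1.trans_le hr).ne', Real.sqrt_mul (sub_nonneg.2 hr)]

theorem refS_neg_sqrt (ha : a ∈ Ioo 0 (2 * M)) (hka : kTilde M H a = c) {r : ℝ} (hr : a ≤ r) :
    refS M H c a (-√(r - a)) = -√(slopeSq M H c r) := by
  unfold refS
  rw [refR_neg_sqrt hr, slopeSq_eq_mul ha hka (ha.1.trans_le hr).ne',
    Real.sqrt_mul (sub_nonneg.2 hr), neg_mul]

theorem refσ_div_refS {v : ℝ} (hq : 0 < quotSlope M H c a (refR a v)) (hv : v ≠ 0) :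
    refσ M H c a v / refS M H c a v = 1 / (2 * v) := by
  have := (Real.sqrt_pos.2 hq).ne'
  unfold refσ refS
  field_simp

theorem hasDerivAt_sqrt_sub {r : ℝ} (hq : 0 < quotSlope M H c a r) (hr : a < r) :
    HasDerivAt (fun r => √(r - a))
      (refσ M H c a (√(r - a)) / refS M H c a (√(r - a))) r := by
  have h1 := sub_pos.2 hr
  rw [refσ_div_refS (by rwa [refR_sqrt hr.le]) (Real.sqrt_pos.2 h1).ne']
  exact ((hasDerivAt_id r).sub_const a).sqrt h1.ne'

theorem hasDerivAt_neg_sqrt_sub {r : ℝ} (hq : 0 < quotSlope M H c a r) (hr : a < r) :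
    HasDerivAt (fun r => -√(r - a))
      (refσ M H c a (-√(r - a)) / refS M H c a (-√(r - a))) r := by
  have h1 := sub_pos.2 hr
  rw [refσ_div_refS (by rwa [refR_neg_sqrt hr.le]) (neg_ne_zero.2 (Real.sqrt_pos.2 h1).ne')]
  refine ((hasDerivAt_id r).sub_const a).sqrt h1.ne' |>.neg |>.congr_deriv ?_
  simp only [id]
  rw [mul_neg, div_neg]

/-- Time is smooth in v up to v = 0, hence continuous in r up to a, and it is monotone in r. A
derivative of constant sign with continuous primitive is integrable. -/
theorem f4FiniteAt_turning (hM : 0 < M) (hc : -8 * M ^ 3 * H < c) (ha : a ∈ Ioo 0 (2 * M))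
    (hka : kTilde M H a = c) (hcrit : 3 * M - 2 * a < 3 * H * √(a ^ 3 * (2 * M - a)))
    (hk : ∀ r ∈ Ioo a (2 * M), kTilde M H r < c) : F4FiniteAt M H c a := by
  obtain ⟨U, V, p, q, hall, hU, -, -⟩ := exists_reflected_profile hM hc ha hka hcrit hk
  obtain ⟨s, has, hs2⟩ := exists_between ha.2
  have hq := fun r (hr : a ≤ r) => quotSlope_pos hM hc ha hka hcrit hk hr
  have hint := (integral_timeSlope_eq hM hall (ρ := fun r => √(r - a)) (J := Ico a (2 * M)) (e := 1)
    (r₄ := a) (r := s) (by norm_num) ha.1.le ordConnected_Ico Subset.rfl hk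
    ⟨le_rfl, ha.2⟩ ⟨has.le, hs2⟩ (by fun_prop)
    (fun r hr => ⟨refR_sqrt hr.1, hU _ ((neg_lt_zero.2 (Real.sqrt_pos.2 (sub_pos.2 ha.2))).trans_le
      (Real.sqrt_nonneg _))⟩)
    (fun r hr har => ⟨by rw [one_mul]; exact refS_sqrt ha hka hr.1,
      hasDerivAt_sqrt_sub (hq r hr.1) har⟩)).1
  refine ⟨s, ⟨ha.1.trans has, hs2⟩, has.ne', ?_, ?_⟩
  · intro x hx hne
    rw [uIcc_of_le has.le] at hx
    exact hk x ⟨lt_of_le_of_ne hx.1 (Ne.symm hne), hx.2.trans_lt hs2⟩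
  · refine hint.congr_uIoo fun x hx => ?_
    rw [uIoo_of_le has.le] at hx
    have hx0 : x ∈ Ioo 0 (2 * M) := ⟨ha.1.trans hx.1, hx.2.trans hs2⟩
    obtain ⟨h1, h2⟩ := slopeSq_pos_of_kTilde_lt hx0 (hk x ⟨hx.1, hx0.2⟩)
    exact (f4slope_eq hx0 h1 h2).symm

theorem refσ_le (hM : 0 < M) (hc : -8 * M ^ 3 * H < c) (ha : a ∈ Ioo 0 (2 * M))
    (hka : kTilde M H a = c) (hcrit : 3 * M - 2 * a < 3 * H * √(a ^ 3 * (2 * M - a)))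
    (hk : ∀ r ∈ Ioo a (2 * M), kTilde M H r < c) (hcont : Continuous (refσ M H c a)) :
    ∃ C, ∀ v, 0 ≤ v → refσ M H c a v ≤ C * (1 + v) := by
  obtain ⟨C₁, hC₁⟩ := (isCompact_Icc (a := (0 : ℝ)) (b := 1)).bddAbove_image hcont.continuousOn
  -- For v ≥ 1 one has r = a + v² ≤ (a + 1)v², so the linear bound on S gives v √`quotSlope` ≤ C₂
  -- v²; on [0, 1] compactness suffices.
  set C₂ := (1 + |H| + |c|) * (a + 1) with hC₂
  have ha0 := ha.1
  have hC₂0 : 0 < C₂ := by positivity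
  refine ⟨max C₁ C₂, fun v hv => ?_⟩
  rcases le_total v 1 with h | h
  · have h1 := hC₁ (mem_image_of_mem _ ⟨hv, h⟩)
    have h2 := le_max_left C₁ C₂
    have h3 := le_max_right C₁ C₂
    nlinarith
  · have h1 : 1 ≤ refR a v := by unfold refR; nlinarith
    have h2 := sqrt_slopeSq_le (H := H) (c := c) hM h1
    have hq := quotSlope_pos hM hc ha hka hcrit hk (le_refR a v)
    have h3 : 0 ≤ refS M H c a v := mul_nonneg hv (Real.sqrt_nonneg _)
    rw [← refS_sq ha hka hq, Real.sqrt_sq h3] at h2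
    have h4 : refR a v ≤ (a + 1) * v ^ 2 := by
      have : 1 ≤ v ^ 2 := by nlinarith
      unfold refR
      nlinarith [mul_le_mul_of_nonneg_left this ha0.le]
    have h5 : v * √(quotSlope M H c a (refR a v)) ≤ v * (C₂ * v) := by
      calc _ ≤ _ := h2
        _ ≤ (1 + |H| + |c|) * ((a + 1) * v ^ 2) := mul_le_mul_of_nonneg_left h4 (by positivity)
        _ = _ := by rw [hC₂]; ring
    have h6 := le_of_mul_le_mul_left h5 (by linarith)
    have h7 := le_max_right C₁ C₂
    have h8 : 0 ≤ √(quotSlope M H c a (refR a v)) := Real.sqrt_nonneg _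
    unfold refσ
    have h9 : C₂ * v ≤ max C₁ C₂ * (1 + v) :=
      mul_le_mul h7 (by linarith) hv (hC₂0.le.trans h7)
    linarith

/-- The solutions with two branches in region II'. -/
theorem two_ended_of_two_branches (hM : 0 < M) (hc : -8 * M ^ 3 * H < c) (ha : a ∈ Ioo 0 (2 * M))
    (hka : kTilde M H a = c) (hcrit : 3 * M - 2 * a < 3 * H * √(a ^ 3 * (2 * M - a)))
    (hk : ∀ r ∈ Ioo a (2 * M), kTilde M H r < c)
    (hdom : f4OuterDomain M H c = Ico a (2 * M)) {r₁ cbar₁ r₃ : ℝ} (hr₁ : 2 * M < r₁)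
    (hr₃ : 2 * M < r₃) :
    ∃ cbar₄ cbar₃ x y : ℝ, 0 < x ∧ 0 < y ∧
      JoinSmoothly M H (Sigma1 M H c r₁ cbar₁) (sphereOver (-x) x)
        (Sigma4inc M H c a cbar₄ ∪ Sigma4dec M H c a cbar₄) ∧
      JoinSmoothly M H (Sigma4inc M H c a cbar₄ ∪ Sigma4dec M H c a cbar₄)
        (sphereOver (-y) (-y)) (Sigma3 M H c r₃ cbar₃) ∧
      IsCompleteSSCMCWithTwoEnds M H
        (Sigma1 M H c r₁ cbar₁ ∪ sphereOver (-x) x ∪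
          (Sigma4inc M H c a cbar₄ ∪ Sigma4dec M H c a cbar₄) ∪
          sphereOver (-y) (-y) ∪ Sigma3 M H c r₃ cbar₃) := by
  obtain ⟨U₁, V₁, p₁, q₁, hall₁, hUp₁, hUn₁, hUz₁⟩ :=
    exists_reflected_profile hM hc ha hka hcrit hk
  have hq := fun r (hr : a ≤ r) => quotSlope_pos hM hc ha hka hcrit hk hr
  set b := √(2 * M - a) with hb
  have hb0 : 0 < b := Real.sqrt_pos.2 (sub_pos.2 ha.2)
  have hb2 : b ^ 2 = 2 * M - a := Real.sq_sqrt (sub_pos.2 ha.2).le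
  have hneg : ∀ r, -b < √(r - a) := fun r => (neg_lt_zero.2 hb0).trans_le (Real.sqrt_nonneg _)
  have hbsqrt : ∀ r, 2 * M < r → b < √(r - a) := fun r hr =>
    Real.sqrt_lt_sqrt (sub_pos.2 ha.2).le (by linarith)
  obtain ⟨k, hk0, hkt⟩ := exists_boost (U := U₁) (V := V₁) (v := √(r₁ - a)) hM
    (hUp₁ _ (hneg _)).ne' ((hall₁ _).V_pos (by
      rw [refR_sqrt (ha.2.trans hr₁).le]; exact hr₁) (hUp₁ _ (hneg _))).ne' cbar₁
  have hall := fun v => (hall₁ v).boost hk0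
  have hUp : ∀ v, -b < v → 0 < k * U₁ v := fun v hv => mul_pos hk0 (hUp₁ v hv)
  have hUn : ∀ v, v < -b → k * U₁ v < 0 := fun v hv => mul_neg_of_pos_of_neg hk0 (hUn₁ v hv)
  have hUz : k * U₁ (-b) = 0 := by rw [hUz₁, mul_zero]
  set U : ℝ → ℝ := fun v => k * U₁ v with hU
  set V : ℝ → ℝ := fun v => k⁻¹ * V₁ v with hV
  have h1 : Sigma1 M H c r₁ cbar₁ = sweep (Ioi b) (nullPoint U V) := by
    refine Sigma1_eq_sweep hM hall (ρ := fun r => √(r - a)) hr₁ (fun r hr => ?_)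
      (fun v hv => ?_) hkt
    · have har := ha.2.trans hr
      exact ⟨hbsqrt r hr, refR_sqrt har.le, refS_sqrt ha hka har.le, hUp _ (hneg r),
        hasDerivAt_sqrt_sub (hq r har.le) har⟩
    · have hv' : b < v := hv
      unfold refR
      refine ⟨by nlinarith, ?_⟩
      rw [add_sub_cancel_left, Real.sqrt_sq (hb0.trans hv').le]
  have h3 : Sigma3 M H c r₃ (nullTime M U V (-√(r₃ - a))) =
      sweep (Iio (-b)) (nullPoint U V) := by
    refine Sigma3_eq_sweep hM hall (ρ := fun r => -√(r - a)) hr₃ (fun r hr => ?_)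
      (fun v hv => ?_) rfl
    · have har := ha.2.trans hr
      exact ⟨neg_lt_neg (hbsqrt r hr), refR_neg_sqrt har.le, refS_neg_sqrt ha hka har.le,
        hUn _ (neg_lt_neg (hbsqrt r hr)), hasDerivAt_neg_sqrt_sub (hq r har.le) har⟩
    · have hv' : v < -b := hv
      unfold refR
      refine ⟨by nlinarith, ?_⟩
      rw [add_sub_cancel_left, Real.sqrt_sq_eq_abs, abs_of_neg (by linarith), neg_neg]
  have hsb : ∀ r ∈ Ico a (2 * M), √(r - a) < b := fun r hr =>
    Real.sqrt_lt_sqrt (sub_nonneg.2 hr.1) (by linarith [hr.2])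
  -- The decreasing branch is 0 ≤ v < b, where S ≥ 0 and h < 0, and the increasing one is −b < v ≤
  -- 0. They share v = 0, hence the base point a and the additive constant.
  have hdec : Sigma4dec M H c a (nullTime M U V 0) = sweep (Ico 0 b) (nullPoint U V) := by
    have h := Sigma4dec_eq_sweep hM hall (ρ := fun r => √(r - a)) (K := Ico 0 b) (r₄ := a)
      ha.1.le (by rw [hdom]; exact ordConnected_Ico) (by rw [hdom]) hk
      (by rw [hdom]; exact ⟨le_rfl, ha.2⟩) (by fun_prop) ?_ ?_ ?_
    · simpa using h
    · rw [hdom]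
      exact fun r hr => ⟨⟨Real.sqrt_nonneg _, hsb r hr⟩, refR_sqrt hr.1, hUp _ (hneg r)⟩
    · rw [hdom]
      exact fun r hr har => ⟨refS_sqrt ha hka hr.1, hasDerivAt_sqrt_sub (hq r hr.1) har⟩
    · rw [hdom]
      intro v hv
      unfold refR
      refine ⟨⟨by nlinarith, by nlinarith [hv.1, hv.2]⟩, ?_⟩
      rw [add_sub_cancel_left, Real.sqrt_sq hv.1]
  have hinc : Sigma4inc M H c a (nullTime M U V 0) = sweep (Ioc (-b) 0) (nullPoint U V) := by
    have h := Sigma4inc_eq_sweep hM hall (ρ := fun r => -√(r - a)) (K := Ioc (-b) 0) (r₄ := a)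
      ha.1.le (by rw [hdom]; exact ordConnected_Ico) (by rw [hdom]) hk
      (by rw [hdom]; exact ⟨le_rfl, ha.2⟩) (by fun_prop) ?_ ?_ ?_
    · simpa using h
    · rw [hdom]
      exact fun r hr => ⟨⟨neg_lt_neg (hsb r hr), neg_nonpos.2 (Real.sqrt_nonneg _)⟩,
        refR_neg_sqrt hr.1, hUp _ (neg_lt_neg (hsb r hr))⟩
    · rw [hdom]
      exact fun r hr har => ⟨refS_neg_sqrt ha hka hr.1, hasDerivAt_neg_sqrt_sub (hq r hr.1) har⟩
    · rw [hdom]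
      intro v hv
      unfold refR
      refine ⟨⟨by nlinarith, by nlinarith [hv.1, hv.2]⟩, ?_⟩
      rw [add_sub_cancel_left, Real.sqrt_sq_eq_abs, abs_of_nonpos hv.2, neg_neg]
  have hmid : Ioc (-b) 0 ∪ Ico 0 b = Ioo (-b) b := by
    ext v
    simp only [mem_union, mem_Ioc, mem_Ico, mem_Ioo]
    constructor
    · rintro (h | h)
      · exact ⟨h.1, by linarith [h.2]⟩
      · exact ⟨by linarith [h.1], h.2⟩
    · intro h
      rcases le_total v 0 with h0 | h0
      · exact Or.inl ⟨h.1, h0⟩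
      · exact Or.inr ⟨h0, h.2⟩
  have h4 : Sigma4inc M H c a (nullTime M U V 0) ∪ Sigma4dec M H c a (nullTime M U V 0) =
      sweep (Ioo (-b) b) (nullPoint U V) := by
    rw [hinc, hdec, sweep_union, hmid]
  have hRb : refR a b = 2 * M := by unfold refR; linarith
  have hZ : sphereOver (-(U b / 2)) (U b / 2) = sweep {b} (nullPoint U V) :=
    sphereOver_eq_sweep (nullPoint_horizon (hall b) hRb (hUp b (by linarith)).ne')
  -- On the second horizon U = 0, and S < 0 < w makes S − w negative, which by `relV` is the sign of
  -- V.
  have hVb : V (-b) < 0 := by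
    have e1 := (hall (-b)).relV
    have e2 := (hall (-b)).relU
    have e3 := (hall (-b)).p_pos
    have hRb' : refR a (-b) = 2 * M := by unfold refR; linarith [neg_sq b]
    have hw := boostRate_two_mul_pos hM hc
    have hSneg : refS M H c a (-b) < 0 :=
      mul_neg_of_neg_of_pos (neg_lt_zero.2 hb0) (Real.sqrt_pos.2 (hq _ (le_refR a _)))
    rw [hRb'] at e1
    have hneg : 4 * M * Real.exp (-(2 * M) / (2 * M)) * (V (-b) * (k * p₁ (-b))) < 0 := by
      rw [e1]
      exact mul_neg_of_pos_of_neg (by positivity) (by linarith)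
    by_contra! h0
    have : 0 ≤ 4 * M * Real.exp (-(2 * M) / (2 * M)) * (V (-b) * (k * p₁ (-b))) :=
      mul_nonneg (by positivity) (mul_nonneg h0 e3.le)
    linarith
  have hZ' : sphereOver (-(-V (-b) / 2)) (-(-V (-b) / 2)) = sweep {-b} (nullPoint U V) := by
    refine sphereOver_eq_sweep ?_
    have : U (-b) = 0 := hUz
    unfold nullPoint
    rw [this]
    ext <;> ring
  have hUb : 0 < U b := hUp b (by linarith)
  have hIcc : Ioi b ∪ {b} ∪ Ioo (-b) b = Ioi (-b) := by
    ext v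
    simp only [mem_union, mem_Ioi, mem_singleton_iff, mem_Ioo]
    constructor
    · rintro ((h | h) | h)
      · linarith
      · linarith
      · exact h.1
    · intro h
      rcases lt_trichotomy v b with h' | h' | h'
      · exact Or.inr ⟨h, h'⟩
      · exact Or.inl (Or.inr h')
      · exact Or.inl (Or.inl h')
  have hIcc' : Ioo (-b) b ∪ {-b} ∪ Iio (-b) = Iio b := by
    ext v
    simp only [mem_union, mem_Iio, mem_singleton_iff, mem_Ioo]
    constructor
    · rintro ((h | h) | h)
      · exact h.2
      · linarith
      · linarith
    · intro h
      rcases lt_trichotomy v (-b) with h' | h' | h'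
      · exact Or.inr h'
      · exact Or.inl (Or.inr h')
      · exact Or.inl (Or.inl ⟨h', h⟩)
  have huniv : Ioi (-b) ∪ {-b} ∪ Iio (-b) = univ := by
    ext v
    rcases lt_trichotomy v (-b) with h | h | h <;> simp [h]
  have hbb : -b ≠ b := by linarith
  refine ⟨nullTime M U V 0, nullTime M U V (-√(r₃ - a)), U b / 2, -V (-b) / 2, by positivity,
    by linarith, ?_, ?_, ?_⟩
  · rw [h1, h4, hZ]
    exact joinSmoothly_sweep hM hall isOpen_Ioi isOpen_Ioo (by rw [hIcc]; exact isOpen_Ioi)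
      (by simp) (by rw [closure_Ioo hbb]; exact ⟨by linarith, le_rfl⟩)
  · rw [h3, h4, hZ']
    exact joinSmoothly_sweep hM hall isOpen_Ioo isOpen_Iio (by rw [hIcc']; exact isOpen_Iio)
      (by rw [closure_Ioo hbb]; exact ⟨le_rfl, by linarith⟩) (by simp)
  · rw [h1, h3, h4, hZ, hZ', sweep_union, sweep_union, hIcc, sweep_union, sweep_union, huniv]
    have hRc : Continuous (refR a) := by unfold refR; fun_prop
    have hσc : Continuous (refσ M H c a) := by
      have : Continuous fun v => √(quotSlope M H c a (refR a v)) := by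
        rw [continuous_iff_continuousAt]
        intro v
        exact (ContinuousAt.comp (contDiffAt_quotSlope
          (ha.1.trans_le (le_refR a v)).ne').continuousAt hRc.continuousAt).sqrt
      exact this.div_const 2
    obtain ⟨C, hC⟩ := refσ_le hM hc ha hka hcrit hk hσc
    refine isCompleteSSCMCWithTwoEnds_sweep hM hall hσc (fun ε C _ => ⟨|C| + 1, ?_⟩) hC
      (Or.inl ⟨C, fun v hv => ?_⟩)
    · intro v _ h2 _
      unfold refR at h2
      have h5 := le_abs_self C
      have h6 : |v| ^ 2 = v ^ 2 := sq_abs v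
      have h7 := abs_nonneg v
      have := ha.1
      nlinarith
    · have h := hC (-v) (by linarith)
      simpa [refσ, refR, sub_eq_add_neg] using h

end Reflected

/-! ### The double zero of S² at R_H when c = C_H. -/

section Critical

variable {M H c R : ℝ}

theorem boostRate_eq_div {r : ℝ} (hr : r ≠ 0) : boostRate H c r = (H * r ^ 3 + c) / r ^ 2 := by
  unfold boostRate
  field_simp

/-- At the maximum of `kTilde`, `slopeSq` has a double zero. -/
theorem exists_slopeSq_eq_sq_mul (hR : R ∈ Ioo 0 (2 * M)) (hkR : kTilde M H R = c)
    (hcrit : 3 * M - 2 * R = 3 * H * √(R ^ 3 * (2 * M - R))) :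
    ∃ g : ℝ → ℝ, Continuous g ∧ ∀ r, r ≠ 0 → slopeSq M H c r = (r - R) ^ 2 * (g r / r ^ 4) := by
  -- The quotient of `quotPoly` by r − R. The remainder is its value at R, namely 2R²(2R − 3M +
  -- 3H(HR³ + c)), which the critical equation makes zero.
  refine ⟨fun r => (r ^ 2 + 2 * r * R + 3 * R ^ 2) - 2 * M * (r + 2 * R) +
    H * ((r + 2 * R) * (H * r ^ 3 + H * R ^ 3 + 2 * c) + 3 * R ^ 2 * H * (r ^ 2 + r * R + R ^ 2)),
    by fun_prop, fun r hr => ?_⟩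
  rw [← turning_eq hkR] at hcrit
  rw [slopeSq_eq_mul hR hkR hr]
  unfold quotSlope quotPoly
  field_simp
  linear_combination (-2 * R ^ 2) * (r - R) * hcrit

theorem exists_sqrt_slopeSq_le (hR : R ∈ Ioo 0 (2 * M)) (hkR : kTilde M H R = c)
    (hcrit : 3 * M - 2 * R = 3 * H * √(R ^ 3 * (2 * M - R))) :
    ∃ B, ∀ r ∈ Ioc R (R + 1), √(slopeSq M H c r) ≤ B * (r - R) := by
  obtain ⟨g, hg, hgr⟩ := exists_slopeSq_eq_sq_mul hR hkR hcrit
  have hpos : ∀ r ∈ Icc R (R + 1), r ≠ 0 := fun r hr => (hR.1.trans_le hr.1).ne'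
  have hcont : ContinuousOn (fun r => √(g r / r ^ 4)) (Icc R (R + 1)) :=
    (hg.continuousOn.div (by fun_prop) fun r hr => pow_ne_zero 4 (hpos r hr)).sqrt
  obtain ⟨B, hB⟩ := isCompact_Icc.bddAbove_image hcont
  refine ⟨B, fun r hr => ?_⟩
  have hr' := Ioc_subset_Icc_self hr
  have h0 := sub_pos.2 hr.1
  rw [hgr r (hpos r hr'), Real.sqrt_mul (sq_nonneg _), Real.sqrt_sq h0.le, mul_comm]
  exact mul_le_mul_of_nonneg_right (hB (mem_image_of_mem _ hr')) h0.le

/-- At a double zero √(S²) is |r − R| times a bounded factor, while w and h have nonzero limits, so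
dt/dr is at least a constant times 1/|r − R|, which is not integrable. -/
theorem not_f4FiniteAt_of_critical (hR : R ∈ Ioo 0 (2 * M)) (hkR : kTilde M H R = c)
    (hcrit : 3 * M - 2 * R = 3 * H * √(R ^ 3 * (2 * M - R)))
    (hk : ∀ r ∈ Ioo 0 (2 * M), r ≠ R → kTilde M H r < c) : ¬F4FiniteAt M H c R := by
  rintro ⟨s, -, hsR, -, hint⟩
  refine not_intervalIntegrable_of_sub_inv_isBigO_punctured ?_ hsR.symm left_mem_uIcc hint
  obtain ⟨g, hg, hgr⟩ := exists_slopeSq_eq_sq_mul hR hkR hcrit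
  have hR0 := hR.1.ne'
  have hwR : (H * R ^ 3 + c) / R ^ 2 ≠ 0 := by
    rw [turning_eq hkR]
    exact (div_pos (Real.sqrt_pos.2 (kTilde_radicand_pos hR)) (pow_pos hR.1 2)).ne'
  -- This function is the quotient of 1/|x − R| by `f4slope` near R. Only an upper bound for it is
  -- needed, so the value of g at R may be arbitrary.
  have hφ : ContinuousAt (fun x => √(g x / x ^ 4) * ((2 * M / x - 1) / ((H * x ^ 3 + c) / x ^ 2)))
      R := by
    have h2 : R ^ 2 ≠ 0 := pow_ne_zero 2 hR0
    have h4 : R ^ 4 ≠ 0 := pow_ne_zero 4 hR0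
    have hgR := hg.continuousAt (x := R)
    fun_prop (disch := assumption)
  obtain ⟨C, hC⟩ :=
    exists_gt (√(g R / R ^ 4) * ((2 * M / R - 1) / ((H * R ^ 3 + c) / R ^ 2)))
  refine Asymptotics.IsBigO.of_bound C ?_
  filter_upwards [self_mem_nhdsWithin, nhdsWithin_le_nhds (Ioo_mem_nhds hR.1 hR.2),
    nhdsWithin_le_nhds (hφ.eventually (gt_mem_nhds hC))] with x hxR hx hlt
  obtain ⟨hP, hw⟩ := slopeSq_pos_of_kTilde_lt hx (hk x hx hxR)
  have hh : 0 < -hS M x := neg_pos.2 (hS_neg hx)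
  have hd : 0 < |x - R| := abs_pos.2 (sub_ne_zero.2 hxR)
  have hs : √(slopeSq M H c x) = |x - R| * √(g x / x ^ 4) := by
    rw [hgr x hx.1.ne', Real.sqrt_mul (sq_nonneg _), Real.sqrt_sq_eq_abs]
  have hsq := Real.sqrt_pos.2 hP
  have hf : f4slope M H c x = boostRate H c x / (-hS M x * √(slopeSq M H c x)) := by
    rw [f4slope_eq hx hP hw, timeSlope, neg_mul, div_neg]
  have hf0 : 0 < f4slope M H c x := by
    rw [hf]
    positivity
  rw [norm_inv, Real.norm_eq_abs, Real.norm_eq_abs, abs_of_pos hf0]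
  refine le_trans (le_of_eq ?_) (mul_le_mul_of_nonneg_right hlt.le hf0.le)
  have hh' : 2 * M / x - 1 = -hS M x := by
    unfold hS
    ring
  rw [hs] at hsq
  have hg0 : 0 < √(g x / x ^ 4) := pos_of_mul_pos_right hsq hd.le
  rw [hh', ← boostRate_eq_div hx.1.ne', hf, hs]
  have := hw.ne'
  have := hh.ne'
  have := hg0.ne'
  have := hd.ne'
  generalize √(g x / x ^ 4) = A at *
  generalize boostRate H c x = B at *
  generalize |x - R| = D at *
  generalize -hS M x = E at *
  field_simp

end Critical

/-! ### The part of the domain of f₄ that reaches up to r = 2M. -/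

section OuterDomain

variable {M H c r₀ : ℝ}

theorem f4OuterDomain_of_forall_lt (hk : ∀ r ∈ Ioo 0 (2 * M), kTilde M H r < c) :
    f4OuterDomain M H c = Ioo 0 (2 * M) := by
  ext r
  refine ⟨fun h => h.1, fun h => ⟨h, fun x hx => ?_⟩⟩
  have hx' : x ∈ Ioo 0 (2 * M) := ⟨h.1.trans_le hx.1, hx.2⟩
  exact ⟨hx', Or.inl (hk x hx')⟩

theorem f4OuterDomain_eq_Ioo (hr₀ : r₀ ∈ Ioo 0 (2 * M))
    (hk : ∀ r ∈ Ioo r₀ (2 * M), kTilde M H r < c) (h : r₀ ∉ f4Domain M H c) :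
    f4OuterDomain M H c = Ioo r₀ (2 * M) := by
  ext r
  refine ⟨fun hr => ⟨?_, hr.1.2⟩, fun hr => ⟨⟨hr₀.1.trans hr.1, hr.2⟩, fun x hx => ?_⟩⟩
  · by_contra hlt
    exact h (hr.2 ⟨not_lt.1 hlt, hr₀.2⟩)
  · have hx' : x ∈ Ioo r₀ (2 * M) := ⟨hr.1.trans_le hx.1, hx.2⟩
    exact ⟨⟨hr₀.1.trans hx'.1, hx.2⟩, Or.inl (hk x hx')⟩

theorem f4OuterDomain_eq_Ico {R : ℝ} (hR : 0 < R) (hRr : R < r₀) (hr₀ : r₀ < 2 * M)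
    (hk : ∀ r ∈ Ioo r₀ (2 * M), kTilde M H r < c) (h : r₀ ∈ f4Domain M H c)
    (hgt : ∀ r ∈ Ico R r₀, c < kTilde M H r) : f4OuterDomain M H c = Ico r₀ (2 * M) := by
  ext r
  refine ⟨fun hr => ⟨?_, hr.1.2⟩, fun hr => ⟨⟨(hR.trans hRr).trans_le hr.1, hr.2⟩, fun x hx => ?_⟩⟩
  · by_contra hlt
    -- The maximum keeps the test point in [R, r₀), where `kTilde` exceeds c, even if r lies below
    -- R.
    have hmax : max r R < r₀ := max_lt (not_le.1 hlt) hRr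
    have h1 := hgt _ ⟨le_max_right r R, hmax⟩
    rcases (hr.2 ⟨le_max_left r R, hmax.trans hr₀⟩).2 with h2 | h2
    · exact lt_asymm h1 h2
    · exact h1.ne' h2.1
  · rcases (hr.1.trans hx.1).eq_or_lt with rfl | hlt
    · exact h
    · exact ⟨⟨(hR.trans hRr).trans hlt, hx.2⟩, Or.inl (hk x ⟨hlt, hx.2⟩)⟩

end OuterDomain

/-! ### The trichotomy in c₁. -/

theorem theorem2 (M H c₁ cbar₁ r₁ : ℝ) (hM : 0 < M) (hc₁ : -8 * M ^ 3 * H < c₁)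
    (hr₁ : 2 * M < r₁) :
    ∃ R : ℝ, IsPeak M H R ∧
      -- (a) `c₁ > C_H`
      (kTilde M H R < c₁ →
        f4OuterDomain M H c₁ = Set.Ioo 0 (2 * M) ∧
        ∀ r₄ ∈ Set.Ioo 0 (2 * M), ∃ cbar₄ a : ℝ, 0 < a ∧
          JoinSmoothly M H (Sigma1 M H c₁ r₁ cbar₁) (sphereOver (-a) a)
            (Sigma4dec M H c₁ r₄ cbar₄) ∧
          IsCompleteSSCMCWithTwoEnds M H
            (Sigma1 M H c₁ r₁ cbar₁ ∪ sphereOver (-a) a ∪ Sigma4dec M H c₁ r₄ cbar₄)) ∧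
      -- (b) `c₁ = C_H`
      (c₁ = kTilde M H R →
        f4OuterDomain M H c₁ = Set.Ioo R (2 * M) ∧
        ∀ r₄ ∈ Set.Ioo R (2 * M), ∃ cbar₄ a : ℝ, 0 < a ∧
          JoinSmoothly M H (Sigma1 M H c₁ r₁ cbar₁) (sphereOver (-a) a)
            (Sigma4dec M H c₁ r₄ cbar₄) ∧
          IsCompleteSSCMCWithTwoEnds M H
            (Sigma1 M H c₁ r₁ cbar₁ ∪ sphereOver (-a) a ∪ Sigma4dec M H c₁ r₄ cbar₄)) ∧
      -- (c) `c₁ < C_H`; here `Σ⁴` consists of the two branches that meet at `r = r''`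
      (c₁ < kTilde M H R →
        ∃ r'' ∈ Set.Ioo R (2 * M), kTilde M H r'' = c₁ ∧
          f4OuterDomain M H c₁ = Set.Ico r'' (2 * M) ∧
          ∀ r₃ : ℝ, 2 * M < r₃ → ∃ cbar₄ cbar₃ a b : ℝ, 0 < a ∧ 0 < b ∧
            JoinSmoothly M H (Sigma1 M H c₁ r₁ cbar₁) (sphereOver (-a) a)
              (Sigma4inc M H c₁ r'' cbar₄ ∪ Sigma4dec M H c₁ r'' cbar₄) ∧
            JoinSmoothly M H (Sigma4inc M H c₁ r'' cbar₄ ∪ Sigma4dec M H c₁ r'' cbar₄)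
              (sphereOver (-b) (-b)) (Sigma3 M H c₁ r₃ cbar₃) ∧
            IsCompleteSSCMCWithTwoEnds M H
              (Sigma1 M H c₁ r₁ cbar₁ ∪ sphereOver (-a) a ∪
                (Sigma4inc M H c₁ r'' cbar₄ ∪ Sigma4dec M H c₁ r'' cbar₄) ∪
                sphereOver (-b) (-b) ∪ Sigma3 M H c₁ r₃ cbar₃)) := by
  obtain ⟨R, hR, hcrit, hmono, hanti⟩ := exists_peak hM H
  have hpeak := isPeak_of hR hcrit hmono hanti
  have hcrit' : 3 * M - 2 * R = 3 * H * √(R ^ 3 * (2 * M - R)) :=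
    (div_eq_iff (Real.sqrt_pos.2 (kTilde_radicand_pos hR)).ne').1 hcrit
  refine ⟨R, hpeak, fun hc => ?_, fun hc => ?_, fun hc => ?_⟩
  · have hk : ∀ r ∈ Ioo 0 (2 * M), kTilde M H r < c₁ := fun r hr => by
      rcases eq_or_ne r R with rfl | hne
      · exact hc
      · exact (hpeak.2.2 r hr hne).trans hc
    have hdom := f4OuterDomain_of_forall_lt hk
    exact ⟨hdom, fun r₄ hr₄ => two_ended_of_single_branch hM hc₁ le_rfl (by linarith) hk
      (Or.inl rfl) hdom hr₁ hr₄⟩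
  · have hk : ∀ r ∈ Ioo 0 (2 * M), r ≠ R → kTilde M H r < c₁ := fun r hr hne => by
      rw [hc]
      exact hpeak.2.2 r hr hne
    have hk' : ∀ r ∈ Ioo R (2 * M), kTilde M H r < c₁ := fun r hr =>
      hk r ⟨hR.1.trans hr.1, hr.2⟩ hr.1.ne'
    have hdom : f4OuterDomain M H c₁ = Ioo R (2 * M) := by
      refine f4OuterDomain_eq_Ioo hR hk' fun h => ?_
      rcases h.2 with h | h
      · exact h.ne hc.symm
      · exact not_f4FiniteAt_of_critical hR hc.symm hcrit' hk h.2
    exact ⟨hdom, fun r₄ hr₄ => two_ended_of_single_branch hM hc₁ hR.1.le hR.2 hk'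
      (Or.inr (exists_sqrt_slopeSq_le hR hc.symm hcrit')) hdom hr₁ hr₄⟩
  -- From C_H at R to −8M³H at 2M, `kTilde` takes the intermediate value c₁; strict decrease there
  -- makes c₁ exceed `kTilde` to the right of a and lie below it on [R, a).
  · obtain ⟨a, ha, hka⟩ := intermediate_value_Ioo' hR.2.le
      (continuous_kTilde (M := M) (H := H)).continuousOn
      (show c₁ ∈ Ioo _ _ from ⟨kTilde_two_mul.trans_lt hc₁, hc⟩)
    have ha0 : a ∈ Ioo 0 (2 * M) := ⟨hR.1.trans ha.1, ha.2⟩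
    have hk : ∀ r ∈ Ioo a (2 * M), kTilde M H r < c₁ := fun r hr => by
      rw [← hka]
      exact hanti ⟨ha.1.le, ha.2.le⟩ ⟨(ha.1.trans hr.1).le, hr.2.le⟩ hr.1
    have hgt : ∀ r ∈ Ico R a, c₁ < kTilde M H r := fun r hr => by
      rw [← hka]
      exact hanti ⟨hr.1, (hr.2.trans ha.2).le⟩ ⟨ha.1.le, ha.2.le⟩ hr.2
    have hcrita : 3 * M - 2 * a < 3 * H * √(a ^ 3 * (2 * M - a)) := by
      have h := strictAntiOn_kTilde_slope hR ha0 ha.1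
      beta_reduce at h
      rwa [hcrit, div_lt_iff₀ (Real.sqrt_pos.2 (kTilde_radicand_pos ha0))] at h
    have hdom := f4OuterDomain_eq_Ico hR.1 ha.1 ha.2 hk
      ⟨ha0, Or.inr ⟨hka, f4FiniteAt_turning hM hc₁ ha0 hka hcrita hk⟩⟩ hgt
    exact ⟨a, ha, hka, hdom, fun r₃ hr₃ =>
      two_ended_of_two_branches hM hc₁ ha0 hka hcrita hk hdom hr₁ hr₃⟩
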